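/- **Messages.** Fix a signature of function symbols (with arities); messages $M,N,K$ are the first-order terms over it and over a countably infinite set of variables. Names are variables. Fix any set of equations between messages and let $=_E$ be the equational theory it generates (the least congruence containing all substitution instances of the equations). Write $\mathrm{fv}$ for free variables. A substitution $\sigma$ is the identity outside a finite set $\mathrm{dom}(\sigma)=\{y : y\sigma\neq y\}$; it is idempotent if $\mathrm{fv}(y\sigma)\cap\mathrm{dom}(\sigma)=\emptyset$ for all $y$, and *fresh for* a set of variables $\mathcal E$ if $\mathrm{dom}(\sigma)\cap\mathcal E=\emptyset$ and $\mathrm{fv}(y\sigma)\cap\mathcal E=\emptyset$ for all $y\notin\mathcal E$. Write $\mathcal E\vDash M\neq N$ if there is no $\sigma$ fresh for $\mathcal E$ with $M\sigma=_E N\sigma$. **Processes.** $P,Q ::= 0 \mid \overline{M}\langle N\rangle.P \mid M(y).P \mid [M=N]P \mid [M\neq N]P \mid \nu x.P \mid P\,|\,Q \mid P+Q \mid {!P}$, where $M(y).P$ and $\nu y.P$ bind $y$ in $P$; processes are taken up to $\alpha$-conversion. Extended processes (in normal form) are $A,B::=\nu\vec x.(\sigma\,|\,P)$, up to $\alpha$-conversion,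 where the variables in $\mathrm{dom}(\sigma)$ occur neither in $\vec x$ nor in $\mathrm{fv}(P)$ nor in any $\mathrm{fv}(y\sigma)$; $\mathrm{dom}(\sigma)$ counts as free in $A$ and is called the domain of $A$. A process $P$ is identified with the extended process $\mathrm{id}\,|\,P$. Composition is $(\nu z.A)\,|\,Q=\nu z.(A\,|\,Q)$, $Q\,|\,\nu z.A=\nu z.(Q\,|\,A)$, $\rho\,|\,\nu z.A=\nu z.(\rho\,|\,A)$ for $z$ not free in $Q,\rho$, together with $(\sigma\,|\,P)\,|\,Q=\sigma\,|\,(P\,|\,Q)$, $Q\,|\,(\sigma\,|\,P)=\sigma\,|\,(Q\,|\,P)$ and, for disjoint domains, $\sigma\,|\,(\theta\,|\,Q)=(\sigma\cdot\theta)\,|\,Q$ with $\sigma\cdot\theta$ the union. **Transitions.** Actions are $\pi ::= \tau \mid \overline M(z) \mid M\,N$, with bound names $\mathrm{bn}(\overline M(z))=\{z\}$ and $\mathrm{bn}(\pi)=\emptyset$ otherwise; $\mathrm n(\pi)$ is the set of all variables of $\pi$. The relation $\mathcal E : A\xrightarrow{\pi}B$, for a set of variables $\mathcal E$, is the least one closed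 under the following rules. * $\mathcal E: M(x).P\xrightarrow{M'\,N}P\{N/x\}$ if $M=_EM'$. * $\mathcal E:\overline M\langle N\rangle.P\xrightarrow{\overline{M'}(x)}\{N/x\}\,|\,P$ if $M=_EM'$ and $x\notin\mathrm{fv}(M)\cup\mathrm{fv}(M')\cup\mathrm{fv}(N)\cup\mathrm{fv}(P)\cup\mathcal E$. * If $\mathcal E:P\xrightarrow{\pi}A$, then $\mathcal E:P+Q\xrightarrow{\pi}A$ and $\mathcal E:Q+P\xrightarrow{\pi}A$; also $\mathcal E:[M=N]P\xrightarrow{\pi}A$ if $M=_EN$; also $\mathcal E:[M\neq N]P\xrightarrow{\pi}A$ if $\mathcal E\vDash M\neq N$; also $\mathcal E:P\,|\,Q\xrightarrow{\pi}A\,|\,Q$ and $\mathcal E:Q\,|\,P\xrightarrow{\pi}Q\,|\,A$ if $\mathrm{bn}(\pi)\cap\mathrm{fv}(Q)=\emptyset$; also $\mathcal E:{!P}\xrightarrow{\pi}A\,|\,{!P}$ if $\mathrm{bn}(\pi)\cap\mathrm{fv}(P)=\emptyset$. * If $\mathcal E,x:A\xrightarrow{\pi}B$ and $x\notin\mathrm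 n(\pi)\cup\mathcal E$, then $\mathcal E:\nu x.A\xrightarrow{\pi}\nu x.B$ (for processes and extended processes). * If $\mathcal E:P\xrightarrow{\pi\sigma}A$ and $\sigma$ is fresh for $\mathrm{bn}(\pi)$, then $\mathcal E:\sigma\,|\,P\xrightarrow{\pi}\sigma\,|\,A$. * If $\mathcal E:P\xrightarrow{\overline M(x)}\nu\vec z.(\{N/x\}\,|\,P')$, $\mathcal E:Q\xrightarrow{M'\,N}Q'$, $M=_EM'$ and $(\{x\}\cup\vec z)\cap\mathrm{fv}(Q)=\emptyset$, then $\mathcal E:P\,|\,Q\xrightarrow{\tau}\nu\vec z.(P'\,|\,Q')$, and symmetrically $\mathcal E:Q\,|\,P\xrightarrow{\tau}\nu\vec z.(Q'\,|\,P')$. * If $\mathcal E:P\xrightarrow{\overline M(x)}\nu\vec z.(\{N/x\}\,|\,Q)$, $\mathcal E:P\xrightarrow{M'\,N}R$, $M=_EM'$ and $\vec z\cap\mathrm{fv}(P)=\emptyset$, then $\mathcal E:{!P}\xrightarrow{\tau}\nu\vec z.(Q\,|\,R\,|\,{!P})$. Here $\vec z$ is not free in $\mathcal E$ or $M$. Write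 $A\xrightarrow{\pi}B$ for $\emptyset:A\xrightarrow{\pi}B$. **Open barbed bisimilarity.** A process $P$ has barb $M$ if $P\xrightarrow{\overline M(z)}A$ or $P\xrightarrow{M\,N}A$ for some $z,N,A$. An open barbed bisimulation is a symmetric relation $\mathcal R$ on processes such that $P\,\mathcal R\,Q$ implies: (i) $\mathcal C\{P\}\,\mathcal R\,\mathcal C\{Q\}$ for all one-hole process contexts $\mathcal C$ (which may bind free variables of $P$ and $Q$); (ii) every barb of $P$ is a barb of $Q$; (iii) if $P\xrightarrow{\tau}P'$, then $Q\xrightarrow{\tau}Q'$ for some $Q'$ with $P'\,\mathcal R\,Q'$ (a residual $\nu\vec z.(\mathrm{id}\,|\,P_0)$ being read as the process $\nu\vec z.P_0$). Open barbed bisimilarity $\simeq$ is the greatest open barbed bisimulation. **Quasi-open bisimilarity.** $\nu\vec x.(\sigma\,|\,P)$ and $\nu\vec y.(\theta\,|\,Q)$ are statically equivalent if, for all messages $M,N$ with $(\mathrm{fv}(M)\cup\mathrm{fv}(N))\cap(\vec x\cup\vec y)=\emptyset$, $M\sigma=_EN\sigma$ iff $M\theta=_EN\theta$. For $A=\nu\vec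 x.(\theta\,|\,P)$ write $A\le_{\sigma,\nu\vec z.\rho}B$ if $\sigma,\rho$ are idempotent and fresh for $\mathrm{dom}(\theta)$, $\vec z\cap(\mathrm{dom}(\rho)\cup\mathrm{dom}(\theta))=\emptyset$ and $B=\nu\vec z.(\rho\,|\,A\sigma\rho)$ (with capture-avoiding substitution; $\nu\vec z$ binds). A relation $\mathcal R$ on extended processes is open if $A\,\mathcal R\,B$, $A\le_{\sigma,\nu\vec z.\rho}A'$ and $B\le_{\sigma,\nu\vec z.\rho}B'$ imply $A'\,\mathcal R\,B'$. A quasi-open bisimulation is an open symmetric relation $\mathcal R$ on extended processes such that $A\,\mathcal R\,B$ implies that $A$ and $B$ are statically equivalent and that, whenever $A\xrightarrow{\pi}A'$ with $\mathrm{bn}(\pi)$ not free in $A$ or $B$, there is $B'$ with $B\xrightarrow{\pi}B'$ and $A'\,\mathcal R\,B'$. Quasi-open bisimilarity $\sim$ is the greatest quasi-open bisimulation. **Corollary (soundness).** For every signature and equational theory and for all processes $P,Q$: if $P\sim Q$, then $P\simeq Q$. -/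

import Mathlib

universe u v

/-! The applied pi-calculus over an arbitrary message signature and equational theory.

Variables (which also play the role of names) are natural numbers. Processes are taken up to
alpha-conversion: bound variables are de Bruijn indices, so that underneath `n` binders the index
`i < n` is bound, and the index `y + n` is the free variable `y`. -/

namespace AppliedPi

open Set

section Messages

variable {L : FirstOrder.Language.{u, v}}

/-- The equational theory generated by a set of equations: the least congruence on messages that
contains all substitution instances of the equations. -/
inductive EqTheory (Ax : Set (L.Term ℕ × L.Term ℕ)) : L.Term ℕ → L.Term ℕ → Prop
  | ax {M N : L.Term ℕ} (h : (M, N) ∈ Ax) (τ : ℕ → L.Term ℕ) :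
      EqTheory Ax (M.subst τ) (N.subst τ)
  | refl (M : L.Term ℕ) : EqTheory Ax M M
  | symm {M N : L.Term ℕ} : EqTheory Ax M N → EqTheory Ax N M
  | trans {M N K : L.Term ℕ} : EqTheory Ax M N → EqTheory Ax N K → EqTheory Ax M K
  | app {l : ℕ} (f : L.Functions l) {Ms Ns : Fin l → L.Term ℕ} :
      (∀ i, EqTheory Ax (Ms i) (Ns i)) →
      EqTheory Ax (FirstOrder.Language.Term.func f Ms) (FirstOrder.Language.Term.func f Ns)

/-- The variables of a message. -/
def fvT (M : L.Term ℕ) : Set ℕ := ↑M.varFinset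

/-- Weakening of a message by `k` binders. -/
def shiftT (k : ℕ) (M : L.Term ℕ) : L.Term ℕ := M.relabel (fun y => y + k)

/-- The domain of a substitution. -/
def domS (σ : ℕ → L.Term ℕ) : Set ℕ := {y | σ y ≠ FirstOrder.Language.Term.var y}

/-- `σ` is idempotent: no variable of its domain occurs in its range. -/
def Idempotent (σ : ℕ → L.Term ℕ) : Prop := ∀ y, Disjoint (fvT (σ y)) (domS σ)

/-- `σ` is fresh for the set of variables `E`. -/
def FreshFor (σ : ℕ → L.Term ℕ) (E : Set ℕ) : Prop :=
  Disjoint (domS σ) E ∧ ∀ y, y ∉ E → Disjoint (fvT (σ y)) E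

/-- The entailment `E ⊨ M ≠ N`: no (finite) substitution fresh for `E` unifies `M` and `N`. -/
def EntailsNe (Ax : Set (L.Term ℕ × L.Term ℕ)) (E : Set ℕ) (M N : L.Term ℕ) : Prop :=
  ¬ ∃ σ : ℕ → L.Term ℕ, (domS σ).Finite ∧ FreshFor σ E ∧
      EqTheory Ax (M.subst σ) (N.subst σ)

/-- The action of a substitution underneath `n` binders (capture avoiding). -/
def liftS (n : ℕ) (σ : ℕ → L.Term ℕ) : ℕ → L.Term ℕ :=
  fun i => if i < n then FirstOrder.Language.Term.var i else shiftT n (σ (i - n))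

/-- Abstraction of the variable `z`: it becomes index `0` of a new binder. -/
def bindS (z : ℕ) : ℕ → L.Term ℕ :=
  fun y => if y = z then FirstOrder.Language.Term.var 0 else FirstOrder.Language.Term.var (y + 1)

/-- Instantiation of index `0` of a removed binder by the message `N`. -/
def instS (N : L.Term ℕ) : ℕ → L.Term ℕ
  | 0 => N
  | y + 1 => FirstOrder.Language.Term.var y

end Messages

/-- Processes. `inp M P` and `new P` bind index `0` in `P`. -/
inductive Proc (L : FirstOrder.Language.{u, v}) : Type u
  | nil : Proc L
  | out : L.Term ℕ → L.Term ℕ → Proc L → Proc L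
  | inp : L.Term ℕ → Proc L → Proc L
  | mat : L.Term ℕ → L.Term ℕ → Proc L → Proc L
  | mis : L.Term ℕ → L.Term ℕ → Proc L → Proc L
  | new : Proc L → Proc L
  | par : Proc L → Proc L → Proc L
  | plus : Proc L → Proc L → Proc L
  | rep : Proc L → Proc L

/-- Actions: `τ`, the bound output of `z` on `M`, and the free input of `N` on `M`. -/
inductive Act (L : FirstOrder.Language.{u, v}) : Type u
  | tau : Act L
  | out : L.Term ℕ → ℕ → Act L
  | inp : L.Term ℕ → L.Term ℕ → Act L

/-- Extended processes `ν x₁ … ν xₙ. (σ ∣ P)`. The message `act y` is `y σ` for a free variable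
`y` of the extended process; `act y` and `proc` live underneath the `n` binders. -/
structure Ext (L : FirstOrder.Language.{u, v}) : Type u where
  n : ℕ
  act : ℕ → L.Term ℕ
  proc : Proc L

section Operations

variable {L : FirstOrder.Language.{u, v}}

namespace Proc

/-- Capture-avoiding substitution. -/
def subst : Proc L → (ℕ → L.Term ℕ) → Proc L
  | nil, _ => nil
  | out M N P, σ => out (M.subst σ) (N.subst σ) (P.subst σ)
  | inp M P, σ => inp (M.subst σ) (P.subst (liftS 1 σ))
  | mat M N P, σ => mat (M.subst σ) (N.subst σ) (P.subst σ)
  | mis M N P, σ => mis (M.subst σ) (N.subst σ) (P.subst σ)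
  | new P, σ => new (P.subst (liftS 1 σ))
  | par P Q, σ => par (P.subst σ) (Q.subst σ)
  | plus P Q, σ => plus (P.subst σ) (Q.subst σ)
  | rep P, σ => rep (P.subst σ)

/-- Free variables. -/
def fv : Proc L → Set ℕ
  | nil => ∅
  | out M N P => fvT M ∪ fvT N ∪ P.fv
  | inp M P => fvT M ∪ {y | y + 1 ∈ P.fv}
  | mat M N P => fvT M ∪ fvT N ∪ P.fv
  | mis M N P => fvT M ∪ fvT N ∪ P.fv
  | new P => {y | y + 1 ∈ P.fv}
  | par P Q => P.fv ∪ Q.fv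
  | plus P Q => P.fv ∪ Q.fv
  | rep P => P.fv

/-- Weakening by `k` binders. -/
def shift (k : ℕ) (P : Proc L) : Proc L := P.subst (fun y => FirstOrder.Language.Term.var (y + k))

/-- `k` restrictions in front of a process. -/
def newN (k : ℕ) (P : Proc L) : Proc L := Proc.new^[k] P

/-- `ν z. P` for a named variable `z`, which is bound in `P`. -/
def nu (z : ℕ) (P : Proc L) : Proc L := new (P.subst (bindS z))

/-- `M(x). P` for a named variable `x`, which is bound in `P`. -/
def input (M : L.Term ℕ) (x : ℕ) (P : Proc L) : Proc L := inp M (P.subst (bindS x))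

end Proc

namespace Act

/-- Bound names of an action. -/
def bn : Act L → Set ℕ
  | tau => ∅
  | out _ z => {z}
  | inp _ _ => ∅

/-- Application of a substitution (fresh for the bound names) to an action. -/
def subst : Act L → (ℕ → L.Term ℕ) → Act L
  | tau, _ => tau
  | out M z, σ => out (M.subst σ) z
  | inp M N, σ => inp (M.subst σ) (N.subst σ)

/-- Weakening by one binder; the new variable `0` is not a name of the weakened action. -/
def shift : Act L → Act L
  | tau => tau
  | out M z => out (shiftT 1 M) (z + 1)
  | inp M N => inp (shiftT 1 M) (shiftT 1 N)

end Act

/-- The identity active substitution underneath `n` binders. -/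
def idAct (n : ℕ) : ℕ → L.Term ℕ := fun y => FirstOrder.Language.Term.var (y + n)

/-- The active substitution of `x` by `N` underneath `n` binders. -/
def singleAct (n : ℕ) (x : ℕ) (N : L.Term ℕ) : ℕ → L.Term ℕ :=
  fun y => if y = x then N else FirstOrder.Language.Term.var (y + n)

namespace Ext

/-- A process, seen as an extended process with the identity substitution. -/
def ofProc (P : Proc L) : Ext L := ⟨0, idAct 0, P⟩

/-- The domain of the active substitution. -/
def dom (A : Ext L) : Set ℕ := {y | A.act y ≠ FirstOrder.Language.Term.var (y + A.n)}

/-- Free variables; those in the domain of the active substitution are included. -/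
def fv (A : Ext L) : Set ℕ :=
  A.dom ∪ {w | ∃ y ∈ A.dom, w + A.n ∈ fvT (A.act y)} ∪ {w | w + A.n ∈ A.proc.fv}

/-- The normal form restriction: the active substitution is finite and idempotent, and it is fully
applied to the process. (That its domain avoids the `n` restricted variables is automatic.) -/
def Normal (A : Ext L) : Prop :=
  A.dom.Finite ∧
    ∀ y ∈ A.dom, y + A.n ∉ A.proc.fv ∧ ∀ w, y + A.n ∉ fvT (A.act w)

/-- `A ∣ Q`. -/
def parR (A : Ext L) (Q : Proc L) : Ext L := ⟨A.n, A.act, A.proc.par (Q.shift A.n)⟩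

/-- `Q ∣ A`. -/
def parL (Q : Proc L) (A : Ext L) : Ext L := ⟨A.n, A.act, (Q.shift A.n).par A.proc⟩

/-- `k` restrictions, of the variables `0, …, k - 1`, in front of an extended process whose
active substitution does not affect these; the other variables `y + k` become `y`. -/
def newN (k : ℕ) (A : Ext L) : Ext L := ⟨A.n + k, fun y => A.act (y + k), A.proc⟩

/-- `ν z. A` for a named variable `z` outside the domain of `A`. -/
def nu (z : ℕ) (A : Ext L) : Ext L where
  n := A.n + 1
  act := fun y => if y = z then FirstOrder.Language.Term.var (y + (A.n + 1))
    else (A.act y).subst (liftS A.n (bindS z))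
  proc := A.proc.subst (liftS A.n (bindS z))

/-- `σ ∣ A`. Wherever it is used, `σ` is fresh for the domain of the active substitution `θ` of `A`,
and then the composition `y ↦ (y σ) θ` is the union of the two substitutions. -/
def withSubst (σ : ℕ → L.Term ℕ) (A : Ext L) : Ext L := ⟨A.n, fun y => (σ y).subst A.act, A.proc⟩

open Classical in
/-- `A σ`, for `σ` fresh for the domain of `A`: the substitution applies to the range of the
active substitution and to the process. -/
noncomputable def subst (A : Ext L) (σ : ℕ → L.Term ℕ) : Ext L where
  n := A.n
  act := fun y => if y ∈ A.dom then (A.act y).subst (liftS A.n σ)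
    else FirstOrder.Language.Term.var (y + A.n)
  proc := A.proc.subst (liftS A.n σ)

end Ext

/-- Process contexts with one hole; the named variable of `inp` and `new` is bound, in particular
in whatever is put into the hole. -/
inductive Ctx (L : FirstOrder.Language.{u, v}) : Type u
  | hole : Ctx L
  | out : L.Term ℕ → L.Term ℕ → Ctx L → Ctx L
  | inp : L.Term ℕ → ℕ → Ctx L → Ctx L
  | mat : L.Term ℕ → L.Term ℕ → Ctx L → Ctx L
  | mis : L.Term ℕ → L.Term ℕ → Ctx L → Ctx L
  | new : ℕ → Ctx L → Ctx L
  | parL : Ctx L → Proc L → Ctx L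
  | parR : Proc L → Ctx L → Ctx L
  | plusL : Ctx L → Proc L → Ctx L
  | plusR : Proc L → Ctx L → Ctx L
  | rep : Ctx L → Ctx L

/-- The process `C{P}`. -/
def Ctx.fill : Ctx L → Proc L → Proc L
  | hole, P => P
  | out M N C, P => Proc.out M N (C.fill P)
  | inp M x C, P => Proc.input M x (C.fill P)
  | mat M N C, P => Proc.mat M N (C.fill P)
  | mis M N C, P => Proc.mis M N (C.fill P)
  | new x C, P => Proc.nu x (C.fill P)
  | parL C Q, P => Proc.par (C.fill P) Q
  | parR Q C, P => Proc.par Q (C.fill P)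
  | plusL C Q, P => Proc.plus (C.fill P) Q
  | plusR Q C, P => Proc.plus Q (C.fill P)
  | rep C, P => Proc.rep (C.fill P)

end Operations

section Semantics

variable {L : FirstOrder.Language.{u, v}} (Ax : Set (L.Term ℕ × L.Term ℕ))

/-- The environment `E, x` in the scope of a restriction of `x`, where `x` is the index `0`. -/
def extendEnv (E : Set ℕ) : Set ℕ := insert 0 ((fun y => y + 1) '' E)

/-- The open early labelled transitions `E : P ⟶π A` of processes. In the communication rules the
`k` private names extruded by the sender are the variables `0, …, k - 1` on the side of the
receiver, which is weakened accordingly. -/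
inductive Step : Set ℕ → Proc L → Act L → Ext L → Prop
  | inp {E M M' P} (N : L.Term ℕ) (hM : EqTheory Ax M M') :
      Step E (Proc.inp M P) (Act.inp M' N) (Ext.ofProc (P.subst (instS N)))
  | out {E M M' N P x} (hM : EqTheory Ax M M')
      (hx : x ∉ fvT M ∪ fvT M' ∪ fvT N ∪ P.fv ∪ E) :
      Step E (Proc.out M N P) (Act.out M' x) ⟨0, singleAct 0 x N, P⟩
  | sumL {E P Q π A} (h : Step E P π A) : Step E (Proc.plus P Q) π A
  | sumR {E P Q π A} (h : Step E Q π A) : Step E (Proc.plus P Q) π A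
  | mat {E M N P π A} (hM : EqTheory Ax M N) (h : Step E P π A) : Step E (Proc.mat M N P) π A
  | mis {E M N P π A} (h : Step E P π A) (hM : EntailsNe Ax E M N) :
      Step E (Proc.mis M N P) π A
  | res {E P π A} (h : Step (extendEnv E) P π.shift A) :
      Step E (Proc.new P) π (A.newN 1)
  | parL {E P Q π A} (h : Step E P π A) (hb : Disjoint π.bn Q.fv) :
      Step E (Proc.par P Q) π (A.parR Q)
  | parR {E P Q π A} (h : Step E Q π A) (hb : Disjoint π.bn P.fv) :
      Step E (Proc.par P Q) π (Ext.parL P A)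
  | repAct {E P π A} (h : Step E P π A) (hb : Disjoint π.bn P.fv) :
      Step E (Proc.rep P) π (A.parR (Proc.rep P))
  | closeL {E P Q M M' N x k P' B}
      (h₁ : Step E P (Act.out M x) ⟨k, singleAct k x N, P'⟩)
      (h₂ : Step ((fun y => y + k) '' E) (Q.shift k) (Act.inp M' N) B)
      (hM : EqTheory Ax (shiftT k M) M') (hx : x ∉ Q.fv) :
      Step E (Proc.par P Q) Act.tau ((Ext.parL P' B).newN k)
  | closeR {E P Q M M' N x k Q' B}
      (h₁ : Step E Q (Act.out M x) ⟨k, singleAct k x N, Q'⟩)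
      (h₂ : Step ((fun y => y + k) '' E) (P.shift k) (Act.inp M' N) B)
      (hM : EqTheory Ax (shiftT k M) M') (hx : x ∉ P.fv) :
      Step E (Proc.par P Q) Act.tau ((Ext.parR B Q').newN k)
  | repClose {E P M M' N x k Q B}
      (h₁ : Step E P (Act.out M x) ⟨k, singleAct k x N, Q⟩)
      (h₂ : Step ((fun y => y + k) '' E) (P.shift k) (Act.inp M' N) B)
      (hM : EqTheory Ax (shiftT k M) M') :
      Step E (Proc.rep P) Act.tau (((Ext.parL Q B).parR ((Proc.rep P).shift k)).newN k)

/-- The open early labelled transitions `E : A ⟶π B` of extended processes. -/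
inductive ExtStep : Set ℕ → Ext L → Act L → Ext L → Prop
  | active {E σ P π A} (h : Step Ax E P (π.subst σ) A) (hσ : FreshFor σ π.bn) :
      ExtStep E ⟨0, σ, P⟩ π (Ext.withSubst σ A)
  | res {E A π B} (h : ExtStep (extendEnv E) A π.shift B) (hA : 0 ∉ A.dom) :
      ExtStep E (A.newN 1) π (B.newN 1)

/-- `P ⟶τ P'` for processes: the identity substitution of the residual is dropped. -/
def TauStep (P P' : Proc L) : Prop :=
  ∃ (k : ℕ) (P₀ : Proc L), Step Ax ∅ P Act.tau ⟨k, idAct k, P₀⟩ ∧ P' = P₀.newN k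

/-- The process `P` has barb `M`. -/
def Barb (P : Proc L) (M : L.Term ℕ) : Prop :=
  (∃ z A, Step Ax ∅ P (Act.out M z) A) ∨ ∃ N A, Step Ax ∅ P (Act.inp M N) A

/-- Open barbed bisimulations. -/
structure IsOpenBarbedBisimulation (R : Proc L → Proc L → Prop) : Prop where
  symm : ∀ P Q, R P Q → R Q P
  context : ∀ P Q, R P Q → ∀ C : Ctx L, R (C.fill P) (C.fill Q)
  barb : ∀ P Q, R P Q → ∀ M, Barb Ax P M → Barb Ax Q M
  tau : ∀ P Q, R P Q → ∀ P', TauStep Ax P P' → ∃ Q', TauStep Ax Q Q' ∧ R P' Q'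

/-- Open barbed bisimilarity: the union of all open barbed bisimulations. -/
def OpenBarbedBisimilar (P Q : Proc L) : Prop :=
  ∃ R : Proc L → Proc L → Prop, IsOpenBarbedBisimulation Ax R ∧ R P Q

/-- Static equivalence. The recipes `M` and `N` range over messages in the free variables, hence
do not mention the restricted variables of `A` and `B`. -/
def StaticEquiv (A B : Ext L) : Prop :=
  ∀ M N : L.Term ℕ,
    EqTheory Ax (M.subst A.act) (N.subst A.act) ↔ EqTheory Ax (M.subst B.act) (N.subst B.act)

/-- `A` reaches `B = ν zs. (ρ ∣ A σ ρ)` by the substitution `σ` and the environment extension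
`zs. ρ`. -/
def Reach (σ : ℕ → L.Term ℕ) (zs : List ℕ) (ρ : ℕ → L.Term ℕ) (A B : Ext L) : Prop :=
  (domS σ).Finite ∧ (domS ρ).Finite ∧ Idempotent σ ∧ Idempotent ρ ∧
  FreshFor σ A.dom ∧ FreshFor ρ A.dom ∧ (∀ z ∈ zs, z ∉ domS ρ ∪ A.dom) ∧
  B = zs.foldr Ext.nu (Ext.withSubst ρ ((A.subst σ).subst ρ))

/-- Open relations: those preserved by reachability. -/
def IsOpenRel (R : Ext L → Ext L → Prop) : Prop :=
  ∀ A B, R A B → ∀ σ zs ρ A' B', Reach σ zs ρ A A' → Reach σ zs ρ B B' → R A' B'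

/-- Quasi-open bisimulations, as relations between extended processes in normal form. As usual for
labels with a bound variable, that variable is chosen fresh for both extended processes. -/
structure IsQuasiOpenBisimulation (R : Ext L → Ext L → Prop) : Prop where
  normal : ∀ A B, R A B → A.Normal ∧ B.Normal
  isOpen : IsOpenRel R
  symm : ∀ A B, R A B → R B A
  static : ∀ A B, R A B → StaticEquiv Ax A B
  step : ∀ A B, R A B → ∀ π A', ExtStep Ax ∅ A π A' → Disjoint π.bn (A.fv ∪ B.fv) →
    ∃ B', ExtStep Ax ∅ B π B' ∧ R A' B'

/-- Quasi-open bisimilarity: the union of all quasi-open bisimulations. -/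
def QuasiOpenBisimilar (A B : Ext L) : Prop :=
  ∃ R : Ext L → Ext L → Prop, IsQuasiOpenBisimulation Ax R ∧ R A B

end Semantics

end AppliedPi

/-! The content of the theorem is that quasi-open bisimilarity is preserved by all contexts. `Link`
relates extended processes that arise from bisimilar ones by a one-hole context, and `Chain` is its
reflexive transitive closure. `Link.sim` shows that a transition on one side of a link is matched on
the other side, with residuals related by a chain. Links are symmetric, so chains of links between
processes form an open barbed bisimulation: contexts are handled by `ProcLink.fill`, barbs and
silent steps are matched link by link. Chains are needed because one step may change several holes:
after a step of `!P` both the active copy and the remaining `!P` have to be exchanged.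

The central case is parallel composition. An extended process is viewed as a process together with
an interface, a family of messages known to its surroundings, and the component put beside it is a
recipe, a process instantiated by that interface. By `Tr.transfer`, a transition of a recipe under
one interface exists under any other interface that satisfies the equations and entailed
inequalities of the first (`Transferable`), and the residuals are instances of one recipe. Hence in
`Sim.par` the moves of the recipe are matched by the recipe itself. In a communication, a message
sent to the recipe becomes a new interface entry, and names extruded by the recipe become exposed
private names.

This forces an induction hypothesis that is stable under substitution of free names, new private
names and change of interface, the operations bundled in `Ext.map`. `Link.static_map` and
`Link.sim_map` therefore establish static equivalence and simulation for all maps at once. The base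
case is where openness enters: up to an injective renaming and a change of interface, every map of a
bisimilar pair is a reachable instance (`exists_reach`, `Bisim.static_map`, `Bisim.sim_map`).
Private names first appear as fresh free names, receive aliases through `ρ`, and are then
restricted. Openness also settles mismatch: an entailed inequality quantifies over substitutions,
and static equivalence of all instances carries a unifier from one side to the other
(`transferable_of_static`).

All of this is done for transitions `Tr` without bound names in labels; `Step.exists_tr` and
`Tr.toStep` relate them to the given semantics. -/

namespace AppliedPi

open Set
open FirstOrder.Language (Term)
open FirstOrder.Language.Term (var func)

/-! ### Algebra of substitutions under binders. -/

section Algebra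

variable {L : FirstOrder.Language.{u, v}}

theorem Term.subst_subst {α β γ : Type*} (M : L.Term α) (σ : α → L.Term β) (τ : β → L.Term γ) :
    (M.subst σ).subst τ = M.subst (fun i => (σ i).subst τ) := by
  induction M with
  | var => rfl
  | func f ts ih => simp [ih]

theorem Term.subst_var {α : Type*} (M : L.Term α) : M.subst var = M := by
  induction M with
  | var => rfl
  | func f ts ih => simp [ih]

theorem relabel_eq_subst {α β : Type*} (M : L.Term α) (g : α → β) :
    M.relabel g = M.subst (fun i => var (g i)) := by
  induction M with
  | var => rfl
  | func f ts ih => simp [ih]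

theorem shiftT_eq (k : ℕ) (M : L.Term ℕ) : shiftT k M = M.subst (fun y => var (y + k)) :=
  relabel_eq_subst M _

@[simp] theorem mem_fvT_var (x y : ℕ) : x ∈ fvT (var y : L.Term ℕ) ↔ x = y := by
  simp [fvT]

theorem mem_fvT_func (x : ℕ) {l : ℕ} (f : L.Functions l) (ts : Fin l → L.Term ℕ) :
    x ∈ fvT (func f ts) ↔ ∃ i, x ∈ fvT (ts i) := by
  simp [fvT]

theorem fvT_finite (M : L.Term ℕ) : (fvT M).Finite := Finset.finite_toSet _

theorem Term.subst_congr {β : Type*} {M : L.Term ℕ} {σ τ : ℕ → L.Term β}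
    (h : ∀ y ∈ fvT M, σ y = τ y) : M.subst σ = M.subst τ := by
  induction M with
  | var y => exact h y (by simp)
  | func f ts ih =>
    simp only [Term.subst]
    congr 1
    funext i
    exact ih i fun y hy => h y ((mem_fvT_func ..).2 ⟨i, hy⟩)

theorem mem_fvT_subst (M : L.Term ℕ) (σ : ℕ → L.Term ℕ) (x : ℕ) :
    x ∈ fvT (M.subst σ) ↔ ∃ y ∈ fvT M, x ∈ fvT (σ y) := by
  induction M with
  | var y => simp
  | func f ts ih =>
    simp only [Term.subst, mem_fvT_func, ih]
    constructor
    · rintro ⟨i, y, hy, hx⟩; exact ⟨y, ⟨i, hy⟩, hx⟩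
    · rintro ⟨y, ⟨i, hy⟩, hx⟩; exact ⟨i, y, hy, hx⟩

theorem mem_fvT_shiftT (k : ℕ) (M : L.Term ℕ) (x : ℕ) :
    x ∈ fvT (shiftT k M) ↔ ∃ y ∈ fvT M, x = y + k := by
  simp [shiftT_eq, mem_fvT_subst]

theorem add_mem_fvT_shiftT {k : ℕ} {M : L.Term ℕ} {x : ℕ} :
    x + k ∈ fvT (shiftT k M) ↔ x ∈ fvT M := by
  simp [mem_fvT_shiftT]

theorem shiftT_zero (M : L.Term ℕ) : shiftT 0 M = M := by
  rw [shiftT_eq]; exact Term.subst_var M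

theorem shiftT_shiftT (k j : ℕ) (M : L.Term ℕ) : shiftT k (shiftT j M) = shiftT (j + k) M := by
  simp only [shiftT_eq, Term.subst_subst, Term.subst, Nat.add_assoc]

theorem shiftT_injective (k : ℕ) : Function.Injective (shiftT k : L.Term ℕ → L.Term ℕ) := by
  intro M N h
  have : ∀ M : L.Term ℕ, (shiftT k M).subst (fun y => var (y - k)) = M := fun M => by
    simp only [shiftT_eq, Term.subst_subst, Term.subst, Nat.add_sub_cancel]
    exact Term.subst_var M
  rw [← this M, h, this N]

@[simp] theorem liftS_of_lt {n i : ℕ} (σ : ℕ → L.Term ℕ) (h : i < n) : liftS n σ i = var i :=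
  if_pos h

@[simp] theorem liftS_add_right (n y : ℕ) (σ : ℕ → L.Term ℕ) :
    liftS n σ (y + n) = shiftT n (σ y) := by
  simp [liftS]

theorem lt_or_eq_add (n i : ℕ) : i < n ∨ ∃ y, i = y + n := by
  rcases lt_or_ge i n with h | h
  · exact .inl h
  · exact .inr ⟨i - n, by omega⟩

theorem liftS_zero (σ : ℕ → L.Term ℕ) : liftS 0 σ = σ := by
  funext i
  simp [liftS, shiftT_zero]

theorem liftS_var (n : ℕ) : liftS n (var : ℕ → L.Term ℕ) = var := by
  funext i
  obtain h | ⟨y, rfl⟩ := lt_or_eq_add n i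
  · simp [h]
  · rw [liftS_add_right]; rfl

theorem shiftT_subst_liftS (n : ℕ) (M : L.Term ℕ) (σ : ℕ → L.Term ℕ) :
    (shiftT n M).subst (liftS n σ) = shiftT n (M.subst σ) := by
  simp only [shiftT_eq, Term.subst_subst, Term.subst, liftS_add_right]

theorem liftS_comp (n : ℕ) (σ τ : ℕ → L.Term ℕ) :
    (fun i => (liftS n σ i).subst (liftS n τ)) = liftS n (fun i => (σ i).subst τ) := by
  funext i
  obtain h | ⟨y, rfl⟩ := lt_or_eq_add n i
  · simp [h]
  · simp [shiftT_subst_liftS]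

theorem liftS_liftS (n m : ℕ) (σ : ℕ → L.Term ℕ) : liftS n (liftS m σ) = liftS (m + n) σ := by
  funext i
  obtain h | ⟨y, rfl⟩ := lt_or_eq_add n i
  · simp [h, show i < m + n by omega]
  · rw [liftS_add_right]
    obtain h | ⟨z, rfl⟩ := lt_or_eq_add m y
    · simp only [h, liftS_of_lt, show y + n < m + n by omega]; rfl
    · rw [liftS_add_right, shiftT_shiftT, show z + m + n = z + (m + n) by omega, liftS_add_right]

theorem liftS_ren (n : ℕ) (r : ℕ → ℕ) :
    liftS n (fun y => (var (r y) : L.Term ℕ)) =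
      fun i => var (if i < n then i else r (i - n) + n) := by
  funext i
  simp only [liftS]
  split_ifs <;> rfl

namespace Proc

theorem subst_subst (P : Proc L) (σ τ : ℕ → L.Term ℕ) :
    (P.subst σ).subst τ = P.subst (fun i => (σ i).subst τ) := by
  induction P generalizing σ τ <;> simp_all [subst, Term.subst_subst, liftS_comp]

theorem subst_var (P : Proc L) : P.subst var = P := by
  induction P <;> simp_all [subst, Term.subst_var, liftS_var]

theorem liftS_one_congr {S : Set ℕ} {σ τ : ℕ → L.Term ℕ} (h : ∀ y, y + 1 ∈ S → σ y = τ y) :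
    ∀ y ∈ S, liftS 1 σ y = liftS 1 τ y := by
  intro y hy
  cases y with
  | zero => simp
  | succ y => rw [liftS_add_right, liftS_add_right, h y hy]

theorem subst_congr {P : Proc L} {σ τ : ℕ → L.Term ℕ} (h : ∀ y ∈ P.fv, σ y = τ y) :
    P.subst σ = P.subst τ := by
  induction P generalizing σ τ with
  | nil => rfl
  | out M N P ih | mat M N P ih | mis M N P ih =>
    simp only [subst]
    rw [Term.subst_congr fun y hy => h y (.inl (.inl hy)),
      Term.subst_congr fun y hy => h y (.inl (.inr hy)), ih fun y hy => h y (.inr hy)]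
  | inp M P ih =>
    simp only [subst]
    rw [Term.subst_congr fun y hy => h y (.inl hy),
      ih (liftS_one_congr fun y hy => h y (.inr hy))]
  | new P ih => simp only [subst]; rw [ih (liftS_one_congr fun y hy => h y hy)]
  | par P Q ih₁ ih₂ | plus P Q ih₁ ih₂ =>
    simp only [subst]
    rw [ih₁ fun y hy => h y (.inl hy), ih₂ fun y hy => h y (.inr hy)]
  | rep P ih => simp only [subst]; rw [ih h]

theorem fv_finite (P : Proc L) : P.fv.Finite := by
  have key : ∀ S : Set ℕ, S.Finite → {y | y + 1 ∈ S}.Finite := fun S hS =>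
    hS.preimage (fun _ _ _ _ h => Nat.succ_injective h)
  induction P with
  | nil => exact finite_empty
  | out M N P ih | mat M N P ih | mis M N P ih =>
    exact ((fvT_finite M).union (fvT_finite N)).union ih
  | inp M P ih => exact (fvT_finite M).union (key _ ih)
  | new P ih => exact key _ ih
  | par P Q ih₁ ih₂ | plus P Q ih₁ ih₂ => exact ih₁.union ih₂
  | rep P ih => exact ih

theorem exists_liftS_one {S : Set ℕ} {σ : ℕ → L.Term ℕ} {x : ℕ} :
    (∃ y ∈ S, x + 1 ∈ fvT (liftS 1 σ y)) ↔ ∃ y, y + 1 ∈ S ∧ x ∈ fvT (σ y) := by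
  constructor
  · rintro ⟨y, hy, hx⟩
    cases y with
    | zero => simp at hx
    | succ y => rw [liftS_add_right, add_mem_fvT_shiftT] at hx; exact ⟨y, hy, hx⟩
  · rintro ⟨y, hy, hx⟩
    exact ⟨y + 1, hy, by rwa [liftS_add_right, add_mem_fvT_shiftT]⟩

theorem mem_fv_subst (P : Proc L) (σ : ℕ → L.Term ℕ) (x : ℕ) :
    x ∈ (P.subst σ).fv ↔ ∃ y ∈ P.fv, x ∈ fvT (σ y) := by
  induction P generalizing σ x with
  | nil => simp [subst, fv]
  | out M N P ih | mat M N P ih | mis M N P ih =>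
    simp only [subst, fv, mem_union, mem_fvT_subst, ih, or_and_right, exists_or]
  | inp M P ih =>
    simp only [subst, fv, mem_union, mem_fvT_subst, mem_ofPred_eq, ih, or_and_right, exists_or,
      exists_liftS_one]
  | new P ih => simp only [subst, fv, mem_ofPred_eq, ih, exists_liftS_one]
  | par P Q ih₁ ih₂ | plus P Q ih₁ ih₂ =>
    simp only [subst, fv, mem_union, ih₁, ih₂, or_and_right, exists_or]
  | rep P ih => exact ih σ x

theorem shift_eq (k : ℕ) (P : Proc L) : P.shift k = P.subst (fun y => var (y + k)) := rfl

theorem shift_shift (k j : ℕ) (P : Proc L) : (P.shift j).shift k = P.shift (j + k) := by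
  simp only [shift_eq, subst_subst, Term.subst, Nat.add_assoc]

theorem shift_subst_liftS (n : ℕ) (P : Proc L) (σ : ℕ → L.Term ℕ) :
    (P.shift n).subst (liftS n σ) = (P.subst σ).shift n := by
  simp only [shift_eq, subst_subst, Term.subst, liftS_add_right, shiftT_eq]

theorem newN_zero (P : Proc L) : newN 0 P = P := rfl

theorem newN_succ (k : ℕ) (P : Proc L) : newN (k + 1) P = new (newN k P) :=
  Function.iterate_succ_apply' ..

theorem newN_subst (k : ℕ) (P : Proc L) (σ : ℕ → L.Term ℕ) :
    (newN k P).subst σ = newN k (P.subst (liftS k σ)) := by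
  induction k generalizing σ with
  | zero => simp [newN_zero, liftS_zero]
  | succ k ih => rw [newN_succ, newN_succ, subst, ih, liftS_liftS, Nat.add_comm]

end Proc

/-! ### Equations, inequalities and environments under renaming. -/

variable {Ax : Set (L.Term ℕ × L.Term ℕ)}

theorem EqTheory.subst {M N : L.Term ℕ} (h : EqTheory Ax M N) (σ : ℕ → L.Term ℕ) :
    EqTheory Ax (M.subst σ) (N.subst σ) := by
  induction h with
  | ax h τ => rw [Term.subst_subst, Term.subst_subst]; exact .ax h _
  | refl M => exact .refl _
  | symm _ ih => exact ih.symm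
  | trans _ _ ih₁ ih₂ => exact ih₁.trans ih₂
  | app f _ ih => exact .app f ih

theorem EqTheory.shiftT {M N : L.Term ℕ} (h : EqTheory Ax M N) (k : ℕ) :
    EqTheory Ax (shiftT k M) (shiftT k N) := by
  rw [shiftT_eq, shiftT_eq]; exact h.subst _

theorem eqTheory_ren_iff {r : ℕ → ℕ} (hr : Function.Injective r) {M N : L.Term ℕ} :
    EqTheory Ax (M.subst fun y => var (r y)) (N.subst fun y => var (r y)) ↔ EqTheory Ax M N := by
  refine ⟨fun h => ?_, fun h => h.subst _⟩
  have := h.subst (fun y => var (Function.invFun r y))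
  simpa only [Term.subst_subst, FirstOrder.Language.Term.subst, Function.leftInverse_invFun hr _,
    Term.subst_var] using this

theorem eqTheory_shiftT_iff {k : ℕ} {M N : L.Term ℕ} :
    EqTheory Ax (shiftT k M) (shiftT k N) ↔ EqTheory Ax M N := by
  rw [shiftT_eq, shiftT_eq]
  exact eqTheory_ren_iff (add_left_injective k)

-- Unifiers are transported along `r` and back. Only the correspondence of the environments on the
-- range of `r` matters, since no other variable occurs in the two messages.
open Classical in
theorem entailsNe_ren_iff {r : ℕ → ℕ} (hr : Function.Injective r) {E F : Set ℕ} (hF : F.Finite)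
    (h : ∀ y, r y ∈ E ↔ y ∈ F) {M N : L.Term ℕ} :
    EntailsNe Ax E (M.subst fun y => var (r y)) (N.subst fun y => var (r y)) ↔
      EntailsNe Ax F M N := by
  have hg : ∀ y, Function.invFun r (r y) = y := Function.leftInverse_invFun hr
  refine not_congr ⟨?_, ?_⟩
  · rintro ⟨σ, hfin, ⟨hd, hfr⟩, he⟩
    -- Variables outside the range of `r` have no preimage and are sent to a constant `c`. Freshness
    -- of the resulting unifier for `F` requires `c ∉ F`, hence finiteness of `F`.
    obtain ⟨c, hc⟩ := hF.infinite_compl.nonempty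
    let g : ℕ → L.Term ℕ := fun w => var (if w ∈ range r then Function.invFun r w else c)
    have hgr : ∀ y, g (r y) = var y := fun y => by simp [g, hg]
    refine ⟨fun y => (σ (r y)).subst g, ?_, ⟨?_, ?_⟩, ?_⟩
    · refine (hfin.preimage hr.injOn).subset fun y hy hy' => hy ?_
      change (σ (r y)).subst g = _
      rw [hy']
      exact hgr y
    · rw [disjoint_left] at hd ⊢
      intro y hy hyF
      refine hy ?_
      have : σ (r y) = var (r y) := not_not.1 fun h' => hd h' ((h y).2 hyF)
      change (σ (r y)).subst g = _
      rw [this]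
      exact hgr y
    · intro y hy
      rw [disjoint_left]
      intro z hz
      obtain ⟨w, hw, hz⟩ := (mem_fvT_subst ..).1 hz
      have hwE := disjoint_left.1 (hfr (r y) (fun h' => hy ((h y).1 h'))) hw
      simp only [g, mem_fvT_var] at hz
      subst hz
      split_ifs with hwr
      · obtain ⟨z, rfl⟩ := hwr
        rw [hg, ← h]; exact hwE
      · exact hc
    · have := he.subst g
      simpa only [Term.subst_subst, FirstOrder.Language.Term.subst] using this
  · rintro ⟨σ, hfin, ⟨hd, hfr⟩, he⟩
    let σ' : ℕ → L.Term ℕ := fun w =>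
      if w ∈ range r then (σ (Function.invFun r w)).subst (fun y => var (r y)) else var w
    have hσ' : ∀ y, σ' (r y) = (σ y).subst (fun y => var (r y)) := fun y => by simp [σ', hg]
    refine ⟨σ', ?_, ⟨?_, ?_⟩, ?_⟩
    · refine (hfin.image r).subset fun w hw => ?_
      by_cases hwr : w ∈ range r
      · obtain ⟨y, rfl⟩ := hwr
        refine ⟨y, fun hy => hw ?_, rfl⟩
        rw [hσ', hy]; rfl
      · exact absurd (if_neg hwr) hw
    · rw [disjoint_left] at hd ⊢
      intro w hw hwE
      refine hw ?_
      by_cases hwr : w ∈ range r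
      · obtain ⟨y, rfl⟩ := hwr
        have : σ y = var y := not_not.1 fun h' => hd h' ((h y).1 hwE)
        rw [hσ', this]; rfl
      · exact if_neg hwr
    · intro w hwE
      rw [disjoint_left]
      intro z hz
      by_cases hwr : w ∈ range r
      · obtain ⟨y, rfl⟩ := hwr
        rw [hσ', mem_fvT_subst] at hz
        obtain ⟨x, hx, hz⟩ := hz
        rw [mem_fvT_var] at hz
        subst hz
        rw [h]
        exact disjoint_left.1 (hfr y (fun h' => hwE ((h y).2 h'))) hx
      · simp only [σ', if_neg hwr, mem_fvT_var] at hz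
        exact hz ▸ hwE
    · have := he.subst (fun y => var (r y))
      simp only [Term.subst_subst, FirstOrder.Language.Term.subst] at this ⊢
      simpa only [hσ'] using this

/-- The environment obtained by entering the scope of `k` restrictions. -/
def envN (k : ℕ) (E : Set ℕ) : Set ℕ := {i | k ≤ i → i - k ∈ E}

theorem mem_envN_of_lt {k i : ℕ} {E : Set ℕ} (h : i < k) : i ∈ envN k E := fun h' => by omega

@[simp] theorem add_mem_envN {k y : ℕ} {E : Set ℕ} : y + k ∈ envN k E ↔ y ∈ E := by
  simp [envN]

theorem extendEnv_eq (E : Set ℕ) : extendEnv E = envN 1 E := by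
  ext i
  cases i with
  | zero => simp [extendEnv, mem_envN_of_lt]
  | succ i => simp [extendEnv]

theorem envN_zero (E : Set ℕ) : envN 0 E = E := by
  ext i; exact add_mem_envN (k := 0)

theorem envN_envN (k j : ℕ) (E : Set ℕ) : envN k (envN j E) = envN (j + k) E := by
  ext i
  obtain h | ⟨y, rfl⟩ := lt_or_eq_add k i
  · simp [mem_envN_of_lt h, mem_envN_of_lt (show i < j + k by omega)]
  · rw [add_mem_envN]
    obtain h | ⟨z, rfl⟩ := lt_or_eq_add j y
    · simp [mem_envN_of_lt h, mem_envN_of_lt (show y + k < j + k by omega)]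
    · rw [show z + j + k = z + (j + k) by omega, add_mem_envN, add_mem_envN]

theorem envN_Iio (k n : ℕ) : envN k (Iio n) = Iio (n + k) := by
  ext i; simp only [envN, mem_ofPred_eq, mem_Iio]; omega

theorem envN_finite (k : ℕ) {E : Set ℕ} (hE : E.Finite) : (envN k E).Finite := by
  refine ((finite_Iio k).union (hE.image (· + k))).subset fun i hi => ?_
  obtain h | ⟨y, rfl⟩ := lt_or_eq_add k i
  · exact .inl h
  · exact .inr ⟨y, add_mem_envN.1 hi, rfl⟩

theorem add_mem_image {k y : ℕ} {E : Set ℕ} : y + k ∈ (fun y => y + k) '' E ↔ y ∈ E := by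
  simp

end Algebra

/-- Labels without bound names. The payload of an output lives underneath the binders extruded by
the transition; the message of an input is a parameter of the residual. -/
inductive Lab (L : FirstOrder.Language.{u, v}) : Type u
  | tau : Lab L
  | out : L.Term ℕ → L.Term ℕ → Lab L
  | inp : L.Term ℕ → Lab L

/-! ### Transitions without bound names in labels. -/

section Transitions

variable {L : FirstOrder.Language.{u, v}}

namespace Lab

/-- The number of message parameters of the residual. -/
def params : Lab L → ℕ
  | tau => 0
  | out _ _ => 0
  | inp _ => 1

/-- Weakening of the subject by one binder, which is then extruded. -/
def shift : Lab L → Lab L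
  | tau => tau
  | out M N => out (shiftT 1 M) N
  | inp M => inp (shiftT 1 M)

/-- Substitution in the label of a transition that extrudes `k` binders. -/
def subst (k : ℕ) : Lab L → (ℕ → L.Term ℕ) → Lab L
  | tau, _ => tau
  | out M N, σ => out (M.subst σ) (N.subst (liftS k σ))
  | inp M, σ => inp (M.subst σ)

@[simp] theorem params_shift (l : Lab L) : l.shift.params = l.params := by cases l <;> rfl

@[simp] theorem params_subst (k : ℕ) (l : Lab L) (σ : ℕ → L.Term ℕ) :
    (l.subst k σ).params = l.params := by cases l <;> rfl

/-- Equality of labels up to the equational theory on subjects. -/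
inductive Eqv (Ax : Set (L.Term ℕ × L.Term ℕ)) : Lab L → Lab L → Prop
  | tau : Eqv Ax tau tau
  | out {M M' : L.Term ℕ} (N : L.Term ℕ) (h : EqTheory Ax M M') : Eqv Ax (out M N) (out M' N)
  | inp {M M' : L.Term ℕ} (h : EqTheory Ax M M') : Eqv Ax (inp M) (inp M')

end Lab

variable (Ax : Set (L.Term ℕ × L.Term ℕ))

/-- Transitions without label names: `Tr Ax E P l k P'` extrudes `k` binders. In the residual of an
input, the index `0` stands for the message received. -/
inductive Tr : Set ℕ → Proc L → Lab L → ℕ → Proc L → Prop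
  | inp {E M M' P} (hM : EqTheory Ax M M') : Tr E (Proc.inp M P) (Lab.inp M') 0 P
  | out {E M M' N P} (hM : EqTheory Ax M M') : Tr E (Proc.out M N P) (Lab.out M' N) 0 P
  | sumL {E P Q l k P'} (h : Tr E P l k P') : Tr E (Proc.plus P Q) l k P'
  | sumR {E P Q l k P'} (h : Tr E Q l k P') : Tr E (Proc.plus P Q) l k P'
  | mat {E M N P l k P'} (hM : EqTheory Ax M N) (h : Tr E P l k P') :
      Tr E (Proc.mat M N P) l k P'
  | mis {E M N P l k P'} (hM : EntailsNe Ax E M N) (h : Tr E P l k P') :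
      Tr E (Proc.mis M N P) l k P'
  | res {E P l k P'} (h : Tr (extendEnv E) P l.shift k P') : Tr E (Proc.new P) l (k + 1) P'
  | parL {E P Q l k P'} (h : Tr E P l k P') :
      Tr E (Proc.par P Q) l k (P'.par (Q.shift (k + l.params)))
  | parR {E P Q l k Q'} (h : Tr E Q l k Q') :
      Tr E (Proc.par P Q) l k ((P.shift (k + l.params)).par Q')
  | repAct {E P l k P'} (h : Tr E P l k P') :
      Tr E (Proc.rep P) l k (P'.par ((Proc.rep P).shift (k + l.params)))
  | closeL {E P Q M M' N k j P' Q'} (h₁ : Tr E P (Lab.out M N) k P')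
      (h₂ : Tr ((fun y => y + k) '' E) (Q.shift k) (Lab.inp M') j Q')
      (hM : EqTheory Ax (shiftT k M) M') :
      Tr E (Proc.par P Q) Lab.tau (j + k) ((P'.shift j).par (Q'.subst (instS (shiftT j N))))
  | closeR {E P Q M M' N k j P' Q'} (h₁ : Tr E Q (Lab.out M N) k Q')
      (h₂ : Tr ((fun y => y + k) '' E) (P.shift k) (Lab.inp M') j P')
      (hM : EqTheory Ax (shiftT k M) M') :
      Tr E (Proc.par P Q) Lab.tau (j + k) ((P'.subst (instS (shiftT j N))).par (Q'.shift j))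
  | repClose {E P M M' N k j P' Q'} (h₁ : Tr E P (Lab.out M N) k P')
      (h₂ : Tr ((fun y => y + k) '' E) (P.shift k) (Lab.inp M') j Q')
      (hM : EqTheory Ax (shiftT k M) M') :
      Tr E (Proc.rep P) Lab.tau (j + k)
        (((P'.shift j).par (Q'.subst (instS (shiftT j N)))).par ((Proc.rep P).shift (j + k)))

variable {Ax}

theorem Lab.Eqv.params_eq {l l' : Lab L} (h : Lab.Eqv Ax l l') : l.params = l'.params := by
  cases h <;> rfl

theorem Lab.Eqv.shift {l l' : Lab L} (h : Lab.Eqv Ax l l') : Lab.Eqv Ax l.shift l'.shift := by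
  cases h with
  | tau => exact .tau
  | out N h => exact .out _ (h.shiftT 1)
  | inp h => exact .inp (h.shiftT 1)

/-- The prefix rules fix the subject of a label only up to the equational theory, and the other
rules pass labels on. Communication has no subject to change. -/
theorem Tr.label {E : Set ℕ} {P P' : Proc L} {l l' : Lab L} {k : ℕ} (h : Tr Ax E P l k P')
    (hl : Lab.Eqv Ax l l') : Tr Ax E P l' k P' := by
  induction h generalizing l' with
  | inp hM => cases hl with | inp h => exact .inp (hM.trans h)
  | out hM => cases hl with | out _ h => exact .out (hM.trans h)
  | sumL _ ih => exact .sumL (ih hl)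
  | sumR _ ih => exact .sumR (ih hl)
  | mat hM _ ih => exact .mat hM (ih hl)
  | mis hM _ ih => exact .mis hM (ih hl)
  | res _ ih => exact .res (ih hl.shift)
  | parL _ ih => rw [hl.params_eq]; exact .parL (ih hl)
  | parR _ ih => rw [hl.params_eq]; exact .parR (ih hl)
  | repAct _ ih => rw [hl.params_eq]; exact .repAct (ih hl)
  | closeL h₁ h₂ hM _ _ => cases hl; exact .closeL h₁ h₂ hM
  | closeR h₁ h₂ hM _ _ => cases hl; exact .closeR h₁ h₂ hM
  | repClose h₁ h₂ hM _ _ => cases hl; exact .repClose h₁ h₂ hM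

/-- A fresh variable cannot occur in the payload; this is what makes the variable recorded by an
output really enter the domain in `Tr.dom_record`. -/
theorem Tr.fv_payload {E : Set ℕ} {P P' : Proc L} {l : Lab L} {k : ℕ} (h : Tr Ax E P l k P')
    {M N : L.Term ℕ} (hl : l = .out M N) {y : ℕ} (hy : y + k ∈ fvT N) : y ∈ P.fv := by
  induction h generalizing M N y with
  | inp hM => cases hl
  | out hM => cases hl; exact .inl (.inr hy)
  | sumL _ ih | parL _ ih => exact .inl (ih hl hy)
  | sumR _ ih | parR _ ih | mat _ _ ih | mis _ _ ih => exact .inr (ih hl hy)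
  | res _ ih =>
    subst hl
    exact ih rfl (by rwa [Nat.add_assoc, Nat.add_comm 1])
  | repAct _ ih => exact ih hl hy
  | closeL | closeR | repClose => cases hl

/-! ### Transfer of transitions between instances of a recipe. -/

variable (Ax) in
/-- What is true of the instances of recipes by `φ₁` and holds in `E₁` is also true of those by `φ₂`
in `E₂`. -/
structure Transferable (E₁ : Set ℕ) (φ₁ : ℕ → L.Term ℕ) (E₂ : Set ℕ) (φ₂ : ℕ → L.Term ℕ) :
    Prop where
  finite₁ : E₁.Finite
  finite₂ : E₂.Finite
  eq : ∀ k (M N : L.Term ℕ), EqTheory Ax (M.subst (liftS k φ₁)) (N.subst (liftS k φ₁)) →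
    EqTheory Ax (M.subst (liftS k φ₂)) (N.subst (liftS k φ₂))
  ne : ∀ k (M N : L.Term ℕ),
    EntailsNe Ax (envN k E₁) (M.subst (liftS k φ₁)) (N.subst (liftS k φ₁)) →
    EntailsNe Ax (envN k E₂) (M.subst (liftS k φ₂)) (N.subst (liftS k φ₂))

namespace Transferable

variable {E₁ E₂ : Set ℕ} {φ₁ φ₂ : ℕ → L.Term ℕ}

theorem eq_zero (h : Transferable Ax E₁ φ₁ E₂ φ₂) {M N : L.Term ℕ}
    (h' : EqTheory Ax (M.subst φ₁) (N.subst φ₁)) : EqTheory Ax (M.subst φ₂) (N.subst φ₂) := by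
  simpa only [liftS_zero] using h.eq 0 M N (by simpa only [liftS_zero] using h')

theorem ne_zero (h : Transferable Ax E₁ φ₁ E₂ φ₂) {M N : L.Term ℕ}
    (h' : EntailsNe Ax E₁ (M.subst φ₁) (N.subst φ₁)) :
    EntailsNe Ax E₂ (M.subst φ₂) (N.subst φ₂) := by
  simpa only [liftS_zero, envN_zero] using
    h.ne 0 M N (by simpa only [liftS_zero, envN_zero] using h')

/-- The quantification over `k` in `Transferable` is there for this: passing a restriction only
turns `k` into `1 + k`. -/
theorem extend (h : Transferable Ax E₁ φ₁ E₂ φ₂) :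
    Transferable Ax (extendEnv E₁) (liftS 1 φ₁) (extendEnv E₂) (liftS 1 φ₂) where
  finite₁ := by rw [extendEnv_eq]; exact envN_finite _ h.finite₁
  finite₂ := by rw [extendEnv_eq]; exact envN_finite _ h.finite₂
  eq k := by simpa only [liftS_liftS] using h.eq (1 + k)
  ne k := by simpa only [liftS_liftS, extendEnv_eq, envN_envN] using h.ne (1 + k)

theorem liftS_shift (k j : ℕ) (φ : ℕ → L.Term ℕ) :
    liftS k (fun y => shiftT j (φ y)) =
      fun y => (liftS k φ y).subst (fun i => var (if i < k then i else i + j)) := by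
  funext i
  obtain h | ⟨y, rfl⟩ := lt_or_eq_add k i
  · simp [h]
  · simp only [liftS_add_right, shiftT_eq, Term.subst_subst, FirstOrder.Language.Term.subst]
    congr 1; funext i
    simp only [show ¬ i + k < k by omega, if_false]
    congr 1; omega

theorem shift_ren_injective (k j : ℕ) :
    Function.Injective (fun i : ℕ => if i < k then i else i + j) := by
  intro a b h
  simp only at h
  split_ifs at h <;> omega

/-- This is the situation of a receiver weakened by the names of a sender. The weakening is
injective and respects the environments, so both conditions reduce to the original ones. -/
theorem shift (h : Transferable Ax E₁ φ₁ E₂ φ₂) (j : ℕ) :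
    Transferable Ax ((fun y => y + j) '' E₁) (fun y => shiftT j (φ₁ y))
      ((fun y => y + j) '' E₂) (fun y => shiftT j (φ₂ y)) := by
  have henv : ∀ (k : ℕ) (E : Set ℕ) (y : ℕ),
      (if y < k then y else y + j) ∈ envN k ((fun y => y + j) '' E) ↔ y ∈ envN k E := by
    intro k E y
    obtain h | ⟨z, rfl⟩ := lt_or_eq_add k y
    · simp [h, mem_envN_of_lt h]
    · rw [if_neg (by omega), show z + k + j = (z + j) + k by omega, add_mem_envN, add_mem_envN,
        add_mem_image]
  refine ⟨h.finite₁.image _, h.finite₂.image _, fun k M N h' => ?_, fun k M N h' => ?_⟩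
  · rw [liftS_shift, ← Term.subst_subst, ← Term.subst_subst,
      eqTheory_ren_iff (shift_ren_injective k j)] at h' ⊢
    exact h.eq k M N h'
  · rw [liftS_shift, ← Term.subst_subst, ← Term.subst_subst] at h' ⊢
    rw [entailsNe_ren_iff (shift_ren_injective k j) (envN_finite k h.finite₁) (henv k E₁)] at h'
    rw [entailsNe_ren_iff (shift_ren_injective k j) (envN_finite k h.finite₂) (henv k E₂)]
    exact h.ne k M N h'

/-- Injective renamings are transferable to each other. -/
theorem ren {r₁ r₂ : ℕ → ℕ} (h₁ : Function.Injective r₁) (h₂ : Function.Injective r₂)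
    {E : Set ℕ} (hE : E.Finite) (hE₁ : E₁.Finite) (hE₂ : E₂.Finite) (he₁ : ∀ y, r₁ y ∈ E₁ ↔ y ∈ E)
    (he₂ : ∀ y, r₂ y ∈ E₂ ↔ y ∈ E) :
    Transferable Ax E₁ (fun y => var (r₁ y)) E₂ (fun y => var (r₂ y)) := by
  have hinj : ∀ {r : ℕ → ℕ}, Function.Injective r → ∀ k,
      Function.Injective fun i => if i < k then i else r (i - k) + k := by
    intro r hr k a b hab
    simp only at hab
    split_ifs at hab
    · exact hab
    · omega
    · omega
    · have := hr (Nat.add_right_cancel hab); omega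
  have henv : ∀ {r : ℕ → ℕ} {E' : Set ℕ}, (∀ y, r y ∈ E' ↔ y ∈ E) → ∀ k y,
      (if y < k then y else r (y - k) + k) ∈ envN k E' ↔ y ∈ envN k E := by
    intro r E' h k y
    obtain hlt | ⟨z, rfl⟩ := lt_or_eq_add k y
    · simp [hlt, mem_envN_of_lt hlt]
    · rw [if_neg (by omega), Nat.add_sub_cancel, add_mem_envN, add_mem_envN, h]
  refine ⟨hE₁, hE₂, fun k M N h' => ?_, fun k M N h' => ?_⟩
  · rw [liftS_ren, eqTheory_ren_iff (hinj h₁ k)] at h'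
    rwa [liftS_ren, eqTheory_ren_iff (hinj h₂ k)]
  · rw [liftS_ren, entailsNe_ren_iff (hinj h₁ k) (envN_finite k hE) (henv he₁ k)] at h'
    rwa [liftS_ren, entailsNe_ren_iff (hinj h₂ k) (envN_finite k hE) (henv he₂ k)]

end Transferable

theorem instS_subst (N : L.Term ℕ) (σ : ℕ → L.Term ℕ) :
    (fun i => (instS N i).subst σ) = fun i => (liftS 1 σ i).subst (instS (N.subst σ)) := by
  funext i
  cases i with
  | zero => simp [instS]
  | succ i =>
    simp only [instS, liftS_add_right, shiftT_eq, Term.subst_subst, FirstOrder.Language.Term.subst]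
    exact (Term.subst_var _).symm

theorem Proc.subst_instS (P : Proc L) (N : L.Term ℕ) (σ : ℕ → L.Term ℕ) :
    (P.subst (instS N)).subst σ = (P.subst (liftS 1 σ)).subst (instS (N.subst σ)) := by
  simp only [subst_subst, instS_subst]

theorem shiftT_subst_instS (M N : L.Term ℕ) : (shiftT 1 M).subst (instS N) = M := by
  simp only [shiftT_eq, Term.subst_subst, FirstOrder.Language.Term.subst, instS]
  exact Term.subst_var _

theorem subst_comp_shiftT (M : L.Term ℕ) (k : ℕ) (φ : ℕ → L.Term ℕ) :
    M.subst (fun y => shiftT k (φ y)) = shiftT k (M.subst φ) := by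
  simp only [shiftT_eq, Term.subst_subst]

theorem Proc.subst_comp_shiftT (P : Proc L) (k : ℕ) (φ : ℕ → L.Term ℕ) :
    P.subst (fun y => shiftT k (φ y)) = (P.subst φ).shift k := by
  simp only [shiftT_eq, Proc.shift_eq, subst_subst]

/-- Delivering the message commutes with instantiating the recipes: the residual of a communication
between instances is an instance of a recipe. The sender's `k` names lie outside the receiver's `j`.
-/
theorem close_residual (S : Proc L) (N : L.Term ℕ) (j k : ℕ) (φ : ℕ → L.Term ℕ) :
    (S.subst (liftS (j + 1) fun y => shiftT k (φ y))).subst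
        (instS (shiftT j (N.subst (liftS k φ)))) =
      ((S.subst (liftS (j + 1) fun y => var (y + k))).subst (instS (shiftT j N))).subst
        (liftS (j + k) φ) := by
  rw [Proc.subst_instS, ← shiftT_subst_liftS, liftS_liftS, Nat.add_comm k j]
  congr 1
  have : (fun i => (liftS (j + 1) (fun y => var (y + k)) i).subst (liftS (j + k + 1) φ)) =
      liftS (j + 1) (fun y => shiftT k (φ y)) := by
    rw [show j + k + 1 = k + (j + 1) by omega, ← liftS_liftS (j + 1) k φ, liftS_comp]
    simp only [FirstOrder.Language.Term.subst, liftS_add_right]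
  rw [Proc.subst_subst, liftS_liftS, this]

theorem shift_close_residual (R : Proc L) (j k : ℕ) (φ : ℕ → L.Term ℕ) :
    (R.subst (liftS k φ)).shift j = (R.shift j).subst (liftS (j + k) φ) := by
  rw [← Proc.shift_subst_liftS, liftS_liftS, Nat.add_comm]

/-- Both channels are recipes up to the equational theory, so their agreement is an equation between
recipes and transfers. The weakening by `k` is injective and is stripped before, restored after. -/
theorem Transferable.close {E₁ E₂ : Set ℕ} {φ₁ φ₂ : ℕ → L.Term ℕ}
    (h : Transferable Ax E₁ φ₁ E₂ φ₂) {M M' M₀ M₁ : L.Term ℕ} {k : ℕ}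
    (hM : EqTheory Ax (shiftT k M) M') (h₀ : EqTheory Ax M (M₀.subst φ₁))
    (h₁ : EqTheory Ax M' (M₁.subst fun y => shiftT k (φ₁ y))) :
    EqTheory Ax (shiftT k (M₀.subst φ₂)) (M₁.subst fun y => shiftT k (φ₂ y)) := by
  rw [subst_comp_shiftT] at h₁ ⊢
  exact (h.eq_zero (eqTheory_shiftT_iff.1 (((h₀.symm.shiftT k).trans hM).trans h₁))).shiftT k

/-- A transition of a recipe under a transferable pair of instances. -/
theorem Tr.transfer {E₁ : Set ℕ} {P P' : Proc L} {l₁ : Lab L} {k : ℕ} (h : Tr Ax E₁ P l₁ k P') :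
    ∀ {φ₁ φ₂ : ℕ → L.Term ℕ} {E₂ : Set ℕ} {R : Proc L}, Transferable Ax E₁ φ₁ E₂ φ₂ →
      P = R.subst φ₁ → ∃ (l : Lab L) (R' : Proc L), Lab.Eqv Ax l₁ (l.subst k φ₁) ∧
        P' = R'.subst (liftS (k + l₁.params) φ₁) ∧
        Tr Ax E₂ (R.subst φ₂) (l.subst k φ₂) k (R'.subst (liftS (k + l₁.params) φ₂)) := by
  induction h with
  | inp hM =>
    intro φ₁ φ₂ E₂ R ht hR
    cases R <;> simp only [Proc.subst, Proc.inp.injEq, reduceCtorEq] at hR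
    case inp M R =>
    obtain ⟨rfl, rfl⟩ := hR
    exact ⟨.inp M, R, .inp hM.symm, rfl, .inp (.refl _)⟩
  | out hM =>
    intro φ₁ φ₂ E₂ R ht hR
    cases R <;> simp only [Proc.subst, Proc.out.injEq, reduceCtorEq] at hR
    case out M N R =>
    obtain ⟨rfl, rfl, rfl⟩ := hR
    refine ⟨.out M N, R, ?_, ?_, ?_⟩
    · simpa only [Lab.subst, liftS_zero] using .out _ hM.symm
    · simp only [Lab.params, Nat.add_zero, liftS_zero]
    · simpa only [Lab.params, Lab.subst, Nat.add_zero, liftS_zero, Proc.subst] using .out (.refl _)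
  | sumL _ ih =>
    intro φ₁ φ₂ E₂ R ht hR
    cases R <;> simp only [Proc.subst, Proc.plus.injEq, reduceCtorEq] at hR
    obtain ⟨l, R', h₁, h₂, h₃⟩ := ih ht hR.1
    exact ⟨l, R', h₁, h₂, .sumL h₃⟩
  | sumR _ ih =>
    intro φ₁ φ₂ E₂ R ht hR
    cases R <;> simp only [Proc.subst, Proc.plus.injEq, reduceCtorEq] at hR
    obtain ⟨l, R', h₁, h₂, h₃⟩ := ih ht hR.2
    exact ⟨l, R', h₁, h₂, .sumR h₃⟩
  | mat hM _ ih =>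
    intro φ₁ φ₂ E₂ R ht hR
    cases R <;> simp only [Proc.subst, Proc.mat.injEq, reduceCtorEq] at hR
    obtain ⟨rfl, rfl, hR⟩ := hR
    obtain ⟨l, R', h₁, h₂, h₃⟩ := ih ht hR
    exact ⟨l, R', h₁, h₂, .mat (ht.eq_zero hM) h₃⟩
  | mis hM _ ih =>
    intro φ₁ φ₂ E₂ R ht hR
    cases R <;> simp only [Proc.subst, Proc.mis.injEq, reduceCtorEq] at hR
    obtain ⟨rfl, rfl, hR⟩ := hR
    obtain ⟨l, R', h₁, h₂, h₃⟩ := ih ht hR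
    exact ⟨l, R', h₁, h₂, .mis (ht.ne_zero hM) h₃⟩
  | @res E P l₁ k P' _ ih =>
    intro φ₁ φ₂ E₂ R ht hR
    cases R <;> simp only [Proc.subst, Proc.new.injEq, reduceCtorEq] at hR
    case new R =>
    obtain ⟨l, R', h₁, h₂, h₃⟩ := ih ht.extend hR
    simp only [Lab.params_shift, liftS_liftS] at h₂ h₃
    rw [show 1 + (k + l₁.params) = k + 1 + l₁.params by omega] at h₂ h₃
    -- The label does not mention the restricted name, but the recipe `M` found for it may, since it
    -- is determined only up to the equational theory. Any message may then replace that name; `var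
    -- 0` is an arbitrary choice. The equality survives on the first side and transfers to the
    -- second.
    have key : ∀ M M₁ : L.Term ℕ, EqTheory Ax (shiftT 1 M₁) (M.subst (liftS 1 φ₁)) →
        EqTheory Ax M₁ ((M.subst (instS (var 0))).subst φ₁) ∧
        EqTheory Ax (M.subst (liftS 1 φ₂)) (shiftT 1 ((M.subst (instS (var 0))).subst φ₂)) := by
      intro M M₁ h
      have h' : EqTheory Ax M₁ ((M.subst (instS (var 0))).subst φ₁) := by
        have := h.subst (instS ((var 0 : L.Term ℕ).subst φ₁))
        rwa [shiftT_subst_instS, Term.subst_subst, ← instS_subst, ← Term.subst_subst] at this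
      refine ⟨h', ?_⟩
      rw [← shiftT_subst_liftS]
      refine ht.extend.eq_zero (h.symm.trans ?_)
      rw [shiftT_subst_liftS]
      exact h'.shiftT 1
    cases l₁ with
    | tau =>
      cases l <;> cases h₁
      exact ⟨.tau, R', .tau, h₂, .res h₃⟩
    | out M₁ N₁ =>
      cases l with
      | out M N =>
        simp only [Lab.subst, Lab.shift, liftS_liftS] at h₁ h₃
        rw [Nat.add_comm 1 k] at h₁ h₃
        cases h₁ with
        | out _ h₁ =>
        obtain ⟨h₁, h₁'⟩ := key _ _ h₁
        exact ⟨.out (M.subst (instS (var 0))) N, R', .out _ h₁, h₂, .res (h₃.label (.out _ h₁'))⟩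
      | _ => cases h₁
    | inp M₁ =>
      cases l with
      | inp M =>
        cases h₁ with
        | inp h₁ =>
        obtain ⟨h₁, h₁'⟩ := key _ _ h₁
        exact ⟨.inp (M.subst (instS (var 0))), R', .inp h₁, h₂, .res (h₃.label (.inp h₁'))⟩
      | _ => cases h₁
  | @parL E P Q l₁ k P' _ ih =>
    intro φ₁ φ₂ E₂ R ht hR
    cases R <;> simp only [Proc.subst, Proc.par.injEq, reduceCtorEq] at hR
    case par R S =>
    obtain ⟨l, R', h₁, h₂, h₃⟩ := ih ht hR.1
    refine ⟨l, R'.par (S.shift (k + l₁.params)), h₁, ?_, ?_⟩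
    · rw [Proc.subst, Proc.shift_subst_liftS, h₂, hR.2]
    · have := Tr.parL (Q := S.subst φ₂) h₃
      rw [l.params_subst, ← l.params_subst k φ₁, ← h₁.params_eq] at this
      rw [← Proc.shift_subst_liftS] at this
      exact this
  | @parR E P Q l₁ k P' _ ih =>
    intro φ₁ φ₂ E₂ R ht hR
    cases R <;> simp only [Proc.subst, Proc.par.injEq, reduceCtorEq] at hR
    case par S R =>
    obtain ⟨l, R', h₁, h₂, h₃⟩ := ih ht hR.2
    refine ⟨l, (S.shift (k + l₁.params)).par R', h₁, ?_, ?_⟩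
    · rw [Proc.subst, Proc.shift_subst_liftS, h₂, hR.1]
    · have := Tr.parR (P := S.subst φ₂) h₃
      rw [l.params_subst, ← l.params_subst k φ₁, ← h₁.params_eq] at this
      rw [← Proc.shift_subst_liftS] at this
      exact this
  | @repAct E P l₁ k P' _ ih =>
    intro φ₁ φ₂ E₂ R ht hR
    cases R <;> simp only [Proc.subst, Proc.rep.injEq, reduceCtorEq] at hR
    case rep R =>
    obtain ⟨l, R', h₁, h₂, h₃⟩ := ih ht hR
    refine ⟨l, R'.par (R.rep.shift (k + l₁.params)), h₁, ?_, ?_⟩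
    · rw [Proc.subst, Proc.shift_subst_liftS, h₂, hR, Proc.subst]
    · have := Tr.repAct  h₃
      rw [l.params_subst, ← l.params_subst k φ₁, ← h₁.params_eq] at this
      rw [show (R.subst φ₂).rep = R.rep.subst φ₂ from rfl, ← Proc.shift_subst_liftS] at this
      exact this
  | @closeL E P Q M M' N k j P' Q' _ _ hM ih₁ ih₂ =>
    intro φ₁ φ₂ E₂ R ht hR
    cases R <;> simp only [Proc.subst, Proc.par.injEq, reduceCtorEq] at hR
    case par R S =>
    obtain ⟨l, R', h₁, rfl, h₃⟩ := ih₁ ht hR.1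
    cases l <;> cases h₁
    case out M₀ N₀ hM₀ _ =>
    -- The receiver, weakened by the `k` extruded names, is the recipe `S` over the weakened
    -- interface.
    obtain ⟨l, S', h₁', rfl, h₃'⟩ := ih₂ (R := S) (ht.shift k)
      (by rw [hR.2, Proc.subst_comp_shiftT])
    cases l <;> cases h₁'
    case inp M₁ hM₁ =>
    refine ⟨.tau, (R'.shift j).par ((S'.subst (liftS (j + 1) fun y => var (y + k))).subst
      (instS (shiftT j N₀))), .tau, ?_, ?_⟩
    · simp only [Lab.params, Nat.add_zero, Proc.subst, close_residual, shift_close_residual]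
    · have := Tr.closeL (Q := S.subst φ₂) h₃ (by rwa [Proc.subst_comp_shiftT] at h₃')
        (ht.close hM hM₀ hM₁)
      simpa only [Lab.params, Nat.add_zero, Proc.subst, close_residual, shift_close_residual,
        Lab.subst] using this
  | @closeR E P Q M M' N k j P' Q' _ _ hM ih₁ ih₂ =>
    intro φ₁ φ₂ E₂ R ht hR
    cases R <;> simp only [Proc.subst, Proc.par.injEq, reduceCtorEq] at hR
    case par S R =>
    obtain ⟨l, R', h₁, rfl, h₃⟩ := ih₁ ht hR.2
    cases l <;> cases h₁
    case out M₀ N₀ hM₀ _ =>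
    obtain ⟨l, S', h₁', rfl, h₃'⟩ := ih₂ (R := S) (ht.shift k)
      (by rw [hR.1, Proc.subst_comp_shiftT])
    cases l <;> cases h₁'
    case inp M₁ hM₁ =>
    refine ⟨.tau, ((S'.subst (liftS (j + 1) fun y => var (y + k))).subst
      (instS (shiftT j N₀))).par (R'.shift j), .tau, ?_, ?_⟩
    · simp only [Lab.params, Nat.add_zero, Proc.subst, close_residual, shift_close_residual]
    · have := Tr.closeR (P := S.subst φ₂) h₃ (by rwa [Proc.subst_comp_shiftT] at h₃')
        (ht.close hM hM₀ hM₁)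
      simpa only [Lab.params, Nat.add_zero, Proc.subst, close_residual, shift_close_residual,
        Lab.subst] using this
  | @repClose E P M M' N k j P' Q' _ _ hM ih₁ ih₂ =>
    intro φ₁ φ₂ E₂ R ht hR
    cases R <;> simp only [Proc.subst, Proc.rep.injEq, reduceCtorEq] at hR
    case rep R =>
    obtain ⟨l, R', h₁, rfl, h₃⟩ := ih₁ ht hR
    cases l <;> cases h₁
    case out M₀ N₀ hM₀ _ =>
    obtain ⟨l, S', h₁', rfl, h₃'⟩ := ih₂ (R := R) (ht.shift k)
      (by rw [hR, Proc.subst_comp_shiftT])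
    cases l <;> cases h₁'
    case inp M₁ hM₁ =>
    have hrep : ∀ φ : ℕ → L.Term ℕ, (R.subst φ).rep.shift (j + k) =
        (R.rep.shift (j + k)).subst (liftS (j + k) φ) := fun φ => by
      rw [Proc.shift_subst_liftS, Proc.subst]
    refine ⟨.tau, ((R'.shift j).par ((S'.subst (liftS (j + 1) fun y => var (y + k))).subst
      (instS (shiftT j N₀)))).par (R.rep.shift (j + k)), .tau, ?_, ?_⟩
    · simp only [Lab.params, Nat.add_zero, Proc.subst, close_residual, shift_close_residual, hR,
        hrep]
    · have := Tr.repClose (P := R.subst φ₂) h₃ (by rwa [Proc.subst_comp_shiftT] at h₃')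
        (ht.close hM hM₀ hM₁)
      rw [hrep] at this
      simpa only [Lab.params, Nat.add_zero, Proc.subst, close_residual, shift_close_residual,
        Lab.subst] using this

end Transitions

/-! ### Correspondence with the given labelled transitions. -/

section Correspondence

variable {L : FirstOrder.Language.{u, v}} {Ax : Set (L.Term ℕ × L.Term ℕ)}

/-- The extended process reached by an action, in terms of the data of the corresponding transition
without label names. -/
inductive Residual : Act L → Lab L → ℕ → Proc L → Ext L → Prop
  | tau (k : ℕ) (P' : Proc L) : Residual .tau .tau k P' ⟨k, idAct k, P'⟩
  | out (M : L.Term ℕ) (x : ℕ) (N : L.Term ℕ) (k : ℕ) (P' : Proc L) :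
      Residual (.out M x) (.out M N) k P' ⟨k, singleAct k x N, P'⟩
  | inp (M N : L.Term ℕ) (k : ℕ) (P' : Proc L) :
      Residual (.inp M N) (.inp M) k P' ⟨k, idAct k, P'.subst (instS (shiftT k N))⟩

theorem shift_succ_subst_instS (Q : Proc L) (k : ℕ) (N : L.Term ℕ) :
    (Q.shift (k + 1)).subst (instS N) = Q.shift k := by
  simp only [Proc.shift_eq, Proc.subst_subst, FirstOrder.Language.Term.subst, ← Nat.add_assoc,
    instS]

namespace Residual

variable {π : Act L} {l : Lab L} {k : ℕ} {P' : Proc L} {A : Ext L}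

theorem parR (h : Residual π l k P' A) (Q : Proc L) :
    Residual π l k (P'.par (Q.shift (k + l.params))) (A.parR Q) := by
  cases h with
  | tau => exact .tau ..
  | out => exact .out ..
  | inp M N => simpa only [Proc.subst, shift_succ_subst_instS, Ext.parR, Ext.parL, Lab.params] using
      Residual.inp M N k (P'.par (Q.shift (k + 1)))

theorem parL (h : Residual π l k P' A) (Q : Proc L) :
    Residual π l k ((Q.shift (k + l.params)).par P') (Ext.parL Q A) := by
  cases h with
  | tau => exact .tau ..
  | out => exact .out ..
  | inp M N => simpa only [Proc.subst, shift_succ_subst_instS, Ext.parR, Ext.parL, Lab.params] using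
      Residual.inp M N k ((Q.shift (k + 1)).par P')

theorem of_parR {Q : Proc L} (h : Residual π l k (P'.par (Q.shift (k + l.params))) A) :
    ∃ B, Residual π l k P' B ∧ A = B.parR Q := by
  cases h with
  | tau => exact ⟨_, .tau .., rfl⟩
  | out => exact ⟨_, .out .., rfl⟩
  | inp M N =>
    refine ⟨_, .inp .., ?_⟩
    simp only [Proc.subst, Lab.params, shift_succ_subst_instS, Ext.parR]

theorem of_parL {Q : Proc L} (h : Residual π l k ((Q.shift (k + l.params)).par P') A) :
    ∃ B, Residual π l k P' B ∧ A = Ext.parL Q B := by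
  cases h with
  | tau => exact ⟨_, .tau .., rfl⟩
  | out => exact ⟨_, .out .., rfl⟩
  | inp M N =>
    refine ⟨_, .inp .., ?_⟩
    simp only [Proc.subst, Lab.params, shift_succ_subst_instS, Ext.parL]

theorem idAct_add (k j : ℕ) : (fun y => idAct k (y + j) : ℕ → L.Term ℕ) = idAct (k + j) := by
  funext y; simp only [idAct]; congr 1; omega

theorem singleAct_add_one (k x : ℕ) (N : L.Term ℕ) :
    (fun y => singleAct k (x + 1) N (y + 1)) = singleAct (k + 1) x N := by
  funext y; simp only [singleAct, Nat.add_right_cancel_iff, Nat.add_assoc, Nat.add_comm 1]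

theorem newN_one {l' : Lab L} (h : Residual π.shift l' k P' A) :
    ∃ l, l' = l.shift ∧ Residual π l (k + 1) P' (A.newN 1) := by
  cases π with
  | tau =>
    cases h
    exact ⟨.tau, rfl, by simpa only [Ext.newN, idAct_add] using Residual.tau ..⟩
  | out M x =>
    cases h with
    | out _ _ N =>
      exact ⟨.out M N, rfl, by simpa only [Ext.newN, singleAct_add_one] using Residual.out ..⟩
  | inp M N =>
    cases h with
    | inp _ _ _ P' =>
    refine ⟨.inp M, rfl, ?_⟩
    have := Residual.inp M N (k + 1) P'
    rwa [Nat.add_comm k 1, ← shiftT_shiftT, Nat.add_comm 1 k, ← idAct_add] at this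

theorem of_newN_one (h : Residual π l (k + 1) P' A) :
    ∃ B, Residual π.shift l.shift k P' B ∧ A = B.newN 1 := by
  generalize hj : k + 1 = j at h
  cases h with
  | tau => subst hj; exact ⟨_, .tau .., by simp only [Ext.newN, idAct_add]⟩
  | out => subst hj; exact ⟨_, .out .., by simp only [Ext.newN, singleAct_add_one]⟩
  | inp M N =>
    subst hj
    exact ⟨_, .inp .., by simp only [Ext.newN, idAct_add, shiftT_shiftT, Nat.add_comm 1 k]⟩

end Residual

theorem singleAct_injective {k x : ℕ} {N N' : L.Term ℕ} (h : singleAct k x N = singleAct k x N') :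
    N = N' := by
  simpa [singleAct] using congrFun h x

/-- Dropping the bound variable of an output loses nothing: its payload can be read off the active
substitution of the residual. -/
theorem Step.exists_tr {E : Set ℕ} {P : Proc L} {π : Act L} {A : Ext L} (h : Step Ax E P π A) :
    ∃ l k P', Residual π l k P' A ∧ Tr Ax E P l k P' := by
  induction h with
  | @inp E M M' P N hM =>
    refine ⟨_, 0, P, ?_, .inp hM⟩
    simpa only [shiftT_zero, Ext.ofProc] using Residual.inp M' N 0 P
  | out hM hx => exact ⟨_, 0, _, .out .., .out hM⟩
  | sumL _ ih => obtain ⟨l, k, P', hr, ht⟩ := ih; exact ⟨l, k, P', hr, .sumL ht⟩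
  | sumR _ ih => obtain ⟨l, k, P', hr, ht⟩ := ih; exact ⟨l, k, P', hr, .sumR ht⟩
  | mat hM _ ih => obtain ⟨l, k, P', hr, ht⟩ := ih; exact ⟨l, k, P', hr, .mat hM ht⟩
  | mis _ hM ih => obtain ⟨l, k, P', hr, ht⟩ := ih; exact ⟨l, k, P', hr, .mis hM ht⟩
  | res _ ih =>
    obtain ⟨l, k, P', hr, ht⟩ := ih
    obtain ⟨l, rfl, hr'⟩ := hr.newN_one
    exact ⟨l, k + 1, P', hr', .res ht⟩
  | parL _ _ ih => obtain ⟨l, k, P', hr, ht⟩ := ih; exact ⟨l, k, _, hr.parR _, .parL ht⟩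
  | parR _ _ ih => obtain ⟨l, k, P', hr, ht⟩ := ih; exact ⟨l, k, _, hr.parL _, .parR ht⟩
  | repAct _ _ ih => obtain ⟨l, k, P', hr, ht⟩ := ih; exact ⟨l, k, _, hr.parR _, .repAct ht⟩
  | closeL _ _ hM hx ih₁ ih₂ =>
    obtain ⟨l, k, P', hr, ht⟩ := ih₁
    -- The payload is the value of the active substitution at `x`, so `singleAct_injective`
    -- identifies it with the one in the induction hypothesis.
    generalize hA : (Ext.mk _ (singleAct _ _ _) _ : Ext L) = A at hr
    cases hr with
    | out M x N' k P'' =>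
    simp only [Ext.mk.injEq] at hA
    obtain ⟨rfl, hA, rfl⟩ := hA
    obtain rfl := singleAct_injective hA
    obtain ⟨l, j, Q', hr, ht'⟩ := ih₂
    cases hr with
    | inp =>
    refine ⟨.tau, j + _, _, ?_, .closeL ht ht' hM⟩
    simpa only [Ext.newN, Ext.parL, Residual.idAct_add] using Residual.tau ..
  | closeR _ _ hM hx ih₁ ih₂ =>
    obtain ⟨l, k, P', hr, ht⟩ := ih₁
    generalize hA : (Ext.mk _ (singleAct _ _ _) _ : Ext L) = A at hr
    cases hr with
    | out M x N' k P'' =>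
    simp only [Ext.mk.injEq] at hA
    obtain ⟨rfl, hA, rfl⟩ := hA
    obtain rfl := singleAct_injective hA
    obtain ⟨l, j, Q', hr, ht'⟩ := ih₂
    cases hr with
    | inp =>
    refine ⟨.tau, j + _, _, ?_, .closeR ht ht' hM⟩
    simpa only [Ext.newN, Ext.parR, Residual.idAct_add] using Residual.tau ..
  | repClose _ _ hM ih₁ ih₂ =>
    obtain ⟨l, k, P', hr, ht⟩ := ih₁
    generalize hA : (Ext.mk _ (singleAct _ _ _) _ : Ext L) = A at hr
    cases hr with
    | out M x N' k P'' =>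
    simp only [Ext.mk.injEq] at hA
    obtain ⟨rfl, hA, rfl⟩ := hA
    obtain rfl := singleAct_injective hA
    obtain ⟨l, j, Q', hr, ht'⟩ := ih₂
    cases hr with
    | inp =>
    refine ⟨.tau, j + _, _, ?_, .repClose ht ht' hM⟩
    simpa only [Ext.newN, Ext.parL, Ext.parR, Proc.shift_shift, Residual.idAct_add,
      Nat.add_comm _ j] using Residual.tau ..

/-- The names that the bound variable of an action has to avoid. -/
def Act.Avoids : Act L → Set ℕ → Prop
  | .out M x, S => x ∉ fvT M ∧ x ∉ S
  | _, _ => True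

theorem Act.Avoids.mono {π : Act L} {S T : Set ℕ} (h : π.Avoids S) (hT : T ⊆ S) : π.Avoids T := by
  cases π with
  | out M x => exact ⟨h.1, fun h' => h.2 (hT h')⟩
  | _ => trivial

theorem Act.Avoids.disjoint {π : Act L} {S : Set ℕ} (h : π.Avoids S) : Disjoint π.bn S := by
  cases π with
  | out M x => exact disjoint_singleton_left.2 h.2
  | _ => exact disjoint_left.2 fun _ h => h.elim

theorem Act.Avoids.shift {π : Act L} {S T : Set ℕ} (h : π.Avoids S)
    (hT : ∀ y, y + 1 ∈ T → y ∈ S) : π.shift.Avoids T := by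
  cases π with
  | out M x => exact ⟨fun h' => h.1 (add_mem_fvT_shiftT.1 h'), fun h' => h.2 (hT _ h')⟩
  | _ => trivial

/-- Any sufficiently fresh variable may name the output. For the outputs inside communications one
must be chosen, which is possible as only finitely many variables are forbidden. -/
theorem Tr.toStep {E : Set ℕ} {P P' : Proc L} {l : Lab L} {k : ℕ} (h : Tr Ax E P l k P')
    (hE : E.Finite) {π : Act L} {A : Ext L} (hr : Residual π l k P' A)
    (ha : π.Avoids (P.fv ∪ E)) : Step Ax E P π A := by
  induction h generalizing π A with
  | @inp E M M' P hM =>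
    cases hr with
    | inp _ N => simpa only [shiftT_zero, Ext.ofProc] using Step.inp N hM
  | @out E M M' N P hM =>
    cases hr with
    | out =>
    refine .out hM ?_
    obtain ⟨h₁, h₂⟩ := ha
    simp only [Proc.fv, mem_union, not_or] at h₂ ⊢
    tauto
  | sumL _ ih => exact .sumL (ih hE hr (ha.mono (union_subset_union_left _ subset_union_left)))
  | sumR _ ih => exact .sumR (ih hE hr (ha.mono (union_subset_union_left _ subset_union_right)))
  | mat hM _ ih =>
    exact .mat hM (ih hE hr (ha.mono (union_subset_union_left _ subset_union_right)))
  | mis hM _ ih =>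
    exact .mis (ih hE hr (ha.mono (union_subset_union_left _ subset_union_right))) hM
  | res _ ih =>
    obtain ⟨B, hB, rfl⟩ := hr.of_newN_one
    refine .res (ih (extendEnv_eq _ ▸ envN_finite 1 hE) hB (ha.shift ?_))
    rintro y (h | h)
    · exact .inl h
    · rw [extendEnv_eq, add_mem_envN] at h; exact .inr h
  | parL _ ih =>
    obtain ⟨B, hB, rfl⟩ := hr.of_parR
    exact .parL (ih hE hB (ha.mono (union_subset_union_left _ subset_union_left)))
      (ha.mono (T := _) (subset_union_right.trans subset_union_left)).disjoint
  | parR _ ih =>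
    obtain ⟨B, hB, rfl⟩ := hr.of_parL
    exact .parR (ih hE hB (ha.mono (union_subset_union_left _ subset_union_right)))
      (ha.mono (T := _) (subset_union_left.trans subset_union_left)).disjoint
  | repAct _ ih =>
    obtain ⟨B, hB, rfl⟩ := hr.of_parR
    exact .repAct (ih hE hB ha) (ha.mono subset_union_left).disjoint
  | @closeL E P Q M M' N k j P' Q' _ _ hM ih₁ ih₂ =>
    cases hr
    obtain ⟨x, hx⟩ := (((fvT_finite M).union (P.fv_finite.union hE)).union
      Q.fv_finite).infinite_compl.nonempty
    simp only [mem_compl_iff, mem_union, not_or] at hx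
    have := Step.closeL (ih₁ hE (.out M x N k P') ⟨hx.1.1, fun h => h.elim hx.1.2.1 hx.1.2.2⟩)
      (ih₂ (hE.image _) (.inp M' N j Q') trivial) hM hx.2
    simpa only [Ext.newN, Ext.parL, Residual.idAct_add] using this
  | @closeR E P Q M M' N k j P' Q' _ _ hM ih₁ ih₂ =>
    cases hr
    obtain ⟨x, hx⟩ := (((fvT_finite M).union (Q.fv_finite.union hE)).union
      P.fv_finite).infinite_compl.nonempty
    simp only [mem_compl_iff, mem_union, not_or] at hx
    have := Step.closeR (ih₁ hE (.out M x N k Q') ⟨hx.1.1, fun h => h.elim hx.1.2.1 hx.1.2.2⟩)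
      (ih₂ (hE.image _) (.inp M' N j P') trivial) hM hx.2
    simpa only [Ext.newN, Ext.parR, Residual.idAct_add] using this
  | @repClose E P M M' N k j P' Q' _ _ hM ih₁ ih₂ =>
    cases hr
    obtain ⟨x, hx⟩ := ((fvT_finite M).union (P.fv_finite.union hE)).infinite_compl.nonempty
    simp only [mem_compl_iff, mem_union, not_or] at hx
    have := Step.repClose (ih₁ hE (.out M x N k P') ⟨hx.1, fun h => h.elim hx.2.1 hx.2.2⟩)
      (ih₂ (hE.image _) (.inp M' N j Q') trivial) hM
    simpa only [Ext.newN, Ext.parL, Ext.parR, Proc.shift_shift, Residual.idAct_add,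
      Nat.add_comm k j] using this

end Correspondence

/-! ### Interfaces, links and chains. -/

section Links

variable {L : FirstOrder.Language.{u, v}} {Ax : Set (L.Term ℕ × L.Term ℕ)}

/-- Substitution of names by `δ` with `k` new private names, together with a new interface: `ξ y` is
a recipe over the old interface, on the left, and the new names, on the right. -/
def Ext.map (k : ℕ) (δ : ℕ → L.Term ℕ) (ξ : ℕ → L.Term (ℕ ⊕ ℕ)) (A : Ext L) : Ext L :=
  ⟨A.n + k, fun y => (ξ y).subst
    (Sum.elim (fun z => (A.act z).subst (liftS A.n δ)) (fun i => var (i + A.n))),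
    A.proc.subst (liftS A.n δ)⟩

/-- Change of interface. -/
def Ext.reint (η : ℕ → L.Term ℕ) (A : Ext L) : Ext L :=
  ⟨A.n, fun y => (η y).subst A.act, A.proc⟩

/-- Permutation of indices. -/
def Ext.perm (p : Equiv.Perm ℕ) (A : Ext L) : Ext L :=
  ⟨A.n, fun y => (A.act y).subst (fun i => var (p i)), A.proc.subst (fun i => var (p i))⟩

/-- Weakening by `k` private names that are put into the interface. -/
def Ext.expose (k : ℕ) (A : Ext L) : Ext L := ⟨A.n + k, liftS k A.act, A.proc.shift k⟩

/-- Extension of an interface by a message. -/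
def consS (N : L.Term ℕ) (φ : ℕ → L.Term ℕ) : ℕ → L.Term ℕ
  | 0 => N
  | y + 1 => φ y

/-- The residual of a transition without payload. -/
def Ext.after (A : Ext L) (k : ℕ) (P' : Proc L) : Ext L :=
  ⟨A.n + k, fun y => shiftT k (A.act y), P'⟩

/-- The residual of an output transition. -/
def Ext.afterOut (A : Ext L) (k : ℕ) (N : L.Term ℕ) (P' : Proc L) : Ext L :=
  ⟨A.n + k, consS N fun y => shiftT k (A.act y), P'⟩

/-- Parallel composition in either order. -/
def Proc.parB : Bool → Proc L → Proc L → Proc L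
  | true, P, Q => P.par Q
  | false, P, Q => Q.par P

/-- Parallel composition with a recipe process. -/
def Ext.parB (b : Bool) (R : Proc L) (A : Ext L) : Ext L :=
  ⟨A.n, A.act, Proc.parB b A.proc (R.subst A.act)⟩

theorem Proc.parB_subst (b : Bool) (P Q : Proc L) (σ : ℕ → L.Term ℕ) :
    (Proc.parB b P Q).subst σ = Proc.parB b (P.subst σ) (Q.subst σ) := by
  cases b <;> rfl

/-- The permutation that moves `k` indices from behind `n` others to the front. -/
def blockSwap (n k : ℕ) : Equiv.Perm ℕ where
  toFun i := if i < n then i + k else if i < n + k then i - n else i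
  invFun i := if i < k then i + n else if i < n + k then i - k else i
  left_inv i := by simp only; split_ifs <;> omega
  right_inv i := by simp only; split_ifs <;> omega

theorem blockSwap_of_lt {n k i : ℕ} (h : i < n) : blockSwap n k i = i + k := if_pos h

theorem blockSwap_add {n k i : ℕ} (h : i < k) : blockSwap n k (i + n) = i := by
  simp only [blockSwap, Equiv.coe_fn_mk]; split_ifs <;> omega

theorem blockSwap_of_le {n k i : ℕ} (h : n + k ≤ i) : blockSwap n k i = i := by
  simp only [blockSwap, Equiv.coe_fn_mk]; split_ifs <;> omega

/-- New names introduced by `Ext.map` sit behind the `n` existing private names, those of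
`Ext.expose` in front of them; the block swap reconciles the two positions. -/
theorem liftS_shift_blockSwap (n k : ℕ) (δ : ℕ → L.Term ℕ) :
    (fun i => (liftS n (fun y => shiftT k (δ y)) i).subst fun i => var (blockSwap n k i)) =
      fun i => shiftT k (liftS n δ i) := by
  funext i
  obtain h | ⟨y, rfl⟩ := lt_or_eq_add n i
  · simp [h, blockSwap_of_lt h, shiftT_eq]
  · simp only [liftS_add_right, shiftT_eq, Term.subst_subst, FirstOrder.Language.Term.subst]
    congr 1; funext z
    rw [blockSwap_of_le (by omega)]
    congr 1; omega

theorem Ext.ext' {A B : Ext L} (h₁ : A.n = B.n) (h₂ : ∀ y, A.act y = B.act y)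
    (h₃ : A.proc = B.proc) : A = B := by
  cases A; cases B
  simp only [Ext.mk.injEq]
  exact ⟨h₁, funext h₂, h₃⟩

/-- Closure of maps under composition is what makes a property of all maps of a link usable in an
induction over links. -/
theorem Ext.map_map (A : Ext L) (k k' : ℕ) (δ δ' : ℕ → L.Term ℕ) (ξ ξ' : ℕ → L.Term (ℕ ⊕ ℕ)) :
    (A.map k δ ξ).map k' δ' ξ' = A.map (k + k') (fun y => (δ y).subst (liftS k δ'))
      (fun y => (ξ' y).subst (Sum.elim
        (fun z => (ξ z).subst (Sum.elim (fun w => var (.inl w))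
          (fun i => (liftS k δ' i).subst fun v => var (.inr v))))
        (fun i => var (.inr (i + k))))) := by
  refine Ext.ext' (by simp only [Ext.map]; omega) (fun y => ?_) ?_
  · simp only [Ext.map, Term.subst_subst]
    congr 1
    funext s
    cases s with
    | inr i => simp only [Sum.elim_inr, FirstOrder.Language.Term.subst]; congr 1; omega
    | inl z =>
      simp only [Sum.elim_inl, Term.subst_subst]
      congr 1
      funext s
      cases s with
      | inl w =>
        simp only [Sum.elim_inl, Term.subst_subst, FirstOrder.Language.Term.subst]
        rw [← liftS_comp, liftS_liftS, Nat.add_comm k]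
      | inr i =>
        simp only [Sum.elim_inr, Term.subst_subst, FirstOrder.Language.Term.subst]
        rw [Nat.add_comm A.n k, ← liftS_liftS, liftS_add_right, shiftT_eq]
  · simp only [Ext.map, Proc.subst_subst]
    rw [← liftS_comp, liftS_liftS, Nat.add_comm k]

theorem Ext.map_zero (A : Ext L) : A.map 0 var (fun y => var (.inl y)) = A :=
  Ext.ext' rfl (fun y => by simp [Ext.map, liftS_var, Term.subst_var])
    (by simp [Ext.map, liftS_var, Proc.subst_var])

theorem Ext.reint_eq_map (A : Ext L) (η : ℕ → L.Term ℕ) :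
    A.reint η = A.map 0 var (fun y => (η y).subst fun z => var (.inl z)) :=
  Ext.ext' rfl (fun y => by simp [Ext.map, Ext.reint, liftS_var, Term.subst_subst, Term.subst_var])
    (by simp [Ext.map, Ext.reint, liftS_var, Proc.subst_var])

/-- The interface of the exposed private names. -/
def exposeRec (k : ℕ) : ℕ → L.Term (ℕ ⊕ ℕ) :=
  fun i => if i < k then var (.inr i) else var (.inl (i - k))

theorem Ext.expose_map (A : Ext L) (k : ℕ) (δ : ℕ → L.Term ℕ) :
    (A.map 0 δ fun y => var (.inl y)).expose k =
      (A.map k (fun y => shiftT k (δ y)) (exposeRec k)).perm (blockSwap A.n k) := by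
  refine Ext.ext' rfl (fun i => ?_) ?_
  · simp only [Ext.expose, Ext.map, Ext.perm, exposeRec]
    obtain h | ⟨y, rfl⟩ := lt_or_eq_add k i
    · simp [h, blockSwap_add h]
    · simp only [show ¬ y + k < k by omega, if_false, liftS_add_right, Nat.add_sub_cancel,
        FirstOrder.Language.Term.subst, Sum.elim_inl, Term.subst_subst, liftS_shift_blockSwap,
        subst_comp_shiftT]
  · simp only [Ext.expose, Ext.map, Ext.perm, Proc.subst_subst, liftS_shift_blockSwap,
      Proc.subst_comp_shiftT]

theorem Ext.expose_eq (A : Ext L) (k : ℕ) :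
    A.expose k = (A.map k (fun y => var (y + k)) (exposeRec k)).perm (blockSwap A.n k) := by
  have := A.expose_map k var
  rwa [Ext.map_zero] at this

theorem liftS_perm_comm {n : ℕ} {p : Equiv.Perm ℕ} (hp : ∀ i, n ≤ i → p i = i)
    (δ : ℕ → L.Term ℕ) :
    (fun i => ((var (p i) : L.Term ℕ)).subst (liftS n δ)) =
      fun i => (liftS n δ i).subst fun i => var (p i) := by
  funext i
  simp only [FirstOrder.Language.Term.subst]
  obtain h | ⟨y, rfl⟩ := lt_or_eq_add n i
  · have : p i < n := by
      by_contra h'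
      have := p.injective (hp (p i) (by omega))
      omega
    simp [h, this]
  · rw [hp _ (by omega), liftS_add_right]
    simp only [shiftT_eq, Term.subst_subst, FirstOrder.Language.Term.subst]
    congr 1; funext z
    rw [hp _ (by omega)]

theorem Ext.perm_map (A : Ext L) {p : Equiv.Perm ℕ} (hp : ∀ i, A.n ≤ i → p i = i) (k : ℕ)
    (δ : ℕ → L.Term ℕ) (ξ : ℕ → L.Term (ℕ ⊕ ℕ)) :
    (A.perm p).map k δ ξ = (A.map k δ ξ).perm p := by
  refine Ext.ext' rfl (fun y => ?_) ?_
  · simp only [Ext.map, Ext.perm, Term.subst_subst]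
    congr 1
    funext s
    cases s with
    | inl z => simp only [Sum.elim_inl, liftS_perm_comm hp, Term.subst_subst]
    | inr i =>
      simp only [Sum.elim_inr, FirstOrder.Language.Term.subst]
      rw [hp _ (by omega)]
  · simp only [Ext.map, Ext.perm, Proc.subst_subst, liftS_perm_comm hp]

theorem Ext.perm_symm (A : Ext L) (p : Equiv.Perm ℕ) : (A.perm p).perm p.symm = A :=
  Ext.ext' rfl (fun y => by simp [Ext.perm, Term.subst_subst, Term.subst_var])
    (by simp [Ext.perm, Proc.subst_subst, Proc.subst_var])

/-- Interface recipes that retain both the recipes `ξ` and the old interface. -/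
def pairRec (ξ : ℕ → L.Term (ℕ ⊕ ℕ)) : ℕ → L.Term (ℕ ⊕ ℕ) :=
  fun i => if i % 2 = 0 then ξ (i / 2) else var (.inl (i / 2))

theorem pairRec_even (ξ : ℕ → L.Term (ℕ ⊕ ℕ)) (y : ℕ) : pairRec ξ (2 * y) = ξ y := by
  simp [pairRec]

theorem pairRec_odd (ξ : ℕ → L.Term (ℕ ⊕ ℕ)) (y : ℕ) : pairRec ξ (2 * y + 1) = var (.inl y) := by
  simp only [pairRec, show (2 * y + 1) % 2 = 1 by omega, show (2 * y + 1) / 2 = y by omega]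
  rfl

/-- The new interface `ξ` may forget messages that `R` uses. Keeping the old interface at the odd
positions lets `R` remain a recipe; restricting to the even positions afterwards restores `ξ`. -/
theorem Ext.parB_map (A : Ext L) (b : Bool) (R : Proc L) (k : ℕ) (δ : ℕ → L.Term ℕ)
    (ξ : ℕ → L.Term (ℕ ⊕ ℕ)) :
    (A.parB b R).map k δ ξ = ((A.map k δ (pairRec ξ)).parB b
      (R.subst fun y => var (2 * y + 1))).reint (fun y => var (2 * y)) := by
  refine Ext.ext' rfl (fun y => ?_) ?_
  · simp only [Ext.map, Ext.parB, Ext.reint, FirstOrder.Language.Term.subst, pairRec_even]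
  · simp only [Ext.map, Ext.parB, Ext.reint, FirstOrder.Language.Term.subst, pairRec_odd,
      Proc.parB_subst, Proc.subst_subst, Sum.elim_inl]

/-- Quasi-open bisimilarity of extended processes with the same domain. -/
def Bisim (Ax : Set (L.Term ℕ × L.Term ℕ)) (A B : Ext L) : Prop :=
  QuasiOpenBisimilar Ax A B ∧ A.dom = B.dom

/-- One-hole contexts around quasi-open bisimilar extended processes. Here the messages `act` are an
arbitrary interface to the names and secrets of an extended process. -/
inductive Link (Ax : Set (L.Term ℕ × L.Term ℕ)) : Ext L → Ext L → Prop
  | base {A B} (h : Bisim Ax A B) : Link Ax A B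
  | map {A B} (k δ ξ) (h : Link Ax A B) : Link Ax (A.map k δ ξ) (B.map k δ ξ)
  | perm (A : Ext L) {p : Equiv.Perm ℕ} (hp : ∀ i, A.n ≤ i → p i = i) : Link Ax A (A.perm p)
  | par {A B} (b R) (h : Link Ax A B) : Link Ax (A.parB b R) (B.parB b R)
  | new {n m a b : ℕ} {φ ψ : ℕ → L.Term ℕ} {P Q : Proc L}
      (h : Link Ax ⟨n + a, fun y => shiftT a (φ y), P⟩ ⟨m + b, fun y => shiftT b (ψ y), Q⟩) :
      Link Ax ⟨n, φ, P.newN a⟩ ⟨m, ψ, Q.newN b⟩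
  | out {P Q} (M N) (h : Link Ax (.ofProc P) (.ofProc Q)) :
      Link Ax (.ofProc (.out M N P)) (.ofProc (.out M N Q))
  | inp {P Q} (M) (h : Link Ax (.ofProc P) (.ofProc Q)) :
      Link Ax (.ofProc (.inp M P)) (.ofProc (.inp M Q))
  | mat {P Q} (M N) (h : Link Ax (.ofProc P) (.ofProc Q)) :
      Link Ax (.ofProc (.mat M N P)) (.ofProc (.mat M N Q))
  | mis {P Q} (M N) (h : Link Ax (.ofProc P) (.ofProc Q)) :
      Link Ax (.ofProc (.mis M N P)) (.ofProc (.mis M N Q))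
  | plusL {P Q} (R) (h : Link Ax (.ofProc P) (.ofProc Q)) :
      Link Ax (.ofProc (.plus P R)) (.ofProc (.plus Q R))
  | plusR {P Q} (R) (h : Link Ax (.ofProc P) (.ofProc Q)) :
      Link Ax (.ofProc (.plus R P)) (.ofProc (.plus R Q))
  | rep {P Q} (h : Link Ax (.ofProc P) (.ofProc Q)) :
      Link Ax (.ofProc (.rep P)) (.ofProc (.rep Q))

/-- Chains of links. -/
abbrev Chain (Ax : Set (L.Term ℕ × L.Term ℕ)) : Ext L → Ext L → Prop :=
  Relation.ReflTransGen (Link Ax)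

theorem Link.symm {A B : Ext L} (h : Link Ax A B) : Link Ax B A := by
  induction h with
  | base h =>
    obtain ⟨⟨R, hR, h⟩, hd⟩ := h
    exact .base ⟨⟨R, hR, hR.symm _ _ h⟩, hd.symm⟩
  | map k δ ξ _ ih => exact .map k δ ξ ih
  | perm A hp =>
    have := Link.perm (Ax := Ax) (A.perm ‹_›) (p := Equiv.symm ‹_›)
      fun i hi => (Equiv.symm_apply_eq _).2 (hp i hi).symm
    rwa [Ext.perm_symm] at this
  | par b R _ ih => exact .par b R ih
  | new _ ih => exact .new ih
  | out M N _ ih => exact .out M N ih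
  | inp M _ ih => exact .inp M ih
  | mat M N _ ih => exact .mat M N ih
  | mis M N _ ih => exact .mis M N ih
  | plusL R _ ih => exact .plusL R ih
  | plusR R _ ih => exact .plusR R ih
  | rep _ ih => exact .rep ih

namespace Chain

variable {A B : Ext L}

theorem lift {f : Ext L → Ext L} (hf : ∀ A B, Link Ax A B → Link Ax (f A) (f B))
    (h : Chain Ax A B) : Chain Ax (f A) (f B) := by
  induction h with
  | refl => exact .refl
  | tail _ h ih => exact ih.tail (hf _ _ h)

theorem map (h : Chain Ax A B) (k : ℕ) (δ : ℕ → L.Term ℕ) (ξ : ℕ → L.Term (ℕ ⊕ ℕ)) :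
    Chain Ax (A.map k δ ξ) (B.map k δ ξ) :=
  h.lift (f := Ext.map k δ ξ) fun _ _ h => h.map k δ ξ

theorem par (h : Chain Ax A B) (b : Bool) (R : Proc L) : Chain Ax (A.parB b R) (B.parB b R) :=
  h.lift (f := Ext.parB b R) fun _ _ h => h.par b R

theorem reint (h : Chain Ax A B) (η : ℕ → L.Term ℕ) : Chain Ax (A.reint η) (B.reint η) := by
  rw [Ext.reint_eq_map, Ext.reint_eq_map]; exact h.map _ _ _

/-- Exposing names is a map up to a permutation of private names, and the permutation is itself a
link on either side. -/
theorem expose (h : Chain Ax A B) (k : ℕ) : Chain Ax (A.expose k) (B.expose k) := by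
  have key : ∀ A : Ext L, Link Ax (A.map k (fun y => var (y + k)) (exposeRec k)) (A.expose k) :=
    fun A => A.expose_eq k ▸ .perm _ fun i hi => blockSwap_of_le hi
  exact (Relation.ReflTransGen.single (key A).symm).trans ((h.map _ _ _).tail (key B))

end Chain

/-- The names as an interface of a process. -/
theorem Link.ofProc_map {P Q : Proc L} (h : Link Ax (.ofProc P) (.ofProc Q)) (k : ℕ)
    (δ χ : ℕ → L.Term ℕ) : Link Ax ⟨k, χ, P.subst δ⟩ ⟨k, χ, Q.subst δ⟩ := by
  have key : ∀ P : Proc L, (Ext.ofProc P).map k δ (fun y => (χ y).subst fun i => var (.inr i)) =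
      ⟨k, χ, P.subst δ⟩ := fun P => by
    refine Ext.ext' (Nat.zero_add k) (fun y => ?_) ?_
    · simp only [Ext.map, Ext.ofProc, Term.subst_subst, FirstOrder.Language.Term.subst,
        Sum.elim_inr, Nat.add_zero]
      exact Term.subst_var _
    · simp only [Ext.map, Ext.ofProc, liftS_zero]
  rw [← key P, ← key Q]
  exact h.map _ _ _

end Links

/-! ### Simulation up to chains. -/

section Simulation

variable {L : FirstOrder.Language.{u, v}} {Ax : Set (L.Term ℕ × L.Term ℕ)}

/-- The transitions of `A` with labels given by recipes are matched by `B` up to chains. -/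
structure Sim (Ax : Set (L.Term ℕ × L.Term ℕ)) (A B : Ext L) : Prop where
  tau : ∀ {k P'}, Tr Ax (Iio A.n) A.proc .tau k P' →
    ∃ j Q', Tr Ax (Iio B.n) B.proc .tau j Q' ∧ Chain Ax (A.after k P') (B.after j Q')
  out : ∀ (M : L.Term ℕ) {N k P'}, Tr Ax (Iio A.n) A.proc (.out (M.subst A.act) N) k P' →
    ∃ N' j Q', Tr Ax (Iio B.n) B.proc (.out (M.subst B.act) N') j Q' ∧
      Chain Ax (A.afterOut k N P') (B.afterOut j N' Q')
  inp : ∀ (M N : L.Term ℕ) {k P'}, Tr Ax (Iio A.n) A.proc (.inp (M.subst A.act)) k P' →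
    ∃ j Q', Tr Ax (Iio B.n) B.proc (.inp (M.subst B.act)) j Q' ∧
      Chain Ax (A.after k (P'.subst (instS (shiftT k (N.subst A.act)))))
        (B.after j (Q'.subst (instS (shiftT j (N.subst B.act)))))

section Transfer

variable {E₁ E₂ : Set ℕ} {φ₁ φ₂ : ℕ → L.Term ℕ} {R P' : Proc L} {k : ℕ}

theorem Tr.transfer_tau (h : Tr Ax E₁ (R.subst φ₁) .tau k P') (ht : Transferable Ax E₁ φ₁ E₂ φ₂) :
    ∃ R' : Proc L, P' = R'.subst (liftS k φ₁) ∧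
      Tr Ax E₂ (R.subst φ₂) .tau k (R'.subst (liftS k φ₂)) := by
  obtain ⟨l, R', h₁, h₂, h₃⟩ := h.transfer ht rfl
  cases l <;> cases h₁
  exact ⟨R', h₂, h₃⟩

theorem Tr.transfer_out {M N : L.Term ℕ} (h : Tr Ax E₁ (R.subst φ₁) (.out M N) k P')
    (ht : Transferable Ax E₁ φ₁ E₂ φ₂) : ∃ (M₀ N₀ : L.Term ℕ) (R' : Proc L),
      EqTheory Ax M (M₀.subst φ₁) ∧ N = N₀.subst (liftS k φ₁) ∧ P' = R'.subst (liftS k φ₁) ∧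
      Tr Ax E₂ (R.subst φ₂) (.out (M₀.subst φ₂) (N₀.subst (liftS k φ₂))) k
        (R'.subst (liftS k φ₂)) := by
  obtain ⟨l, R', h₁, h₂, h₃⟩ := h.transfer ht rfl
  cases l <;> cases h₁
  exact ⟨_, _, R', ‹_›, rfl, h₂, h₃⟩

theorem Tr.transfer_inp {M : L.Term ℕ} (h : Tr Ax E₁ (R.subst φ₁) (.inp M) k P')
    (ht : Transferable Ax E₁ φ₁ E₂ φ₂) : ∃ (M₀ : L.Term ℕ) (R' : Proc L),
      EqTheory Ax M (M₀.subst φ₁) ∧ P' = R'.subst (liftS (k + 1) φ₁) ∧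
      Tr Ax E₂ (R.subst φ₂) (.inp (M₀.subst φ₂)) k (R'.subst (liftS (k + 1) φ₂)) := by
  obtain ⟨l, R', h₁, h₂, h₃⟩ := h.transfer ht rfl
  cases l <;> cases h₁
  exact ⟨_, R', ‹_›, h₂, h₃⟩

/-- The `k` new names do not occur in `P`, so `F` is unconstrained on them. This covers both the
environment of a receiver in the communication rules, which omits them, and that of an extended
process with `k` exposed names, which contains them. -/
theorem Tr.shift_inp {E F : Set ℕ} {P : Proc L} {M : L.Term ℕ} {j : ℕ}
    (h : Tr Ax E P (.inp M) j P') (hE : E.Finite) (hF : F.Finite) (hEF : ∀ y, y + k ∈ F ↔ y ∈ E) :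
    Tr Ax F (P.shift k) (.inp (shiftT k M)) j (P'.subst (liftS (j + 1) fun y => var (y + k))) := by
  have ht : Transferable Ax E var F (fun y => var (y + k)) :=
    .ren (r₁ := id) Function.injective_id (add_left_injective k) hE hE hF (fun _ => .rfl) hEF
  rw [← P.subst_var] at h
  obtain ⟨M₀, R', h₁, h₂, h₃⟩ := h.transfer_inp ht
  rw [liftS_var, Proc.subst_var] at h₂
  rw [Term.subst_var] at h₁
  subst h₂
  rw [shiftT_eq]
  exact h₃.label (.inp (h₁.symm.subst _))

theorem Tr.of_shift_inp {E F : Set ℕ} {P : Proc L} {M : L.Term ℕ} {j : ℕ}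
    (h : Tr Ax F (P.shift k) (.inp M) j P') (hE : E.Finite) (hF : F.Finite)
    (hEF : ∀ y, y + k ∈ F ↔ y ∈ E) : ∃ (M₀ : L.Term ℕ) (R' : Proc L),
      EqTheory Ax M (shiftT k M₀) ∧ P' = R'.subst (liftS (j + 1) fun y => var (y + k)) ∧
      Tr Ax E P (.inp M₀) j R' := by
  have ht : Transferable Ax F (fun y => var (y + k)) E var :=
    .ren (r₂ := id) (add_left_injective k) Function.injective_id hE hF hE hEF (fun _ => .rfl)
  obtain ⟨M₀, R', h₁, h₂, h₃⟩ := h.transfer_inp ht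
  rw [liftS_var, Proc.subst_var, Proc.subst_var, Term.subst_var] at h₃
  exact ⟨M₀, R', by rwa [shiftT_eq], h₂, h₃⟩

end Transfer

/-- The residual of the receiver of a message under `k` binders. -/
def Proc.recv (Q : Proc L) (k j : ℕ) (N : L.Term ℕ) : Proc L :=
  (Q.subst (liftS (j + 1) fun y => var (y + k))).subst (instS (shiftT j N))

/-- The receiver's residual is again a recipe, over the old interface extended by the received
message as entry `0`. -/
theorem Proc.recv_subst (S : Proc L) (k j : ℕ) (N : L.Term ℕ) (φ : ℕ → L.Term ℕ) :
    (S.subst (liftS (j + 1) φ)).recv k j N =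
      (S.recv 1 j (var 0)).subst (liftS j (consS N fun y => shiftT k (φ y))) := by
  simp only [Proc.recv, Proc.subst_subst]
  congr 1
  funext a
  obtain h | ⟨y, rfl⟩ := lt_or_eq_add (j + 1) a
  · cases a with
    | zero =>
      simp only [liftS_of_lt _ h, FirstOrder.Language.Term.subst, instS]
      rw [shiftT_subst_liftS]
      rfl
    | succ a =>
      simp [liftS_of_lt _ h, FirstOrder.Language.Term.subst, instS,
        liftS_of_lt _ (show a < j by omega)]
  · have hi : ∀ (N : L.Term ℕ) (a : ℕ), instS N (a + (j + 1)) = var (a + j) := fun _ _ => rfl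
    simp only [liftS_add_right, shiftT_eq, Term.subst_subst, FirstOrder.Language.Term.subst, hi,
      consS]

/-! ### Transitions of parallel compositions and replications. -/

section Composition

variable {E : Set ℕ} {P Q X : Proc L} {k : ℕ} {b : Bool}

/-- The receiver need not be weakened before it moves, and since labels matter only up to the
equational theory, both partners can use literally the same channel. -/
theorem Tr.close_unshift {M M' N : L.Term ℕ} {i j : ℕ} {P' Q' : Proc L} (hE : E.Finite)
    (h₁ : Tr Ax E P (.out M N) i P') (h₂ : Tr Ax ((fun y => y + i) '' E) (Q.shift i) (.inp M') j Q')
    (hM : EqTheory Ax (shiftT i M) M') : ∃ (M : L.Term ℕ) (Q'' : Proc L),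
      Tr Ax E P (.out M N) i P' ∧ Tr Ax E Q (.inp M) j Q'' ∧
      Q'.subst (instS (shiftT j N)) = Q''.recv i j N := by
  obtain ⟨M₀, Q'', h, rfl, h₃⟩ := h₂.of_shift_inp hE (hE.image _) fun _ => add_mem_image
  exact ⟨M₀, Q'', h₁.label (.out _ (eqTheory_shiftT_iff.1 (hM.trans h))), h₃, rfl⟩

theorem Tr.parB_left {l : Lab L} {P' : Proc L} (h : Tr Ax E P l k P') :
    Tr Ax E (P.parB b Q) l k (P'.parB b (Q.shift (k + l.params))) := by
  cases b
  · exact .parR h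
  · exact .parL h

theorem Tr.parB_right {l : Lab L} {Q' : Proc L} (h : Tr Ax E Q l k Q') :
    Tr Ax E (P.parB b Q) l k ((P.shift (k + l.params)).parB b Q') := by
  cases b
  · exact .parL h
  · exact .parR h

theorem Tr.parB_close_left {M N : L.Term ℕ} {i j : ℕ} {P' Q' : Proc L} (hE : E.Finite)
    (h₁ : Tr Ax E P (.out M N) i P') (h₂ : Tr Ax E Q (.inp M) j Q') :
    Tr Ax E (P.parB b Q) .tau (j + i) ((P'.shift j).parB b (Q'.recv i j N)) := by
  have h₂ := h₂.shift_inp (k := i) hE (hE.image _) fun _ => add_mem_image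
  cases b
  · exact .closeR h₁ h₂ (.refl _)
  · exact .closeL h₁ h₂ (.refl _)

theorem Tr.parB_close_right {M N : L.Term ℕ} {i j : ℕ} {P' Q' : Proc L} (hE : E.Finite)
    (h₁ : Tr Ax E Q (.out M N) i Q') (h₂ : Tr Ax E P (.inp M) j P') :
    Tr Ax E (P.parB b Q) .tau (j + i) ((P'.recv i j N).parB b (Q'.shift j)) := by
  have h₂ := h₂.shift_inp (k := i) hE (hE.image _) fun _ => add_mem_image
  cases b
  · exact .closeL h₁ h₂ (.refl _)
  · exact .closeR h₁ h₂ (.refl _)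

theorem Tr.parB_cases {l : Lab L} (hE : E.Finite) (h : Tr Ax E (P.parB b Q) l k X) :
    (∃ P', Tr Ax E P l k P' ∧ X = P'.parB b (Q.shift (k + l.params))) ∨
    (∃ Q', Tr Ax E Q l k Q' ∧ X = (P.shift (k + l.params)).parB b Q') ∨
    (l = .tau ∧ ∃ (M N : L.Term ℕ) (i j : ℕ) (P' Q' : Proc L), k = j + i ∧
      Tr Ax E P (.out M N) i P' ∧ Tr Ax E Q (.inp M) j Q' ∧
      X = (P'.shift j).parB b (Q'.recv i j N)) ∨
    (l = .tau ∧ ∃ (M N : L.Term ℕ) (i j : ℕ) (P' Q' : Proc L), k = j + i ∧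
      Tr Ax E Q (.out M N) i Q' ∧ Tr Ax E P (.inp M) j P' ∧
      X = (P'.recv i j N).parB b (Q'.shift j)) := by
  cases b
  · cases h with
    | parL h => exact .inr (.inl ⟨_, h, rfl⟩)
    | parR h => exact .inl ⟨_, h, rfl⟩
    | closeL h₁ h₂ hM =>
      obtain ⟨M, Q'', h₁, h₂, he⟩ := h₁.close_unshift hE h₂ hM
      exact .inr (.inr (.inr ⟨rfl, _, _, _, _, _, _, rfl, h₁, h₂, by rw [he]; rfl⟩))
    | closeR h₁ h₂ hM =>
      obtain ⟨M, Q'', h₁, h₂, he⟩ := h₁.close_unshift hE h₂ hM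
      exact .inr (.inr (.inl ⟨rfl, _, _, _, _, _, _, rfl, h₁, h₂, by rw [he]; rfl⟩))
  · cases h with
    | parL h => exact .inl ⟨_, h, rfl⟩
    | parR h => exact .inr (.inl ⟨_, h, rfl⟩)
    | closeL h₁ h₂ hM =>
      obtain ⟨M, Q'', h₁, h₂, he⟩ := h₁.close_unshift hE h₂ hM
      exact .inr (.inr (.inl ⟨rfl, _, _, _, _, _, _, rfl, h₁, h₂, by rw [he]; rfl⟩))
    | closeR h₁ h₂ hM =>
      obtain ⟨M, Q'', h₁, h₂, he⟩ := h₁.close_unshift hE h₂ hM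
      exact .inr (.inr (.inr ⟨rfl, _, _, _, _, _, _, rfl, h₁, h₂, by rw [he]; rfl⟩))

theorem Tr.rep_close {M N : L.Term ℕ} {i j : ℕ} {P' Q' : Proc L} (hE : E.Finite)
    (h₁ : Tr Ax E P (.out M N) i P') (h₂ : Tr Ax E P (.inp M) j Q') :
    Tr Ax E P.rep .tau (j + i)
      (((P'.shift j).par (Q'.recv i j N)).par (P.rep.shift (j + i))) :=
  .repClose h₁ (h₂.shift_inp (k := i) hE (hE.image _) fun _ => add_mem_image) (.refl _)

theorem Tr.rep_cases {l : Lab L} (hE : E.Finite) (h : Tr Ax E P.rep l k X) :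
    (∃ P', Tr Ax E P l k P' ∧ X = P'.par (P.rep.shift (k + l.params))) ∨
    (l = .tau ∧ ∃ (M N : L.Term ℕ) (i j : ℕ) (P' Q' : Proc L), k = j + i ∧
      Tr Ax E P (.out M N) i P' ∧ Tr Ax E P (.inp M) j Q' ∧
      X = ((P'.shift j).par (Q'.recv i j N)).par (P.rep.shift (j + i))) := by
  cases h with
  | repAct h => exact .inl ⟨_, h, rfl⟩
  | repClose h₁ h₂ hM =>
    obtain ⟨M, Q'', h₁, h₂, he⟩ := h₁.close_unshift hE h₂ hM
    exact .inr ⟨rfl, _, _, _, _, _, _, rfl, h₁, h₂, by rw [he]⟩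

end Composition

namespace Sim

variable {A B : Ext L}

/-- Recipes over the new interface are recipes over the old one. -/
theorem reint (h : Sim Ax A B) (η : ℕ → L.Term ℕ) : Sim Ax (A.reint η) (B.reint η) where
  tau ht := by
    obtain ⟨j, Q', h₁, h₂⟩ := h.tau ht
    refine ⟨j, Q', h₁, ?_⟩
    have := h₂.reint η
    simpa only [Ext.after, Ext.reint, subst_comp_shiftT] using this
  out M N k P' ht := by
    simp only [Ext.reint, ← Term.subst_subst] at ht ⊢
    obtain ⟨N', j, Q', h₁, h₂⟩ := h.out _ ht
    refine ⟨N', j, Q', h₁, ?_⟩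
    -- Entry `0` of the residual's interface is the payload and stays in place; the recipes `η` have
    -- to move past it.
    have := h₂.reint (consS (var 0) fun y => shiftT 1 (η y))
    have key : ∀ (N : L.Term ℕ) (k : ℕ) (φ : ℕ → L.Term ℕ),
        (fun y => (consS (var 0) (fun y => shiftT 1 (η y)) y).subst
          (consS N fun y => shiftT k (φ y))) = consS N fun y => shiftT k ((η y).subst φ) := by
      intro N k φ
      funext y
      cases y with
      | zero => rfl
      | succ y =>
        simp only [consS, shiftT_eq, Term.subst_subst, FirstOrder.Language.Term.subst]
    simpa only [Ext.afterOut, Ext.reint, key] using this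
  inp M N k P' ht := by
    simp only [Ext.reint, ← Term.subst_subst] at ht ⊢
    obtain ⟨j, Q', h₁, h₂⟩ := h.inp (M.subst η) (N.subst η) ht
    refine ⟨j, Q', h₁, ?_⟩
    have := h₂.reint η
    simpa only [Ext.after, Ext.reint, subst_comp_shiftT] using this

end Sim

end Simulation

/-! ### Permutations, renamings and the transfer property from static equivalence. -/

section Closure

variable {L : FirstOrder.Language.{u, v}} {Ax : Set (L.Term ℕ × L.Term ℕ)} {A B : Ext L}

/-- Substitution of names in a process and its interface. -/
def Ext.sub (σ : ℕ → L.Term ℕ) (A : Ext L) : Ext L :=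
  ⟨A.n, fun y => (A.act y).subst (liftS A.n σ), A.proc.subst (liftS A.n σ)⟩

theorem Ext.sub_eq_map (σ : ℕ → L.Term ℕ) (A : Ext L) :
    A.sub σ = A.map 0 σ fun y => var (.inl y) := rfl

theorem Ext.sub_sub (σ τ : ℕ → L.Term ℕ) (A : Ext L) :
    (A.sub σ).sub τ = A.sub fun y => (σ y).subst τ := by
  simp only [Ext.sub, Term.subst_subst, Proc.subst_subst, liftS_comp]

theorem Ext.sub_var (A : Ext L) : A.sub var = A := by
  simp only [Ext.sub, liftS_var, Term.subst_var, Proc.subst_var]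

theorem Ext.sub_after (σ : ℕ → L.Term ℕ) (A : Ext L) (k : ℕ) (P' : Proc L) :
    (A.after k P').sub σ = (A.sub σ).after k (P'.subst (liftS k (liftS A.n σ))) := by
  simp only [Ext.sub, Ext.after, ← liftS_liftS, shiftT_subst_liftS]

theorem Ext.sub_afterOut (σ : ℕ → L.Term ℕ) (A : Ext L) (k : ℕ) (N : L.Term ℕ) (P' : Proc L) :
    (A.afterOut k N P').sub σ = (A.sub σ).afterOut k (N.subst (liftS k (liftS A.n σ)))
      (P'.subst (liftS k (liftS A.n σ))) := by
  refine Ext.ext' rfl (fun y => ?_) (by simp only [Ext.sub, Ext.afterOut, liftS_liftS])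
  cases y with
  | zero => simp only [Ext.sub, Ext.afterOut, liftS_liftS, consS]
  | succ y => simp only [Ext.sub, Ext.afterOut, ← liftS_liftS, consS, shiftT_subst_liftS]

theorem Chain.sub (h : Chain Ax A B) (σ : ℕ → L.Term ℕ) : Chain Ax (A.sub σ) (B.sub σ) :=
  h.map 0 σ fun y => var (.inl y)

/-- The permutation `p` underneath `k` binders. -/
def liftPerm (k : ℕ) (p : Equiv.Perm ℕ) : Equiv.Perm ℕ where
  toFun i := if i < k then i else p (i - k) + k
  invFun i := if i < k then i else p.symm (i - k) + k
  left_inv i := by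
    by_cases h : i < k
    · simp [h]
    · simp [h]; omega
  right_inv i := by
    by_cases h : i < k
    · simp [h]
    · simp [h]; omega

theorem liftS_perm (k : ℕ) (p : Equiv.Perm ℕ) :
    liftS k (fun i => (var (p i) : L.Term ℕ)) = fun i => var (liftPerm k p i) :=
  liftS_ren k p

/-- A permutation of private names is an injective renaming that preserves the environment, so every
transition transfers, and the residuals differ by the same permutation under the extruded binders.
-/
theorem Sim.perm (A : Ext L) {p : Equiv.Perm ℕ} (hp : ∀ i, A.n ≤ i → p i = i) :
    Sim Ax A (A.perm p) := by
  have hlt : ∀ y, p y ∈ Iio A.n ↔ y ∈ Iio A.n := fun y => by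
    simp only [mem_Iio]
    constructor
    · intro h; by_contra h'; rw [hp y (by omega)] at h; exact h' h
    · intro h; by_contra h'
      have := p.injective (hp (p y) (by omega))
      omega
  have ht : Transferable Ax (Iio A.n) var (Iio A.n) fun y => var (p y) :=
    .ren (r₁ := id) Function.injective_id p.injective (finite_Iio _) (finite_Iio _) (finite_Iio _)
      (fun _ => .rfl) hlt
  have hlink : ∀ k (φ : ℕ → L.Term ℕ) (P' : Proc L), Chain Ax ⟨A.n + k, φ, P'⟩
      ⟨A.n + k, fun y => (φ y).subst (liftS k fun i => var (p i)),
        P'.subst (liftS k fun i => var (p i))⟩ := by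
    intro k φ P'
    rw [liftS_perm]
    refine .single (.perm ⟨A.n + k, φ, P'⟩ (p := liftPerm k p) fun i hi => ?_)
    change A.n + k ≤ i at hi
    simp only [liftPerm, Equiv.coe_fn_mk, show ¬ i < k by omega, if_false]
    rw [hp _ (by omega)]; omega
  have hafter : ∀ k P', Chain Ax (A.after k P')
      ((A.perm p).after k (P'.subst (liftS k fun i => var (p i)))) := fun k P' => by
    have := hlink k (fun y => shiftT k (A.act y)) P'
    simpa only [shiftT_subst_liftS, Ext.after, Ext.perm] using this
  refine ⟨fun {k P'} h => ?_, fun M {N k P'} h => ?_, fun M N {k P'} h => ?_⟩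
  · rw [← A.proc.subst_var] at h
    obtain ⟨R', h₁, h₂⟩ := h.transfer_tau ht
    rw [liftS_var, Proc.subst_var] at h₁
    subst h₁
    exact ⟨_, _, h₂, hafter _ _⟩
  · rw [← A.proc.subst_var] at h
    obtain ⟨M₀, N₀, R', h₀, h₁, h₂, h₃⟩ := h.transfer_out ht
    rw [liftS_var, Proc.subst_var] at h₂
    rw [liftS_var, Term.subst_var] at h₁
    rw [Term.subst_var] at h₀
    subst h₁ h₂
    refine ⟨_, _, _, h₃.label (.out _ ?_), ?_⟩
    · rw [Ext.perm, ← Term.subst_subst]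
      exact h₀.symm.subst _
    · have := hlink k (consS N fun y => shiftT k (A.act y)) P'
      have he : (A.perm p).afterOut k (N.subst (liftS k fun i => var (p i)))
          (P'.subst (liftS k fun i => var (p i))) = ⟨A.n + k, fun y =>
            (consS N (fun y => shiftT k (A.act y)) y).subst (liftS k fun i => var (p i)),
            P'.subst (liftS k fun i => var (p i))⟩ := by
        refine Ext.ext' rfl (fun y => ?_) rfl
        cases y with
        | zero => rfl
        | succ y => simp only [Ext.afterOut, consS, Ext.perm, shiftT_subst_liftS]
      rw [he]
      exact this
  · rw [← A.proc.subst_var] at h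
    obtain ⟨M₀, R', h₀, h₂, h₃⟩ := h.transfer_inp ht
    rw [liftS_var, Proc.subst_var] at h₂
    rw [Term.subst_var] at h₀
    subst h₂
    refine ⟨_, _, h₃.label (.inp ?_), ?_⟩
    · rw [Ext.perm, ← Term.subst_subst]
      exact h₀.symm.subst _
    · have := hafter k (P'.subst (instS (shiftT k (N.subst A.act))))
      rwa [Proc.subst_instS, shiftT_subst_liftS, Term.subst_subst, liftS_liftS] at this

/-- Transitions transfer into and out of the weakened processes because the weakening is injective,
and `y - c` undoes it on the residual chains. It allows instances to be compared after their free
names have been moved out of the way. -/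
theorem Sim.of_sub {c : ℕ} (h : Sim Ax (A.sub fun y => var (y + c)) (B.sub fun y => var (y + c))) :
    Sim Ax A B := by
  have hinj : ∀ n, Function.Injective fun i => if i < n then i else i - n + c + n := by
    intro n a b hab
    simp only at hab
    split_ifs at hab <;> omega
  have hmem : ∀ n y, (if y < n then y else y - n + c + n) ∈ Iio n ↔ y ∈ Iio n := by
    intro n y
    simp only [mem_Iio]
    split_ifs <;> omega
  have ht₁ : Transferable Ax (Iio A.n) var (Iio A.n) (liftS A.n fun y => var (y + c)) := by
    rw [liftS_ren]
    exact .ren (r₁ := id) Function.injective_id (hinj _) (finite_Iio _) (finite_Iio _)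
      (finite_Iio _) (fun _ => .rfl) (hmem _)
  have ht₂ : Transferable Ax (Iio B.n) (liftS B.n fun y => var (y + c)) (Iio B.n) var := by
    rw [liftS_ren]
    exact .ren (r₂ := id) (hinj _) Function.injective_id (finite_Iio _) (finite_Iio _)
      (finite_Iio _) (hmem _) (fun _ => .rfl)
  have hback : ∀ A : Ext L, (A.sub fun y => var (y + c)).sub (fun y => var (y - c)) = A := by
    intro A
    simp only [Ext.sub_sub, FirstOrder.Language.Term.subst, Nat.add_sub_cancel]
    exact A.sub_var
  have hafter : ∀ {k j P' Q'}, Chain Ax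
      ((A.sub fun y => var (y + c)).after k (P'.subst (liftS k (liftS A.n fun y => var (y + c)))))
      ((B.sub fun y => var (y + c)).after j (Q'.subst (liftS j (liftS B.n fun y => var (y + c))))) →
      Chain Ax (A.after k P') (B.after j Q') := by
    intro k j P' Q' h
    rw [← Ext.sub_after, ← Ext.sub_after] at h
    simpa only [hback] using h.sub fun y => var (y - c)
  refine ⟨fun {k P'} hP => ?_, fun M {N k P'} hP => ?_, fun M N {k P'} hP => ?_⟩
  · rw [← A.proc.subst_var] at hP
    obtain ⟨R', h₁, h₂⟩ := hP.transfer_tau ht₁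
    rw [liftS_var, Proc.subst_var] at h₁
    subst h₁
    obtain ⟨j, Q', h₃, h₄⟩ := h.tau h₂
    obtain ⟨S', rfl, h₅⟩ := Tr.transfer_tau (R := B.proc) h₃ ht₂
    rw [liftS_var, Proc.subst_var, Proc.subst_var] at h₅
    exact ⟨j, S', h₅, hafter h₄⟩
  · rw [← A.proc.subst_var] at hP
    obtain ⟨M₀, N₀, R', h₀, h₁, h₂, h₃⟩ := hP.transfer_out ht₁
    rw [liftS_var, Proc.subst_var] at h₂
    rw [liftS_var, Term.subst_var] at h₁
    rw [Term.subst_var] at h₀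
    subst h₁ h₂
    obtain ⟨N', j, Q', h₄, h₅⟩ := h.out M (h₃.label (.out _ (by
      simp only [Ext.sub, ← Term.subst_subst]; exact h₀.symm.subst _)))
    obtain ⟨M₁, N₁, S', h₆, rfl, rfl, h₇⟩ := Tr.transfer_out (R := B.proc) h₄ ht₂
    rw [liftS_var, Proc.subst_var, Proc.subst_var, Term.subst_var, Term.subst_var] at h₇
    simp only [Ext.sub, ← Term.subst_subst] at h₆
    have h₆ := ht₂.eq_zero h₆
    rw [Term.subst_var, Term.subst_var] at h₆
    refine ⟨_, j, S', h₇.label (.out _ h₆.symm), ?_⟩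
    rw [← Ext.sub_afterOut, ← Ext.sub_afterOut] at h₅
    simpa only [hback] using h₅.sub fun y => var (y - c)
  · rw [← A.proc.subst_var] at hP
    obtain ⟨M₀, R', h₀, h₂, h₃⟩ := hP.transfer_inp ht₁
    rw [liftS_var, Proc.subst_var] at h₂
    rw [Term.subst_var] at h₀
    subst h₂
    obtain ⟨j, Q', h₄, h₅⟩ := h.inp M N (h₃.label (.inp (by
      simp only [Ext.sub, ← Term.subst_subst]; exact h₀.symm.subst _)))
    obtain ⟨M₁, S', h₆, rfl, h₇⟩ := Tr.transfer_inp (R := B.proc) h₄ ht₂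
    rw [liftS_var, Proc.subst_var, Proc.subst_var, Term.subst_var] at h₇
    simp only [Ext.sub, ← Term.subst_subst] at h₆
    have h₆ := ht₂.eq_zero h₆
    rw [Term.subst_var, Term.subst_var] at h₆
    refine ⟨j, S', h₇.label (.inp h₆.symm), hafter ?_⟩
    have key : ∀ (A : Ext L) (k : ℕ) (P' : Proc L),
        (P'.subst (liftS (k + 1) (liftS A.n fun y => var (y + c)))).subst
          (instS (shiftT k (N.subst (A.sub fun y => var (y + c)).act))) =
        (P'.subst (instS (shiftT k (N.subst A.act)))).subst
          (liftS k (liftS A.n fun y => var (y + c))) := by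
      intro A k P'
      rw [Proc.subst_instS, shiftT_subst_liftS, Term.subst_subst, liftS_liftS 1 k]
      rfl
    rw [← key, ← key]
    exact h₅

theorem StaticEquiv.perm {p q : Equiv.Perm ℕ} (h : StaticEquiv Ax A B) :
    StaticEquiv Ax (A.perm p) (B.perm q) := by
  intro M N
  simp only [Ext.perm, ← Term.subst_subst]
  rw [eqTheory_ren_iff p.injective, eqTheory_ren_iff q.injective]
  exact h M N

/-- Equations transfer by static equivalence with `k` names exposed. For inequalities, a unifier on
the side of `B` that is fresh for the private names is a substitution `δ` of the free names; static
equivalence of the instances by `δ` turns it into a unifier on the side of `A`. -/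
theorem transferable_of_static (h : ∀ k δ ξ, StaticEquiv Ax (A.map k δ ξ) (B.map k δ ξ)) :
    Transferable Ax (Iio A.n) A.act (Iio B.n) B.act := by
  have hsub : ∀ δ k, StaticEquiv Ax ((A.sub δ).expose k) ((B.sub δ).expose k) := fun δ k => by
    rw [Ext.sub_eq_map, Ext.sub_eq_map, Ext.expose_map, Ext.expose_map]
    exact (h _ _ _).perm
  refine ⟨finite_Iio _, finite_Iio _, fun k M N => ?_, fun k M N hne => ?_⟩
  · have := (hsub var k M N).1
    rwa [Ext.sub_var, Ext.sub_var] at this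
  · rw [envN_Iio] at hne ⊢
    rintro ⟨σ, hfin, ⟨hd, hf⟩, he⟩
    -- Freshness of `σ` means that it fixes the `B.n + k` private names and that they do not occur
    -- in the images of other names. The truncated subtraction is therefore exact and `σ` is the
    -- lifting of `δ`.
    let δ : ℕ → L.Term ℕ := fun y =>
      (σ (y + (B.n + k))).subst fun i => var (i - (B.n + k))
    have hσ : σ = liftS (B.n + k) δ := by
      funext i
      obtain hi | ⟨y, rfl⟩ := lt_or_eq_add (B.n + k) i
      · rw [liftS_of_lt _ hi]
        exact not_not.1 fun h' => disjoint_left.1 hd h' hi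
      · rw [liftS_add_right, shiftT_eq, Term.subst_subst]
        conv_lhs => rw [← Term.subst_var (σ (y + (B.n + k)))]
        refine Term.subst_congr fun z hz => ?_
        have : ¬ z < B.n + k :=
          disjoint_left.1 (hf (y + (B.n + k)) (by simp)) hz
        simp only [FirstOrder.Language.Term.subst]
        congr 1; omega
    have hδ : (domS δ).Finite := by
      refine (hfin.preimage (add_left_injective (B.n + k)).injOn).subset fun y hy hy' => hy ?_
      change (σ (y + (B.n + k))).subst _ = _
      rw [hy']
      simp
    have key : ∀ (A : Ext L) (M : L.Term ℕ), (M.subst (liftS k A.act)).subst (liftS (A.n + k) δ) =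
        M.subst ((A.sub δ).expose k).act := by
      intro A M
      rw [← liftS_liftS, Term.subst_subst, liftS_comp]
      rfl
    refine hne ⟨liftS (A.n + k) δ, ?_, ⟨?_, ?_⟩, ?_⟩
    · refine (hδ.image (· + (A.n + k))).subset fun i hi => ?_
      obtain h' | ⟨y, rfl⟩ := lt_or_eq_add (A.n + k) i
      · exact absurd (liftS_of_lt _ h') hi
      · refine ⟨y, fun hy => hi ?_, rfl⟩
        rw [liftS_add_right, hy]
        rfl
    · exact disjoint_left.2 fun i hi h' => hi (liftS_of_lt _ h')
    · intro i hi
      obtain h' | ⟨y, rfl⟩ := lt_or_eq_add (A.n + k) i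
      · exact absurd h' hi
      · rw [liftS_add_right, disjoint_left]
        intro z hz
        obtain ⟨w, -, rfl⟩ := (mem_fvT_shiftT ..).1 hz
        simp
    · rw [key, key]
      refine (hsub δ k M N).2 ?_
      rwa [hσ, key, key] at he

end Closure

/-! ### Preservation of simulation by the operators. -/

section Operators

variable {L : FirstOrder.Language.{u, v}} {Ax : Set (L.Term ℕ × L.Term ℕ)} {A B : Ext L}

namespace Chain

theorem after_left {k j : ℕ} {P' Q' : Proc L} (h : Chain Ax (A.after k P') (B.after j Q'))
    (b : Bool) (R : Proc L) :
    Chain Ax ((A.parB b R).after k (P'.parB b ((R.subst A.act).shift k)))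
      ((B.parB b R).after j (Q'.parB b ((R.subst B.act).shift j))) := by
  simpa only [Ext.parB, Ext.after, Proc.subst_comp_shiftT] using h.par b R

theorem afterOut_left {k j : ℕ} {N N' : L.Term ℕ} {P' Q' : Proc L}
    (h : Chain Ax (A.afterOut k N P') (B.afterOut j N' Q')) (b : Bool) (R : Proc L) :
    Chain Ax ((A.parB b R).afterOut k N (P'.parB b ((R.subst A.act).shift k)))
      ((B.parB b R).afterOut j N' (Q'.parB b ((R.subst B.act).shift j))) := by
  simpa only [Ext.parB, Ext.afterOut, Proc.subst_subst, FirstOrder.Language.Term.subst, consS,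
    ← Proc.subst_comp_shiftT] using h.par b (R.subst fun y => var (y + 1))

/-- Names extruded by the recipe become exposed private names, over which its residual `S` is a
recipe. -/
theorem after_right (h : Chain Ax A B) (b : Bool) (R S : Proc L) (k : ℕ) :
    Chain Ax
      ((A.parB b R).after k ((A.proc.shift k).parB b (S.subst (liftS k A.act))))
      ((B.parB b R).after k ((B.proc.shift k).parB b (S.subst (liftS k B.act)))) := by
  simpa only [Ext.parB, Ext.after, Ext.expose, Ext.reint, FirstOrder.Language.Term.subst,
    liftS_add_right] using ((h.expose k).par b S).reint fun y => var (y + k)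

theorem afterOut_right (h : Chain Ax A B) (b : Bool) (R S : Proc L) (N : L.Term ℕ) (k : ℕ) :
    Chain Ax
      ((A.parB b R).afterOut k (N.subst (liftS k A.act))
        ((A.proc.shift k).parB b (S.subst (liftS k A.act))))
      ((B.parB b R).afterOut k (N.subst (liftS k B.act))
        ((B.proc.shift k).parB b (S.subst (liftS k B.act)))) := by
  have key : ∀ A : Ext L, ((A.expose k).parB b S).reint (consS N fun y => var (y + k)) =
      (A.parB b R).afterOut k (N.subst (liftS k A.act))
        ((A.proc.shift k).parB b (S.subst (liftS k A.act))) := fun A => by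
    refine Ext.ext' rfl (fun y => ?_) rfl
    cases y with
    | zero => rfl
    | succ y =>
      simp only [Ext.parB, Ext.afterOut, Ext.expose, Ext.reint, FirstOrder.Language.Term.subst,
        consS, liftS_add_right]
  rw [← key, ← key]
  exact ((h.expose k).par b S).reint _

/-- The message is an interface entry after the output, so the receiving recipe continues as a
recipe over the extended interface. Forgetting that entry and the exposed names then yields the
silent residual; `R` contributes nothing to it. -/
theorem after_send {i i' : ℕ} {N N' : L.Term ℕ} {P' Q' : Proc L}
    (h : Chain Ax (A.afterOut i N P') (B.afterOut i' N' Q')) (b : Bool) (R S : Proc L) (j : ℕ) :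
    Chain Ax
      ((A.parB b R).after (j + i)
        ((P'.shift j).parB b ((S.subst (liftS (j + 1) A.act)).recv i j N)))
      ((B.parB b R).after (j + i')
        ((Q'.shift j).parB b ((S.subst (liftS (j + 1) B.act)).recv i' j N'))) := by
  have key : ∀ (A : Ext L) (i : ℕ) (N : L.Term ℕ) (P' : Proc L),
      (((A.afterOut i N P').expose j).parB b (S.recv 1 j (var 0))).reint
        (fun y => var (y + 1 + j)) = (A.parB b R).after (j + i)
        ((P'.shift j).parB b ((S.subst (liftS (j + 1) A.act)).recv i j N)) := by
    intro A i N P'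
    refine Ext.ext' ?_ (fun y => ?_) ?_
    · simp only [Ext.parB, Ext.after, Ext.afterOut, Ext.expose, Ext.reint]; omega
    · simp only [Ext.parB, Ext.after, Ext.afterOut, Ext.expose, Ext.reint,
        FirstOrder.Language.Term.subst, liftS_add_right, consS, shiftT_shiftT]
      rw [Nat.add_comm]
    · simp only [Ext.parB, Ext.after, Ext.afterOut, Ext.expose, Ext.reint, Proc.recv_subst]
  rw [← key, ← key]
  exact ((h.expose j).par b _).reint _

/-- The recipe has sent under `i` extruded names; with these exposed, its residual `S` is composed
in parallel, and the names are forgotten afterwards. -/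
theorem after_receive {i j j' : ℕ} {X Y : Proc L}
    (h : Chain Ax ((A.expose i).after j X) ((B.expose i).after j' Y)) (b : Bool) (R S : Proc L) :
    Chain Ax
      ((A.parB b R).after (j + i) (X.parB b ((S.subst (liftS i A.act)).shift j)))
      ((B.parB b R).after (j' + i) (Y.parB b ((S.subst (liftS i B.act)).shift j'))) := by
  have key : ∀ (A : Ext L) (j : ℕ) (X : Proc L),
      (((A.expose i).after j X).parB b S).reint (fun y => var (y + i)) =
        (A.parB b R).after (j + i) (X.parB b ((S.subst (liftS i A.act)).shift j)) := by
    intro A j X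
    refine Ext.ext' ?_ (fun y => ?_) ?_
    · simp only [Ext.parB, Ext.after, Ext.expose, Ext.reint]; omega
    · simp only [Ext.parB, Ext.after, Ext.expose, Ext.reint,
        FirstOrder.Language.Term.subst, liftS_add_right, shiftT_shiftT]
      rw [Nat.add_comm]
    · simp only [Ext.parB, Ext.after, Ext.expose, Ext.reint, Proc.subst_comp_shiftT]
  rw [← key, ← key]
  exact (h.par b S).reint _

end Chain

namespace Sim

/-- Moves of the operand are matched by `hs`, moves of the recipe by `ht`. When the recipe sends,
its message may contain names it extrudes, so the operand must be simulated with those exposed,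
which is the purpose of `he`. -/
theorem par (hs : Sim Ax A B) (he : ∀ k, Sim Ax (A.expose k) (B.expose k))
    (ht : Transferable Ax (Iio A.n) A.act (Iio B.n) B.act) (hc : Chain Ax A B) (b : Bool)
    (R : Proc L) : Sim Ax (A.parB b R) (B.parB b R) := by
  have hA := finite_Iio A.n
  have hB := finite_Iio B.n
  refine ⟨fun {k X} h => ?_, fun M {N k X} h => ?_, fun M N {k X} h => ?_⟩
  · obtain ⟨P', hP, rfl⟩ | ⟨R', hR, rfl⟩ | ⟨-, M, N, i, j, P', S, rfl, hP, hR, rfl⟩ |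
      ⟨-, M, N, i, j, P', S, rfl, hR, hP, rfl⟩ := h.parB_cases hA
    · obtain ⟨j, Q', h₁, h₂⟩ := hs.tau hP
      exact ⟨j, _, h₁.parB_left, h₂.after_left b R⟩
    · obtain ⟨S, rfl, h₁⟩ := hR.transfer_tau ht
      exact ⟨k, _, h₁.parB_right, hc.after_right b R S k⟩
    · obtain ⟨M₀, S, h₀, rfl, h₁⟩ := hR.transfer_inp ht
      obtain ⟨N', i', Q', h₂, h₃⟩ := hs.out M₀ (hP.label (.out _ h₀))
      exact ⟨j + i', _, h₂.parB_close_left hB h₁, h₃.after_send b R S j⟩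
    · obtain ⟨M₀, N, S, h₀, rfl, rfl, h₁⟩ := hR.transfer_out ht
      have h₂ := (hP.label (.inp h₀)).shift_inp (k := i) hA (finite_Iio (A.n + i)) fun y => by simp
      -- With the `i` names exposed, the transmitted message is given by the recipe `N`; the channel
      -- does not involve them.
      obtain ⟨j', Y, h₃, h₄⟩ := (he i).inp (shiftT i M₀) N (by
        simpa only [Ext.expose, shiftT_subst_liftS] using h₂)
      obtain ⟨M₁, Q', h₅, rfl, h₆⟩ := Tr.of_shift_inp (k := i) (P := B.proc) h₃ hB (finite_Iio _)
        fun y => by simp [Ext.expose]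
      simp only [Ext.expose, shiftT_subst_liftS, eqTheory_shiftT_iff] at h₅
      exact ⟨j' + i, _, h₁.parB_close_right hB (h₆.label (.inp h₅.symm)),
        h₄.after_receive b R S⟩
  · obtain ⟨P', hP, rfl⟩ | ⟨R', hR, rfl⟩ | ⟨h', -⟩ | ⟨h', -⟩ := h.parB_cases hA
    · obtain ⟨N', j, Q', h₁, h₂⟩ := hs.out M hP
      exact ⟨N', j, _, h₁.parB_left, h₂.afterOut_left b R⟩
    · obtain ⟨M₀, N, S, h₀, rfl, rfl, h₁⟩ := hR.transfer_out ht
      exact ⟨_, k, _, (h₁.label (.out _ (ht.eq_zero h₀).symm)).parB_right,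
        hc.afterOut_right b R S N k⟩
    · cases h'
    · cases h'
  · obtain ⟨P', hP, rfl⟩ | ⟨R', hR, rfl⟩ | ⟨h', -⟩ | ⟨h', -⟩ := h.parB_cases hA
    · obtain ⟨j, Q', h₁, h₂⟩ := hs.inp M N hP
      refine ⟨j, _, h₁.parB_left, ?_⟩
      simp only [Proc.parB_subst, Lab.params, shift_succ_subst_instS]
      exact h₂.after_left b R
    · obtain ⟨M₀, S, h₀, rfl, h₁⟩ := hR.transfer_inp ht
      refine ⟨k, _, (h₁.label (.inp (ht.eq_zero h₀).symm)).parB_right, ?_⟩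
      have key : ∀ A : Ext L, (S.subst (liftS (k + 1) A.act)).subst
          (instS (shiftT k (N.subst A.act))) =
          (S.subst (instS (shiftT k N))).subst (liftS k A.act) := fun A => by
        rw [Proc.subst_instS, shiftT_subst_liftS, liftS_liftS]
      simp only [Proc.parB_subst, Lab.params, shift_succ_subst_instS, key, Ext.parB]
      exact hc.after_right b R _ k
    · cases h'
    · cases h'

end Sim

/-- Weakening of the subject of a label by `a` binders, which are then extruded. -/
def Lab.shiftN (a : ℕ) : Lab L → Lab L
  | tau => tau
  | out M N => out (shiftT a M) N
  | inp M => inp (shiftT a M)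

theorem Lab.shiftN_zero (l : Lab L) : l.shiftN 0 = l := by
  cases l <;> simp only [shiftN, shiftT_zero]

theorem Lab.shiftN_shift (l : Lab L) (a : ℕ) : l.shift.shiftN a = l.shiftN (a + 1) := by
  cases l <;> simp only [shiftN, shift, shiftT_shiftT, Nat.add_comm]

theorem Tr.newN_iff {E : Set ℕ} {P X : Proc L} {l : Lab L} {a K : ℕ} :
    Tr Ax E (P.newN a) l K X ↔ ∃ k, K = k + a ∧ Tr Ax (envN a E) P (l.shiftN a) k X := by
  induction a generalizing E l K with
  | zero => simp [Proc.newN_zero, envN_zero, Lab.shiftN_zero]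
  | succ a ih =>
    rw [Proc.newN_succ]
    have : Tr Ax E (Proc.new (P.newN a)) l K X ↔
        ∃ k, K = k + 1 ∧ Tr Ax (extendEnv E) (P.newN a) l.shift k X := by
      constructor
      · intro h; cases h with | res h => exact ⟨_, rfl, h⟩
      · rintro ⟨k, rfl, h⟩; exact .res h
    simp only [this, ih, extendEnv_eq, envN_envN, Lab.shiftN_shift, Nat.add_comm 1 a]
    constructor
    · rintro ⟨_, rfl, k, rfl, h⟩; exact ⟨k, by omega, h⟩
    · rintro ⟨k, rfl, h⟩; exact ⟨k + a, by omega, k, rfl, h⟩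

namespace Sim

/-- Since the interface avoids the restricted names, whether they belong to the process or to the
extended process is visible only in the number of binders extruded; the residuals coincide. -/
theorem newN {n m a b : ℕ} {φ ψ : ℕ → L.Term ℕ} {P Q : Proc L}
    (h : Sim Ax ⟨n + a, fun y => shiftT a (φ y), P⟩ ⟨m + b, fun y => shiftT b (ψ y), Q⟩) :
    Sim Ax ⟨n, φ, P.newN a⟩ ⟨m, ψ, Q.newN b⟩ := by
  have hafter : ∀ (n a k : ℕ) (φ : ℕ → L.Term ℕ) (P P' : Proc L),
      (Ext.mk n φ (P.newN a)).after (k + a) P' =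
        (Ext.mk (n + a) (fun y => shiftT a (φ y)) P).after k P' := by
    intro n a k φ P P'
    simp only [Ext.after, shiftT_shiftT, Nat.add_assoc, Nat.add_comm k a]
  refine ⟨fun {k X} hP => ?_, fun M {N k X} hP => ?_, fun M N {k X} hP => ?_⟩
  · obtain ⟨k, rfl, hX⟩ := Tr.newN_iff.1 hP
    rw [envN_Iio] at hX
    obtain ⟨j, Q', h₁, h₂⟩ := h.tau hX
    refine ⟨j + b, Q', Tr.newN_iff.2 ⟨j, rfl, by rw [envN_Iio]; exact h₁⟩, ?_⟩
    rw [hafter, hafter]; exact h₂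
  · obtain ⟨k, rfl, hX⟩ := Tr.newN_iff.1 hP
    rw [envN_Iio] at hX
    obtain ⟨N', j, Q', h₁, h₂⟩ := h.out M (by rw [subst_comp_shiftT]; exact hX)
    rw [subst_comp_shiftT] at h₁
    refine ⟨N', j + b, Q', Tr.newN_iff.2 ⟨j, rfl, by rw [envN_Iio]; exact h₁⟩, ?_⟩
    simpa only [Ext.afterOut, shiftT_shiftT, Nat.add_assoc, Nat.add_comm k a, Nat.add_comm j b]
      using h₂
  · obtain ⟨k, rfl, hX⟩ := Tr.newN_iff.1 hP
    rw [envN_Iio] at hX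
    obtain ⟨j, Q', h₁, h₂⟩ := h.inp M N (by rw [subst_comp_shiftT]; exact hX)
    rw [subst_comp_shiftT] at h₁
    refine ⟨j + b, Q', Tr.newN_iff.2 ⟨j, rfl, by rw [envN_Iio]; exact h₁⟩, ?_⟩
    rw [subst_comp_shiftT, subst_comp_shiftT, shiftT_shiftT, shiftT_shiftT, Nat.add_comm a,
      Nat.add_comm b] at h₂
    rw [hafter, hafter]
    exact h₂

/-- Operators whose transitions are those of an operand. -/
theorem of_operand {n : ℕ} {P Q P₁ Q₁ : Proc L} (h : Sim Ax ⟨n, var, P⟩ ⟨n, var, Q⟩)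
    (h₁ : ∀ l k X, Tr Ax (Iio n) P₁ l k X → Tr Ax (Iio n) P l k X ∨ Tr Ax (Iio n) Q₁ l k X)
    (h₂ : ∀ l k X, Tr Ax (Iio n) Q l k X → Tr Ax (Iio n) Q₁ l k X) :
    Sim Ax ⟨n, var, P₁⟩ ⟨n, var, Q₁⟩ := by
  refine ⟨fun {k X} hP => ?_, fun M {N k X} hP => ?_, fun M N {k X} hP => ?_⟩
  · obtain hP | hP := h₁ _ _ _ hP
    · obtain ⟨j, Q', h₃, h₄⟩ := h.tau hP
      exact ⟨j, Q', h₂ _ _ _ h₃, h₄⟩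
    · exact ⟨k, X, hP, .refl⟩
  · obtain hP | hP := h₁ _ _ _ hP
    · obtain ⟨N', j, Q', h₃, h₄⟩ := h.out M hP
      exact ⟨N', j, Q', h₂ _ _ _ h₃, h₄⟩
    · exact ⟨N, k, X, hP, .refl⟩
  · obtain hP | hP := h₁ _ _ _ hP
    · obtain ⟨j, Q', h₃, h₄⟩ := h.inp M N hP
      exact ⟨j, Q', h₂ _ _ _ h₃, h₄⟩
    · exact ⟨k, X, hP, .refl⟩

theorem mat {n : ℕ} {P Q : Proc L} (h : Sim Ax ⟨n, var, P⟩ ⟨n, var, Q⟩) (M N : L.Term ℕ) :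
    Sim Ax ⟨n, var, .mat M N P⟩ ⟨n, var, .mat M N Q⟩ := by
  by_cases hM : EqTheory Ax M N
  · exact h.of_operand (fun _ _ _ h => by cases h with | mat _ h => exact .inl h)
      fun _ _ _ h => .mat hM h
  · have : ∀ l k X, ¬ Tr Ax (Iio n) (.mat M N P) l k X := fun _ _ _ h => by
      cases h with | mat h _ => exact hM h
    exact ⟨fun h => (this _ _ _ h).elim, fun _ _ _ _ h => (this _ _ _ h).elim,
      fun _ _ _ _ h => (this _ _ _ h).elim⟩

theorem mis {n : ℕ} {P Q : Proc L} (h : Sim Ax ⟨n, var, P⟩ ⟨n, var, Q⟩) (M N : L.Term ℕ) :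
    Sim Ax ⟨n, var, .mis M N P⟩ ⟨n, var, .mis M N Q⟩ := by
  by_cases hM : EntailsNe Ax (Iio n) M N
  · exact h.of_operand (fun _ _ _ h => by cases h with | mis _ h => exact .inl h)
      fun _ _ _ h => .mis hM h
  · have : ∀ l k X, ¬ Tr Ax (Iio n) (.mis M N P) l k X := fun _ _ _ h => by
      cases h with | mis h _ => exact hM h
    exact ⟨fun h => (this _ _ _ h).elim, fun _ _ _ _ h => (this _ _ _ h).elim,
      fun _ _ _ _ h => (this _ _ _ h).elim⟩

theorem plusL {n : ℕ} {P Q : Proc L} (h : Sim Ax ⟨n, var, P⟩ ⟨n, var, Q⟩) (R : Proc L) :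
    Sim Ax ⟨n, var, .plus P R⟩ ⟨n, var, .plus Q R⟩ :=
  h.of_operand (fun _ _ _ h => by
    cases h with
    | sumL h => exact .inl h
    | sumR h => exact .inr (.sumR h)) fun _ _ _ h => .sumL h

theorem plusR {n : ℕ} {P Q : Proc L} (h : Sim Ax ⟨n, var, P⟩ ⟨n, var, Q⟩) (R : Proc L) :
    Sim Ax ⟨n, var, .plus R P⟩ ⟨n, var, .plus R Q⟩ :=
  h.of_operand (fun _ _ _ h => by
    cases h with
    | sumL h => exact .inr (.sumL h)
    | sumR h => exact .inl h) fun _ _ _ h => .sumR h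

theorem output {P Q : Proc L} (h : Link Ax (.ofProc P) (.ofProc Q)) (n : ℕ) (δ : ℕ → L.Term ℕ)
    (M N : L.Term ℕ) :
    Sim Ax ⟨n, var, .out M N (P.subst δ)⟩ ⟨n, var, .out M N (Q.subst δ)⟩ := by
  refine ⟨fun {_ _} hP => (by cases hP), fun M' {N' k X} hP => ?_, fun M' N' {k X} hP => (by cases hP)⟩
  cases hP with
  | out hM => exact ⟨N, 0, Q.subst δ, .out hM, .single (h.ofProc_map n δ _)⟩

/-- The residuals are linked at once: receiving a message is one more substitution of names, and
links are closed under these. -/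
theorem input {P Q : Proc L} (h : Link Ax (.ofProc P) (.ofProc Q)) (n : ℕ) (δ : ℕ → L.Term ℕ)
    (M : L.Term ℕ) :
    Sim Ax ⟨n, var, .inp M (P.subst (liftS 1 δ))⟩ ⟨n, var, .inp M (Q.subst (liftS 1 δ))⟩ := by
  refine ⟨fun {_ _} hP => (by cases hP), fun M' {N' k X} hP => (by cases hP), fun M' N' {k X} hP => ?_⟩
  cases hP with
  | inp hM =>
    refine ⟨0, _, .inp hM, .single ?_⟩
    simp only [Proc.subst_subst]
    exact h.ofProc_map n _ _

/-- The participating copies are exchanged by simulation, one after the other, and the remaining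
replication by a link of its own. The chain composes these exchanges. -/
theorem rep {P Q : Proc L} (h : Link Ax (.ofProc P) (.ofProc Q))
    (hs : ∀ n δ, Sim Ax ⟨n, var, P.subst δ⟩ ⟨n, var, Q.subst δ⟩) (n : ℕ) (δ : ℕ → L.Term ℕ) :
    Sim Ax ⟨n, var, (P.subst δ).rep⟩ ⟨n, var, (Q.subst δ).rep⟩ := by
  have hn := finite_Iio n
  have hshift : ∀ (P : Proc L) (i : ℕ), (P.subst δ).shift i =
      P.subst fun y => (δ y).subst fun z => var (z + i) := fun P i => by
    rw [Proc.shift_eq, Proc.subst_subst]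
  have hright : ∀ (m : ℕ) (χ : ℕ → L.Term ℕ) (Y : Proc L) (i : ℕ),
      Chain Ax ⟨m, χ, Y.par ((P.subst δ).rep.shift i)⟩ ⟨m, χ, Y.par ((Q.subst δ).rep.shift i)⟩ := by
    intro m χ Y i
    have := Chain.reint (.single ((h.rep.ofProc_map m
      (fun y => (δ y).subst fun z => var (z + i)) var).par false Y)) χ
    simp only [Ext.parB, Ext.reint, Proc.subst_var, Term.subst_var, ← hshift] at this
    exact this
  refine ⟨fun {k X} hP => ?_, fun M {N k X} hP => ?_, fun M N {k X} hP => ?_⟩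
  · obtain ⟨P', hP', rfl⟩ | ⟨-, M, N, i, j, P', Q₁, rfl, h₁, h₂, rfl⟩ := hP.rep_cases hn
    · obtain ⟨j, Q', h₁, h₂⟩ := (hs n δ).tau hP'
      exact ⟨j, _, .repAct h₁, (h₂.par true (P.subst δ).rep).trans (hright _ _ _ _)⟩
    · obtain ⟨N', i', P'', h₃, h₄⟩ := (hs n δ).out M (by rw [Term.subst_var]; exact h₁)
      rw [Term.subst_var] at h₃
      -- The receiver is simulated after the sender, with the `i'` names extruded by the matching
      -- sender already private, because the matching message `N'` may contain them.
      have h₅ := h₂.shift_inp (k := i') hn (finite_Iio (n + i')) fun y => by simp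
      rw [hshift] at h₅
      obtain ⟨j', Y, h₆, h₇⟩ := (hs (n + i') _).inp (shiftT i' M) N'
        (by rw [Term.subst_var]; exact h₅)
      simp only [← hshift, Term.subst_var] at h₆ h₇
      obtain ⟨M₁, Q₂, h₈, rfl, h₉⟩ := Tr.of_shift_inp (k := i') h₆ hn (finite_Iio _)
        fun y => by simp
      rw [eqTheory_shiftT_iff] at h₈
      -- `c₁` exchanges the sender and keeps the receiver's residual; `c₂` then exchanges the
      -- receiver beside the new sender's residual. The process `.nil` does not appear in the
      -- residual.
      have c₁ := h₄.after_send true .nil Q₁ j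
      simp only [liftS_var, Proc.subst_var] at c₁
      have c₂ := (Chain.par h₇ false P'').reint fun y => var (y + i')
      have c₃ : Chain Ax
          ⟨n + (j + i), fun y => var (y + (j + i)), (P'.shift j).par (Q₁.recv i j N)⟩
          ⟨n + (j' + i'), fun y => var (y + (j' + i')), (P''.shift j').par (Q₂.recv i' j' N')⟩ := by
        refine Relation.ReflTransGen.trans c₁ ?_
        have key : ∀ (Z : Proc L) (j : ℕ) (X : Proc L),
            (((Ext.mk (n + i') var Z).after j X).parB false P'').reint
              (fun y => var (y + i')) = ⟨n + (j + i'), fun y => var (y + (j + i')),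
                (P''.shift j).par X⟩ := by
          intro Z j X
          refine Ext.ext' ?_ (fun y => ?_) rfl
          · simp only [Ext.parB, Ext.after, Ext.reint]; omega
          · simp only [Ext.parB, Ext.after, Ext.reint, FirstOrder.Language.Term.subst, shiftT_eq]
            congr 1; omega
        rw [key, key] at c₂
        exact c₂
      exact ⟨j' + i', _, Tr.rep_close hn h₃ (h₉.label (.inp h₈.symm)),
        (c₃.par true (P.subst δ).rep).trans (hright _ _ _ _)⟩
  · obtain ⟨P', hP', rfl⟩ | ⟨h, -⟩ := hP.rep_cases hn
    · obtain ⟨N', j, Q', h₁, h₂⟩ := (hs n δ).out M hP'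
      have := h₂.afterOut_left true (P.subst δ).rep
      simp only [Proc.subst_var] at this
      exact ⟨N', j, _, .repAct h₁, this.trans (hright _ _ _ _)⟩
    · cases h
  · obtain ⟨P', hP', rfl⟩ | ⟨h, -⟩ := hP.rep_cases hn
    · obtain ⟨j, Q', h₁, h₂⟩ := (hs n δ).inp M N hP'
      refine ⟨j, _, .repAct h₁, ?_⟩
      simp only [Proc.subst, Lab.params, shift_succ_subst_instS]
      exact (h₂.par true (P.subst δ).rep).trans (hright _ _ _ _)
    · cases h

/-- The interface `var` reveals all names, private ones included, so every other interface common to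
both sides is a change of interface from it. -/
theorem ofProc_map {k : ℕ} {δ : ℕ → L.Term ℕ} {P Q : Proc L}
    (h : Sim Ax ⟨k, var, P.subst δ⟩ ⟨k, var, Q.subst δ⟩) (ξ : ℕ → L.Term (ℕ ⊕ ℕ)) :
    Sim Ax ((Ext.ofProc P).map k δ ξ) ((Ext.ofProc Q).map k δ ξ) := by
  have key : ∀ P : Proc L, (Ext.ofProc P).map k δ ξ =
      (Ext.mk k var (P.subst δ)).reint ((Ext.ofProc Proc.nil).map k δ ξ).act := fun P => by
    refine Ext.ext' (Nat.zero_add k) (fun y => ?_) ?_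
    · simp only [Ext.reint, Term.subst_var]; rfl
    · simp only [Ext.map, Ext.ofProc, Ext.reint, liftS_zero]
  rw [key P, key Q]
  exact h.reint _

end Sim

end Operators

/-! ### Transitions of bisimilar extended processes. -/

section ExtendedSteps

variable {L : FirstOrder.Language.{u, v}} {Ax : Set (L.Term ℕ × L.Term ℕ)}

/-- Weakening of an action by `n` binders. -/
def Act.shiftN (n : ℕ) : Act L → Act L
  | tau => tau
  | out M z => out (shiftT n M) (z + n)
  | inp M N => inp (shiftT n M) (shiftT n N)

theorem Act.shiftN_zero (π : Act L) : π.shiftN 0 = π := by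
  cases π <;> simp only [shiftN, shiftT_zero, Nat.add_zero]

theorem Act.shiftN_shift (π : Act L) (n : ℕ) : π.shift.shiftN n = π.shiftN (n + 1) := by
  cases π <;> simp only [shiftN, shift, shiftT_shiftT, Nat.add_comm 1 n, Nat.add_assoc]

/-- The active substitution, extended to the restricted variables by the identity. -/
def Ext.core (A : Ext L) : ℕ → L.Term ℕ := fun i => if i < A.n then var i else A.act (i - A.n)

theorem Ext.core_add (A : Ext L) (y : ℕ) : A.core (y + A.n) = A.act y := by
  simp [core]

theorem Ext.core_newN_one {A : Ext L} (h : 0 ∉ A.dom) : (A.newN 1).core = A.core := by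
  have h : A.act 0 = var (0 + A.n) := not_not.1 h
  funext i
  simp only [core, show (A.newN 1).n = A.n + 1 from rfl,
    show ∀ y, (A.newN 1).act y = A.act (y + 1) from fun _ => rfl]
  obtain hi | hi | hi := lt_trichotomy i A.n
  · rw [if_pos (by omega), if_pos hi]
  · subst hi; simp [h]
  · rw [if_neg (by omega), if_neg (by omega)]
    congr 1; omega

theorem Ext.core_of_zero (σ : ℕ → L.Term ℕ) (P : Proc L) : (Ext.mk 0 σ P).core = σ := by
  funext i
  simp [core]

theorem Ext.newN_newN_one (A : Ext L) (n : ℕ) : (A.newN n).newN 1 = A.newN (n + 1) :=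
  Ext.ext' (Nat.add_assoc ..) (fun y => by simp only [newN]; congr 1; omega) rfl

/-- All restrictions are peeled off at once; the private names are not in the domain, so `Ext.core`
lets the active substitution fix them. -/
theorem extStep_iff {E : Set ℕ} {A A' : Ext L} {π : Act L} : ExtStep Ax E A π A' ↔
    ∃ B, Step Ax (envN A.n E) A.proc ((π.shiftN A.n).subst A.core) B ∧
      FreshFor A.core (π.shiftN A.n).bn ∧ A' = (Ext.withSubst A.core B).newN A.n := by
  constructor
  · intro h
    induction h with
    | @active E σ P π A h hσ =>
      refine ⟨A, ?_, ?_, ?_⟩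
      · simpa only [Ext.core_of_zero, Act.shiftN_zero, envN_zero] using h
      · simpa only [Ext.core_of_zero, Act.shiftN_zero] using hσ
      · rw [Ext.core_of_zero]; rfl
    | @res E A π B h hA ih =>
      obtain ⟨C, h₁, h₂, rfl⟩ := ih
      refine ⟨C, ?_, ?_, ?_⟩
      · rw [Act.shiftN_shift, extendEnv_eq, envN_envN, Nat.add_comm 1] at h₁
        rw [Ext.core_newN_one hA]
        exact h₁
      · rw [Act.shiftN_shift] at h₂
        rw [Ext.core_newN_one hA]
        exact h₂
      · rw [Ext.core_newN_one hA, Ext.newN_newN_one]; rfl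
  · rintro ⟨B, h₁, h₂, rfl⟩
    obtain ⟨n, φ, P⟩ := A
    induction n generalizing E π φ with
    | zero =>
      simp only [Ext.core_of_zero, Act.shiftN_zero, envN_zero] at h₁ h₂ ⊢
      exact .active h₁ h₂
    | succ n ih =>
      -- Opening the outermost restriction yields a new free variable `0`, which the active
      -- substitution must fix for the restriction rule to apply.
      let A : Ext L := ⟨n, fun y => if y = 0 then var n else φ (y - 1), P⟩
      have hA : 0 ∉ A.dom := by simp [Ext.dom, A]
      have he : Ext.mk (n + 1) φ P = A.newN 1 := Ext.ext' rfl (fun y => by simp [A, Ext.newN]) rfl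
      rw [he, Ext.core_newN_one hA] at h₁ h₂ ⊢
      have h₃ : (A.newN 1).n = n + 1 := rfl
      rw [h₃, ← Act.shiftN_shift] at h₁ h₂
      rw [h₃, ← Ext.newN_newN_one _ n]
      refine .res (ih _ ?_ h₂) hA
      rw [extendEnv_eq, envN_envN, Nat.add_comm]
      exact h₁

theorem envN_empty (n : ℕ) : envN n ∅ = Iio n := by
  ext i
  obtain h | ⟨y, rfl⟩ := lt_or_eq_add n i
  · simp [h, mem_envN_of_lt h]
  · simp

theorem shiftT_subst_core (A : Ext L) (M : L.Term ℕ) :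
    (shiftT A.n M).subst A.core = M.subst A.act := by
  simp only [shiftT_eq, Term.subst_subst, FirstOrder.Language.Term.subst, Ext.core_add]

/-- The residual of an output transition whose payload is recorded as `x`. -/
def Ext.record (A : Ext L) (k x : ℕ) (N : L.Term ℕ) (P' : Proc L) : Ext L :=
  ⟨A.n + k, fun y => if y = x then N else shiftT k (A.act y), P'⟩

theorem withSubst_newN_idAct (A : Ext L) (k : ℕ) (P' : Proc L) :
    (Ext.withSubst A.core ⟨k, idAct k, P'⟩).newN A.n = A.after k P' :=
  Ext.ext' (Nat.add_comm ..) (fun y => by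
    simp only [Ext.newN, Ext.withSubst, Ext.core_add, Ext.after, shiftT_eq]; rfl) rfl

/-- The composition of the two substitutions is their union because `x` is fixed by the active
substitution and occurs in no other of its values. -/
theorem withSubst_newN_singleAct {A : Ext L} {x : ℕ} (hA : A.act x = var (x + A.n))
    (hx : ∀ y, y ≠ x → x + A.n ∉ fvT (A.act y)) (k : ℕ) (N : L.Term ℕ) (P' : Proc L) :
    (Ext.withSubst A.core ⟨k, singleAct k (x + A.n) N, P'⟩).newN A.n = A.record k x N P' := by
  refine Ext.ext' (Nat.add_comm ..) (fun y => ?_) rfl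
  simp only [Ext.newN, Ext.withSubst, Ext.core_add, Ext.record]
  split_ifs with h
  · subst h; rw [hA]; simp [singleAct]
  · rw [shiftT_eq]
    exact Term.subst_congr fun z hz => if_neg fun h' : z = x + A.n => hx y h (h' ▸ hz)

theorem freshFor_core_singleton {A : Ext L} {x : ℕ} :
    FreshFor A.core {x + A.n} ↔
      A.act x = var (x + A.n) ∧ ∀ y, y ≠ x → x + A.n ∉ fvT (A.act y) := by
  constructor
  · rintro ⟨h₁, h₂⟩
    refine ⟨?_, fun y hy => ?_⟩
    · rw [← Ext.core_add]
      exact not_not.1 fun h => disjoint_left.1 h₁ h rfl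
    · rw [← Ext.core_add]
      exact fun h => disjoint_left.1 (h₂ (y + A.n) (by simpa using hy)) h rfl
  · rintro ⟨h₁, h₂⟩
    refine ⟨disjoint_singleton_right.2 fun h => h ?_, fun y hy => disjoint_singleton_right.2 ?_⟩
    · rw [Ext.core_add, h₁]
    · obtain h | ⟨y, rfl⟩ := lt_or_eq_add A.n y
      · simp only [Ext.core, if_pos h, mem_fvT_var]; omega
      · rw [Ext.core_add]
        exact h₂ y fun h => hy (by rw [h]; rfl)

theorem freshFor_empty (σ : ℕ → L.Term ℕ) : FreshFor σ ∅ :=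
  ⟨disjoint_empty _, fun _ _ => disjoint_empty _⟩

theorem extStep_tau_iff {A A' : Ext L} : ExtStep Ax ∅ A .tau A' ↔
    ∃ k P', Tr Ax (Iio A.n) A.proc .tau k P' ∧ A' = A.after k P' := by
  rw [extStep_iff, envN_empty]
  constructor
  · rintro ⟨B, h, -, rfl⟩
    obtain ⟨l, k, P', hr, ht⟩ := h.exists_tr
    cases hr
    exact ⟨k, P', ht, withSubst_newN_idAct ..⟩
  · rintro ⟨k, P', h, rfl⟩
    exact ⟨_, h.toStep (finite_Iio _) (.tau k P') trivial, freshFor_empty _,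
      (withSubst_newN_idAct ..).symm⟩

theorem extStep_inp_iff {A A' : Ext L} {M N : L.Term ℕ} : ExtStep Ax ∅ A (.inp M N) A' ↔
    ∃ k P', Tr Ax (Iio A.n) A.proc (.inp (M.subst A.act)) k P' ∧
      A' = A.after k (P'.subst (instS (shiftT k (N.subst A.act)))) := by
  rw [extStep_iff, envN_empty, Act.shiftN, Act.subst, shiftT_subst_core, shiftT_subst_core]
  constructor
  · rintro ⟨B, h, -, rfl⟩
    obtain ⟨l, k, P', hr, ht⟩ := h.exists_tr
    cases hr
    exact ⟨k, _, ht, withSubst_newN_idAct ..⟩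
  · rintro ⟨k, P', h, rfl⟩
    exact ⟨_, h.toStep (finite_Iio _) (.inp _ _ k P') trivial, freshFor_empty _,
      (withSubst_newN_idAct ..).symm⟩

theorem ExtStep.out_tr {A A' : Ext L} {M : L.Term ℕ} {x : ℕ} (h : ExtStep Ax ∅ A (.out M x) A') :
    ∃ k N P', Tr Ax (Iio A.n) A.proc (.out (M.subst A.act) N) k P' ∧ A' = A.record k x N P' := by
  rw [extStep_iff, envN_empty, Act.shiftN, Act.subst, shiftT_subst_core] at h
  obtain ⟨B, h, hf, rfl⟩ := h
  obtain ⟨l, k, P', hr, ht⟩ := h.exists_tr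
  cases hr
  obtain ⟨h₁, h₂⟩ := freshFor_core_singleton.1 hf
  exact ⟨k, _, P', ht, withSubst_newN_singleAct h₁ h₂ ..⟩

theorem Ext.act_of_notMem_fv {A : Ext L} {x : ℕ} (hx : x ∉ A.fv) : A.act x = var (x + A.n) :=
  not_not.1 fun h => hx (.inl (.inl h))

theorem Ext.notMem_fvT_act {A : Ext L} {x : ℕ} (hx : x ∉ A.fv) {y : ℕ} (hy : y ≠ x) :
    x + A.n ∉ fvT (A.act y) := by
  intro h
  by_cases hd : y ∈ A.dom
  · exact hx (.inl (.inr ⟨y, hd, h⟩))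
  · rw [show A.act y = var (y + A.n) from not_not.1 hd, mem_fvT_var] at h
    omega

theorem Tr.extStep_out {A : Ext L} {M N : L.Term ℕ} {x k : ℕ} {P' : Proc L}
    (h : Tr Ax (Iio A.n) A.proc (.out (M.subst A.act) N) k P') (hx : x ∉ A.fv)
    (hM : x ∉ fvT M) : ExtStep Ax ∅ A (.out M x) (A.record k x N P') := by
  rw [extStep_iff, envN_empty, Act.shiftN, Act.subst, shiftT_subst_core]
  have h₁ := Ext.act_of_notMem_fv hx
  have h₂ := fun y (hy : y ≠ x) => Ext.notMem_fvT_act hx hy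
  refine ⟨_, h.toStep (finite_Iio _) (.out _ _ N k P') ⟨?_, ?_⟩, freshFor_core_singleton.2 ⟨h₁, h₂⟩,
    (withSubst_newN_singleAct h₁ h₂ ..).symm⟩
  · rw [mem_fvT_subst]
    rintro ⟨y, hy, h⟩
    exact h₂ y (fun h => hM (h ▸ hy)) h
  · rintro (h | h)
    · exact hx (.inr h)
    · simp at h

theorem Ext.dom_after (A : Ext L) (k : ℕ) (P' : Proc L) : (A.after k P').dom = A.dom := by
  ext y
  have : (var (y + (A.n + k)) : L.Term ℕ) = shiftT k (var (y + A.n)) := by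
    rw [← Nat.add_assoc]; rfl
  simp only [dom, after, mem_ofPred_eq, this, (shiftT_injective k).ne_iff]

/-- The variable `x` enters the domain unless the payload is `x` itself, which is impossible since
the free names of the payload occur in the sender. Thus domains that agree before an output agree
after it. -/
theorem Tr.dom_record {A : Ext L} {M N : L.Term ℕ} {x k : ℕ} {P' : Proc L}
    (h : Tr Ax (Iio A.n) A.proc (.out M N) k P') (hx : x ∉ A.fv) :
    (A.record k x N P').dom = insert x A.dom := by
  ext y
  by_cases hy : y = x
  · subst hy
    simp only [Ext.dom, Ext.record, mem_ofPred_eq, if_true, mem_insert_iff, true_or, iff_true]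
    intro hN
    refine hx (.inr (h.fv_payload rfl ?_))
    rw [hN, mem_fvT_var, Nat.add_assoc]
  · rw [mem_insert_iff, or_iff_right hy, ← A.dom_after k P']
    simp only [Ext.dom, Ext.record, Ext.after, mem_ofPred_eq, if_neg hy]

namespace Bisim

variable {A B : Ext L}

theorem dom_eq (h : Bisim Ax A B) : A.dom = B.dom := h.2

theorem static (h : Bisim Ax A B) : StaticEquiv Ax A B := by
  obtain ⟨⟨R, hR, h⟩, -⟩ := h
  exact hR.static _ _ h

theorem normal (h : Bisim Ax A B) : A.Normal ∧ B.Normal := by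
  obtain ⟨⟨R, hR, h⟩, -⟩ := h
  exact hR.normal _ _ h

theorem reach {A' B' : Ext L} {σ ρ : ℕ → L.Term ℕ} {zs : List ℕ} (h : Bisim Ax A B)
    (hA : Reach σ zs ρ A A') (hB : Reach σ zs ρ B B') (hd : A'.dom = B'.dom) :
    Bisim Ax A' B' := by
  obtain ⟨⟨R, hR, h⟩, -⟩ := h
  exact ⟨⟨R, hR, hR.isOpen _ _ h _ _ _ _ _ hA hB⟩, hd⟩

theorem tau {k : ℕ} {P' : Proc L} (h : Bisim Ax A B) (ht : Tr Ax (Iio A.n) A.proc .tau k P') :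
    ∃ j Q', Tr Ax (Iio B.n) B.proc .tau j Q' ∧ Bisim Ax (A.after k P') (B.after j Q') := by
  obtain ⟨⟨R, hR, h⟩, hd⟩ := h
  obtain ⟨B', h₁, h₂⟩ := hR.step _ _ h _ _ (extStep_tau_iff.2 ⟨k, P', ht, rfl⟩) (empty_disjoint _)
  obtain ⟨j, Q', h₃, rfl⟩ := extStep_tau_iff.1 h₁
  exact ⟨j, Q', h₃, ⟨R, hR, h₂⟩, by rw [Ext.dom_after, Ext.dom_after, hd]⟩

theorem inp {k : ℕ} {P' : Proc L} {M : L.Term ℕ} (h : Bisim Ax A B)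
    (ht : Tr Ax (Iio A.n) A.proc (.inp (M.subst A.act)) k P') (N : L.Term ℕ) :
    ∃ j Q', Tr Ax (Iio B.n) B.proc (.inp (M.subst B.act)) j Q' ∧
      Bisim Ax (A.after k (P'.subst (instS (shiftT k (N.subst A.act)))))
        (B.after j (Q'.subst (instS (shiftT j (N.subst B.act))))) := by
  obtain ⟨⟨R, hR, h⟩, hd⟩ := h
  obtain ⟨B', h₁, h₂⟩ := hR.step _ _ h _ _ (extStep_inp_iff.2 ⟨k, P', ht, rfl⟩)
    (empty_disjoint _)
  obtain ⟨j, Q', h₃, rfl⟩ := extStep_inp_iff.1 h₁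
  exact ⟨j, Q', h₃, ⟨R, hR, h₂⟩, by rw [Ext.dom_after, Ext.dom_after, hd]⟩

theorem out {k x : ℕ} {P' : Proc L} {M N : L.Term ℕ} (h : Bisim Ax A B)
    (ht : Tr Ax (Iio A.n) A.proc (.out (M.subst A.act) N) k P') (hA : x ∉ A.fv) (hB : x ∉ B.fv)
    (hM : x ∉ fvT M) :
    ∃ N' j Q', Tr Ax (Iio B.n) B.proc (.out (M.subst B.act) N') j Q' ∧
      Bisim Ax (A.record k x N P') (B.record j x N' Q') := by
  obtain ⟨⟨R, hR, h⟩, hd⟩ := h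
  obtain ⟨B', h₁, h₂⟩ := hR.step _ _ h _ _ (ht.extStep_out hA hM)
    (disjoint_singleton_left.2 fun h => h.elim hA hB)
  obtain ⟨j, N', Q', h₃, rfl⟩ := h₁.out_tr
  exact ⟨N', j, Q', h₃, ⟨R, hR, h₂⟩, by rw [ht.dom_record hA, h₃.dom_record hB, hd]⟩

end Bisim

end ExtendedSteps

/-! ### Instances with new private names as reachable extended processes. -/

section Reachability

variable {L : FirstOrder.Language.{u, v}} {Ax : Set (L.Term ℕ × L.Term ℕ)}

/-- Abstraction of the `j` names from `z` on. -/
def abstractS (z j : ℕ) : ℕ → L.Term ℕ :=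
  fun y => if z ≤ y ∧ y < z + j then var (y - z) else var (y + j)

theorem abstractS_succ (z j y : ℕ) :
    (abstractS z j y : L.Term ℕ).subst (liftS j (bindS (z + j))) = abstractS z (j + 1) y := by
  by_cases h : z ≤ y ∧ y < z + j
  · rw [abstractS, abstractS, if_pos h, if_pos (by omega)]
    simp only [FirstOrder.Language.Term.subst]
    rw [liftS_of_lt _ (by omega)]
  · rw [abstractS, if_neg h]
    simp only [FirstOrder.Language.Term.subst, liftS_add_right]
    by_cases h' : y = z + j
    · rw [bindS, if_pos h', abstractS, if_pos (by omega)]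
      change var (0 + j) = _
      congr 1; omega
    · rw [bindS, if_neg h', abstractS, if_neg (by omega)]
      change var (y + 1 + j) = _
      congr 1; omega

/-- The `j` names from `z` on, the largest first. -/
def nameList (z : ℕ) : ℕ → List ℕ
  | 0 => []
  | j + 1 => (z + j) :: nameList z j

theorem mem_nameList {z j y : ℕ} : y ∈ nameList z j ↔ z ≤ y ∧ y < z + j := by
  induction j with
  | zero => simp [nameList]
  | succ j ih => simp only [nameList, List.mem_cons, ih]; omega

/-- Each `Ext.nu` puts its binder outside the existing ones. As the list starts with the largest
name, `z` is bound first, so the name `z + i` ends up as the `i`-th new private name. -/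
theorem foldr_nu_nameList (A : Ext L) (z j : ℕ) :
    (nameList z j).foldr Ext.nu A = ⟨A.n + j,
      fun y => if z ≤ y ∧ y < z + j then var (y + (A.n + j))
        else (A.act y).subst (liftS A.n (abstractS z j)),
      A.proc.subst (liftS A.n (abstractS z j))⟩ := by
  have key : ∀ j, (fun i => (liftS A.n (abstractS z j) i).subst (liftS (A.n + j) (bindS (z + j)))) =
      (liftS A.n (abstractS z (j + 1)) : ℕ → L.Term ℕ) := fun j => by
    rw [Nat.add_comm A.n, ← liftS_liftS, liftS_comp]
    congr 1; funext y; exact abstractS_succ z j y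
  induction j with
  | zero =>
    have : (abstractS z 0 : ℕ → L.Term ℕ) = var := by
      funext y; rw [abstractS, if_neg (by omega)]; rfl
    refine Ext.ext' rfl (fun y => ?_) ?_
    · simp only [this, liftS_var, Term.subst_var]
      rw [if_neg (by omega)]
      rfl
    · simp only [this, liftS_var, Proc.subst_var]; rfl
  | succ j ih =>
    rw [nameList, List.foldr_cons, ih]
    refine Ext.ext' rfl (fun y => ?_) ?_
    · simp only [Ext.nu]
      by_cases h : y = z + j
      · rw [if_pos h, if_pos (by omega)]; rfl
      · rw [if_neg h]
        by_cases h' : z ≤ y ∧ y < z + j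
        · rw [if_pos h', if_pos (by omega)]
          simp only [FirstOrder.Language.Term.subst, liftS_add_right, bindS, if_neg h]
          change var (y + 1 + (A.n + j)) = _
          congr 1; omega
        · rw [if_neg h', if_neg (by omega), Term.subst_subst, key]
    · simp only [Ext.nu, Proc.subst_subst, key]

/-- A bound for the names of an extended process. -/
structure Ext.Below (A : Ext L) (b : ℕ) : Prop where
  dom : ∀ y ∈ A.dom, y < b
  act : ∀ y ∈ A.dom, ∀ w, w + A.n ∈ fvT (A.act y) → w < b
  proc : ∀ w, w + A.n ∈ A.proc.fv → w < b

theorem Ext.Below.mono {A : Ext L} {b c : ℕ} (h : A.Below b) (hc : b ≤ c) : A.Below c :=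
  ⟨fun y hy => (h.dom y hy).trans_le hc, fun y hy w hw => (h.act y hy w hw).trans_le hc,
    fun w hw => (h.proc w hw).trans_le hc⟩

theorem Ext.Normal.exists_below {A : Ext L} (h : A.Normal) : ∃ b, A.Below b := by
  have h₁ : (⋃ y ∈ A.dom, {w | w + A.n ∈ fvT (A.act y)}).Finite :=
    h.1.biUnion fun y _ => (fvT_finite _).preimage (add_left_injective A.n).injOn
  have h₂ : {w | w + A.n ∈ A.proc.fv}.Finite :=
    A.proc.fv_finite.preimage (add_left_injective A.n).injOn
  obtain ⟨b, hb⟩ := ((h.1.union h₁).union h₂).bddAbove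
  have hb : ∀ w, w ∈ A.dom ∪ (⋃ y ∈ A.dom, {w | w + A.n ∈ fvT (A.act y)}) ∪
      {w | w + A.n ∈ A.proc.fv} → w < b + 1 := fun w hw => Nat.lt_succ_of_le (hb hw)
  refine ⟨b + 1, fun y hy => hb y (.inl (.inl hy)), fun y hy w hw => hb w (.inl (.inr ?_)),
    fun w hw => hb w (.inr hw)⟩
  simp only [mem_iUnion]
  exact ⟨y, hy, hw⟩

/-- The names `y + k` become `y + (b + 2 * k + 1)`, and `i < k` becomes `b + k + i`. -/
def nameS (b k : ℕ) : ℕ → L.Term ℕ :=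
  fun i => if i < k then var (b + k + i) else var (i - k + (b + 2 * k + 1))

open Classical in
/-- The substitution of the names below `b` outside `D` by means of `δ`. -/
noncomputable def instantS (D : Set ℕ) (b k : ℕ) (δ : ℕ → L.Term ℕ) : ℕ → L.Term ℕ :=
  fun y => if y < b ∧ y ∉ D then (δ y).subst (nameS b k) else var y

/-- The aliases `b + i` of the names `b + k + i`. -/
def aliasS (b k : ℕ) : ℕ → L.Term ℕ := fun y => if b ≤ y ∧ y < b + k then var (y + k) else var y

theorem nameS_range {b k i y : ℕ} (h : y ∈ fvT (nameS b k i : L.Term ℕ)) :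
    (b + k ≤ y ∧ y < b + 2 * k) ∨ b + 2 * k + 1 ≤ y := by
  rw [nameS] at h
  split_ifs at h <;> rw [mem_fvT_var] at h <;> omega

theorem subst_nameS_range {b k y : ℕ} {M : L.Term ℕ} (h : y ∈ fvT (M.subst (nameS b k))) :
    (b + k ≤ y ∧ y < b + 2 * k) ∨ b + 2 * k + 1 ≤ y := by
  obtain ⟨i, -, h⟩ := (mem_fvT_subst ..).1 h
  exact nameS_range h

theorem mem_domS_instantS {D : Set ℕ} {b k y : ℕ} {δ : ℕ → L.Term ℕ}
    (h : y ∈ domS (instantS D b k δ)) : y < b ∧ y ∉ D := by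
  by_contra h'
  exact h (if_neg h')

theorem mem_domS_aliasS {b k y : ℕ} (h : y ∈ domS (aliasS b k : ℕ → L.Term ℕ)) :
    b ≤ y ∧ y < b + k := by
  by_contra h'
  exact h (if_neg h')

theorem instantS_range {D : Set ℕ} {b k y w : ℕ} {δ : ℕ → L.Term ℕ}
    (h : w ∈ fvT (instantS D b k δ y)) : (w = y ∧ ¬ (y < b ∧ y ∉ D)) ∨ b + k ≤ w := by
  rw [instantS] at h
  split_ifs at h with h'
  · have := subst_nameS_range h; omega
  · exact .inl ⟨(mem_fvT_var _ _).1 h, h'⟩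

theorem aliasS_range {b k y w : ℕ} (h : w ∈ fvT (aliasS b k y : L.Term ℕ)) :
    (w = y ∧ ¬ (b ≤ y ∧ y < b + k)) ∨ b + k ≤ w := by
  rw [aliasS] at h
  split_ifs at h with h' <;> rw [mem_fvT_var] at h <;> omega

/-- The detour through names cancels: a private name is replaced by a free one that `ρ` fixes and
the restrictions bind again, while the other names are merely weakened. The offset makes room for
the names below `b`, the `k` aliases, the `k` temporary names and one spare name. -/
theorem nameS_aliasS_abstractS (b k i : ℕ) :
    ((nameS b k i : L.Term ℕ).subst (aliasS b k)).subst (abstractS (b + k) k) =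
      liftS k (fun y => var (y + (b + 2 * k + 1))) i := by
  obtain h | ⟨y, rfl⟩ := lt_or_eq_add k i
  · rw [nameS, if_pos h, liftS_of_lt _ h]
    simp only [FirstOrder.Language.Term.subst]
    rw [aliasS, if_neg (by omega)]
    simp only [FirstOrder.Language.Term.subst]
    rw [abstractS, if_pos (by omega)]
    congr 1; omega
  · rw [nameS, if_neg (by omega), liftS_add_right]
    simp only [FirstOrder.Language.Term.subst]
    rw [aliasS, if_neg (by omega)]
    simp only [FirstOrder.Language.Term.subst]
    rw [abstractS, if_neg (by omega)]
    change _ = var _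
    congr 1; beta_reduce; omega

theorem Ext.subst_act_of_mem {A : Ext L} {y : ℕ} (h : y ∈ A.dom) (σ : ℕ → L.Term ℕ) :
    (A.subst σ).act y = (A.act y).subst (liftS A.n σ) :=
  if_pos h

theorem Ext.subst_act_of_notMem {A : Ext L} {y : ℕ} (h : y ∉ A.dom) (σ : ℕ → L.Term ℕ) :
    (A.subst σ).act y = var (y + A.n) :=
  if_neg h

/-- `A'` is the instance of `A` by `δ` with `k` exposed private names and weakened names. -/
structure Ext.IsInstance (A : Ext L) (b k : ℕ) (δ : ℕ → L.Term ℕ) (A' : Ext L) : Prop where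
  n_eq : A'.n = A.n + k
  proc_eq : A'.proc = (A.proc.subst (liftS A.n δ)).subst
    (liftS (A.n + k) fun y => var (y + (b + 2 * k + 1)))
  act_dom : ∀ y ∈ A.dom, A'.act y = ((A.act y).subst (liftS A.n δ)).subst
    (liftS (A.n + k) fun y => var (y + (b + 2 * k + 1)))
  act_alias : ∀ i < k, A'.act (b + i) = var (i + A.n)
  act_other : ∀ y ∉ A.dom, ¬ (b ≤ y ∧ y < b + k) → A'.act y = var (y + (A.n + k))

/-- Moving the range of `δ` above `b` makes the substitution idempotent and fresh for the domain,
and finitely many names suffice because only those below `b` occur. Neither finiteness nor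
idempotence of `δ` is needed. -/
theorem exists_reach {A : Ext L} (hA : A.Normal) {b : ℕ} (hb : A.Below b) (k : ℕ)
    (δ : ℕ → L.Term ℕ) : ∃ A', Reach (instantS A.dom b k δ) (nameList (b + k) k) (aliasS b k) A A' ∧
      A.IsInstance b k δ A' := by
  set σ := instantS A.dom b k δ with hσ
  have hσd : FreshFor σ A.dom := by
    refine ⟨disjoint_left.2 fun y h h' => (mem_domS_instantS h).2 h', fun y hy => ?_⟩
    refine disjoint_left.2 fun w hw hw' => ?_
    have := hb.dom w hw'
    obtain ⟨rfl, -⟩ | h := instantS_range hw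
    · exact hy hw'
    · omega
  have hρd : FreshFor (aliasS b k : ℕ → L.Term ℕ) A.dom := by
    refine ⟨disjoint_left.2 fun y h h' => ?_, fun y hy => disjoint_left.2 fun w hw hw' => ?_⟩
    · have := hb.dom y h'; have := mem_domS_aliasS h; omega
    · have := hb.dom w hw'
      obtain ⟨rfl, -⟩ | h := aliasS_range hw
      · exact hy hw'
      · omega
  have hdom : (A.subst σ).dom = A.dom := by
    ext y
    by_cases hy : y ∈ A.dom
    · refine iff_of_true ?_ hy
      change (A.subst σ).act y ≠ var (y + A.n)
      rw [Ext.subst_act_of_mem hy]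
      intro h
      have : y + A.n ∈ fvT ((A.act y).subst (liftS A.n σ)) := by rw [h, mem_fvT_var]
      obtain ⟨w, hw, hw'⟩ := (mem_fvT_subst ..).1 this
      obtain h' | ⟨w, rfl⟩ := lt_or_eq_add A.n w
      · rw [liftS_of_lt _ h', mem_fvT_var] at hw'; omega
      · rw [liftS_add_right, add_mem_fvT_shiftT] at hw'
        have hwd : w ∉ A.dom := fun h => (hA.2 w h).2 y hw
        exact disjoint_left.1 (hσd.2 w hwd) hw' hy
    · refine iff_of_false ?_ hy
      exact not_not.2 (Ext.subst_act_of_notMem hy σ)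
  -- The side condition holds for every name that occurs: `b` bounds the names, and normality keeps
  -- domain variables out of the process and of the values of the active substitution.
  have hcomp : ∀ i, (∀ y, i = y + A.n → y < b ∧ y ∉ A.dom) →
      ((liftS A.n σ i).subst (liftS A.n (aliasS b k))).subst (liftS A.n (abstractS (b + k) k)) =
        (liftS A.n δ i).subst (liftS (A.n + k) fun y => var (y + (b + 2 * k + 1))) := by
    intro i hi
    rw [Nat.add_comm A.n k, ← liftS_liftS]
    obtain h | ⟨y, rfl⟩ := lt_or_eq_add A.n i
    · simp [h]
    · simp only [liftS_add_right, shiftT_subst_liftS]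
      rw [hσ, instantS, if_pos (hi y rfl), Term.subst_subst, Term.subst_subst]
      congr 2; funext i
      rw [← nameS_aliasS_abstractS, Term.subst_subst]
  refine ⟨_, ⟨?_, ?_, ?_, ?_, hσd, hρd, ?_, rfl⟩, ?_⟩
  · exact (finite_Iio b).subset fun y hy => (mem_domS_instantS hy).1
  · exact (finite_Iio (b + k)).subset fun y hy => (mem_domS_aliasS hy).2
  · intro y
    refine disjoint_left.2 fun w hw hw' => ?_
    have h := mem_domS_instantS hw'
    obtain ⟨rfl, h'⟩ | h' := instantS_range hw
    · exact h' h
    · omega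
  · intro y
    refine disjoint_left.2 fun w hw hw' => ?_
    have h := mem_domS_aliasS hw'
    obtain ⟨rfl, h'⟩ | h' := aliasS_range hw
    · exact h' h
    · omega
  · intro z hz
    have hz := mem_nameList.1 hz
    rintro (h | h)
    · have := mem_domS_aliasS h; omega
    · have := hb.dom z h; omega
  · have hact : ∀ y ∉ A.dom, ((A.subst σ).subst (aliasS b k)).act y = var (y + A.n) :=
      fun y hy => Ext.subst_act_of_notMem (hdom ▸ hy) _
    rw [foldr_nu_nameList]
    refine ⟨rfl, ?_, fun y hy => ?_, fun i hi => ?_, fun y hy hy' => ?_⟩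
    · simp only [Ext.withSubst, Ext.subst, Proc.subst_subst]
      refine Proc.subst_congr fun i hi => hcomp i ?_
      rintro y rfl
      exact ⟨hb.proc y hi, fun h => (hA.2 y h).1 hi⟩
    · have := hb.dom y hy
      simp only [Ext.withSubst]
      rw [if_neg (by omega), aliasS, if_neg (by omega)]
      simp only [FirstOrder.Language.Term.subst]
      rw [Ext.subst_act_of_mem (hdom ▸ hy), Ext.subst_act_of_mem hy, Term.subst_subst,
        Term.subst_subst]
      simp only [Term.subst_subst]
      refine Term.subst_congr fun i hi => (Term.subst_subst ..).symm.trans (hcomp i ?_)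
      rintro w rfl
      exact ⟨hb.act y hy w hi, fun h => (hA.2 w h).2 y hi⟩
    · simp only [Ext.withSubst]
      rw [if_neg (by omega), aliasS, if_pos (by omega)]
      simp only [FirstOrder.Language.Term.subst]
      rw [hact _ fun h => by have := hb.dom _ h; omega]
      simp only [FirstOrder.Language.Term.subst]
      change liftS A.n (abstractS (b + k) k) (b + i + k + A.n) = _
      rw [liftS_add_right, abstractS, if_pos (by omega)]
      change var _ = _
      congr 1; beta_reduce; omega
    · simp only [Ext.withSubst]
      split_ifs with h
      · rfl
      · rw [aliasS, if_neg hy']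
        simp only [FirstOrder.Language.Term.subst]
        rw [hact y hy]
        simp only [FirstOrder.Language.Term.subst]
        change liftS A.n (abstractS (b + k) k) (y + A.n) = _
        rw [liftS_add_right, abstractS, if_neg h]
        change var _ = var _
        congr 1; beta_reduce; omega

end Reachability

/-! ### Static equivalence and simulation for maps of bisimilar extended processes. -/

section Instances

variable {L : FirstOrder.Language.{u, v}} {Ax : Set (L.Term ℕ × L.Term ℕ)}

/-- Names of an instance, in terms of the aliases of its exposed names. -/
def exposedS (b k : ℕ) : ℕ → L.Term ℕ :=
  fun i => if i < k then var (b + i) else var (i - k + (b + 2 * k + 1))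

open Classical in
/-- The interface of a renamed image under `Ext.map`, in terms of the interface of an instance. -/
noncomputable def recipeS (D : Set ℕ) (b k : ℕ) (δ : ℕ → L.Term ℕ) : ℕ ⊕ ℕ → L.Term ℕ :=
  Sum.elim (fun z => if z ∈ D then var z else (δ z).subst (exposedS b k)) (exposedS b k)

theorem notMem_fvT_exposedS {b k i : ℕ} : b + 2 * k ∉ fvT (exposedS b k i : L.Term ℕ) := by
  rw [exposedS]
  split_ifs <;> rw [mem_fvT_var] <;> omega

theorem notMem_fvT_recipeS {D : Set ℕ} {b k : ℕ} (hD : ∀ y ∈ D, y < b) (δ : ℕ → L.Term ℕ)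
    (s : ℕ ⊕ ℕ) : b + 2 * k ∉ fvT (recipeS D b k δ s) := by
  cases s with
  | inl z =>
    simp only [recipeS, Sum.elim_inl]
    split_ifs with h
    · have := hD z h
      rw [mem_fvT_var]; omega
    · rw [mem_fvT_subst]
      rintro ⟨i, -, hi⟩
      exact notMem_fvT_exposedS hi
  | inr i => exact notMem_fvT_exposedS

theorem mem_fvT_subst_sum {M : L.Term (ℕ ⊕ ℕ)} {σ : ℕ ⊕ ℕ → L.Term ℕ} {x : ℕ}
    (h : ∀ s, x ∉ fvT (σ s)) : x ∉ fvT (M.subst σ) := by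
  induction M with
  | var s => exact h s
  | func f ts ih =>
    simp only [FirstOrder.Language.Term.subst, mem_fvT_func, not_exists]
    exact ih

theorem le_of_mem_fvT_liftS {n c i y : ℕ}
    (h : y + n ∈ fvT (liftS n (fun y => (var (y + c) : L.Term ℕ)) i)) : c ≤ y := by
  obtain hi | ⟨z, rfl⟩ := lt_or_eq_add n i
  · rw [liftS_of_lt _ hi, mem_fvT_var] at h; omega
  · rw [liftS_add_right, add_mem_fvT_shiftT, mem_fvT_var] at h; omega

namespace Ext.IsInstance

variable {A A' : Ext L} {b k : ℕ} {δ : ℕ → L.Term ℕ}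

theorem dom_eq (h : A.IsInstance b k δ A') (hb : A.Below b) :
    A'.dom = A.dom ∪ {y | b ≤ y ∧ y < b + k} := by
  ext y
  rw [mem_union, mem_ofPred_eq]
  change A'.act y ≠ var (y + A'.n) ↔ _
  by_cases hy : y ∈ A.dom
  · refine iff_of_true (fun h' => ?_) (.inl hy)
    have := hb.dom y hy
    have h'' : y + (A.n + k) ∈ fvT (A'.act y) := by rw [h', h.n_eq, mem_fvT_var]
    rw [h.act_dom y hy, mem_fvT_subst] at h''
    obtain ⟨i, -, hi⟩ := h''
    have := le_of_mem_fvT_liftS hi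
    omega
  · by_cases hy' : b ≤ y ∧ y < b + k
    · refine iff_of_true (fun h' => ?_) (.inr hy')
      obtain ⟨i, rfl⟩ := Nat.exists_eq_add_of_le hy'.1
      rw [h.act_alias i (by omega), h.n_eq] at h'
      injection h' with h'
      omega
    · refine iff_of_false (not_not.2 ?_) (by tauto)
      rw [h.act_other y hy hy', h.n_eq]

/-- The spare name: it lies above aliases and temporary names and just below the weakened ones. It
will name the payload of outputs. -/
theorem notMem_fv (h : A.IsInstance b k δ A') (hb : A.Below b) : b + 2 * k ∉ A'.fv := by
  rintro ((hx | ⟨y, hy, hx⟩) | hx)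
  · rw [h.dom_eq hb] at hx
    obtain hx | ⟨-, hx⟩ := hx
    · have := hb.dom _ hx; omega
    · omega
  · rw [h.dom_eq hb] at hy
    obtain hy | ⟨hy, hy'⟩ := hy
    · rw [h.act_dom y hy, h.n_eq, mem_fvT_subst] at hx
      obtain ⟨i, -, hi⟩ := hx
      have := le_of_mem_fvT_liftS hi
      omega
    · obtain ⟨i, rfl⟩ := Nat.exists_eq_add_of_le hy
      rw [h.act_alias i (by omega), h.n_eq, mem_fvT_var] at hx
      omega
  · rw [mem_ofPred_eq, h.proc_eq, h.n_eq, Proc.mem_fv_subst] at hx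
    obtain ⟨i, -, hi⟩ := hx
    have := le_of_mem_fvT_liftS hi
    omega

/-- New private names are available to recipes through their aliases, domain variables as
themselves, and substituted free names by rebuilding the values of `δ`. Hence the interface of the
map, weakened, is computed from that of the instance. -/
theorem map_sub (h : A.IsInstance b k δ A') (hb : A.Below b) (ξ : ℕ → L.Term (ℕ ⊕ ℕ)) :
    (A.map k δ ξ).sub (fun y => var (y + (b + 2 * k + 1))) =
      A'.reint fun y => (ξ y).subst (recipeS A.dom b k δ) := by
  have hexp : ∀ i, (exposedS b k i).subst A'.act =
      liftS (A.n + k) (fun y => var (y + (b + 2 * k + 1))) (i + A.n) := by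
    intro i
    obtain hi | ⟨y, rfl⟩ := lt_or_eq_add k i
    · rw [exposedS, if_pos hi, liftS_of_lt _ (by omega)]
      exact h.act_alias i hi
    · rw [exposedS, if_neg (by omega), show y + k + A.n = y + (A.n + k) by omega, liftS_add_right]
      simp only [FirstOrder.Language.Term.subst]
      rw [h.act_other _ (fun h => by have := hb.dom _ h; omega) (by omega)]
      change _ = var _
      congr 1; beta_reduce; omega
  refine Ext.ext' h.n_eq.symm (fun y => ?_) h.proc_eq.symm
  simp only [Ext.sub, Ext.map, Ext.reint, Term.subst_subst]
  congr 1
  funext s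
  cases s with
  | inl z =>
    simp only [Sum.elim_inl, recipeS]
    split_ifs with hz
    · exact (h.act_dom z hz).symm
    · rw [show A.act z = var (z + A.n) from not_not.1 hz]
      simp only [FirstOrder.Language.Term.subst, liftS_add_right, Term.subst_subst, hexp, shiftT_eq]
  | inr i =>
    simp only [Sum.elim_inr, recipeS, FirstOrder.Language.Term.subst, hexp]

end Ext.IsInstance

namespace Bisim

variable {A B : Ext L}

/-- Openness requires the same substitutions on both sides; they depend only on the domain and on a
common bound for the names. This is why `Bisim` includes equality of domains. -/
theorem exists_instance (h : Bisim Ax A B) (k : ℕ) (δ : ℕ → L.Term ℕ) :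
    ∃ b A' B', A.Below b ∧ B.Below b ∧ A.IsInstance b k δ A' ∧ B.IsInstance b k δ B' ∧
      Bisim Ax A' B' := by
  obtain ⟨b₁, h₁⟩ := h.normal.1.exists_below
  obtain ⟨b₂, h₂⟩ := h.normal.2.exists_below
  have h₁ := h₁.mono (le_max_left b₁ b₂)
  have h₂ := h₂.mono (le_max_right b₁ b₂)
  obtain ⟨A', hA, hA'⟩ := exists_reach h.normal.1 h₁ k δ
  obtain ⟨B', hB, hB'⟩ := exists_reach h.normal.2 h₂ k δ
  rw [← h.dom_eq] at hB
  exact ⟨_, A', B', h₁, h₂, hA', hB', h.reach hA hB (by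
    rw [hA'.dom_eq h₁, hB'.dom_eq h₂, h.dom_eq])⟩

theorem static_map (h : Bisim Ax A B) (k : ℕ) (δ : ℕ → L.Term ℕ) (ξ : ℕ → L.Term (ℕ ⊕ ℕ)) :
    StaticEquiv Ax (A.map k δ ξ) (B.map k δ ξ) := by
  obtain ⟨b, A', B', h₁, h₂, hA, hB, h'⟩ := h.exists_instance k δ
  have key : ∀ {A A' : Ext L} (_ : A.Below b) (_ : A.IsInstance b k δ A') (M : L.Term ℕ),
      (M.subst fun y => (ξ y).subst (recipeS A.dom b k δ)).subst A'.act =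
        (M.subst (A.map k δ ξ).act).subst
          (liftS (A.n + k) fun y => var (y + (b + 2 * k + 1))) := by
    intro A A' h₁ hA M
    have := congr_arg (fun A : Ext L => M.subst A.act) (hA.map_sub h₁ ξ)
    simp only [Ext.sub, Ext.reint] at this
    rw [Term.subst_subst, Term.subst_subst, ← this]
    rfl
  have hinj : ∀ n, Function.Injective fun i => if i < n then i else i - n + (b + 2 * k + 1) + n := by
    intro n a b hab
    simp only at hab
    split_ifs at hab <;> omega
  intro M N
  have := h'.static (M.subst fun y => (ξ y).subst (recipeS A.dom b k δ))
    (N.subst fun y => (ξ y).subst (recipeS A.dom b k δ))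
  rw [key h₁ hA, key h₁ hA, liftS_ren, eqTheory_ren_iff (hinj _), h.dom_eq, key h₂ hB, key h₂ hB,
    liftS_ren, eqTheory_ren_iff (hinj _)] at this
  exact this

/-- Recipes that avoid `x` can be used in labels while `x` is the bound variable of an output. -/
theorem sim_reint (h : Bisim Ax A B) {x : ℕ} (hA : x ∉ A.fv) (hB : x ∉ B.fv)
    {η : ℕ → L.Term ℕ} (hη : ∀ y, x ∉ fvT (η y)) : Sim Ax (A.reint η) (B.reint η) := by
  have hafter : ∀ (A : Ext L) k P', (A.reint η).after k P' = (A.after k P').reint η := by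
    intro A k P'
    simp only [Ext.after, Ext.reint, subst_comp_shiftT]
  -- The recorded variable `x` supplies entry `0` of the residual's interface; the other recipes do
  -- not notice that it has acquired a value.
  have hrecord : ∀ (A : Ext L) k N P', (A.reint η).afterOut k N P' =
      (A.record k x N P').reint (consS (var x) η) := by
    intro A k N P'
    refine Ext.ext' rfl (fun y => ?_) rfl
    cases y with
    | zero => simp [Ext.afterOut, Ext.reint, Ext.record, consS]
    | succ y =>
      simp only [Ext.afterOut, Ext.reint, Ext.record, consS]
      rw [← subst_comp_shiftT]
      exact Term.subst_congr fun z hz => (if_neg fun h : z = x => hη y (h ▸ hz)).symm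
  refine ⟨fun {k P'} ht => ?_, fun M {N k P'} ht => ?_, fun M N {k P'} ht => ?_⟩
  · obtain ⟨j, Q', h₁, h₂⟩ := h.tau ht
    refine ⟨j, Q', h₁, ?_⟩
    rw [hafter, hafter]
    exact Chain.reint (.single (.base h₂)) η
  · have ht : Tr Ax (Iio A.n) A.proc (.out ((M.subst η).subst A.act) N) k P' := by
      rw [Term.subst_subst]; exact ht
    obtain ⟨N', j, Q', h₁, h₂⟩ := h.out ht hA hB (by
      rw [mem_fvT_subst]
      rintro ⟨y, -, h⟩
      exact hη y h)
    refine ⟨N', j, Q', ?_, ?_⟩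
    · rw [Term.subst_subst] at h₁; exact h₁
    · rw [hrecord, hrecord]
      exact Chain.reint (.single (.base h₂)) _
  · have ht : Tr Ax (Iio A.n) A.proc (.inp ((M.subst η).subst A.act)) k P' := by
      rw [Term.subst_subst]; exact ht
    obtain ⟨j, Q', h₁, h₂⟩ := h.inp ht (N.subst η)
    refine ⟨j, Q', ?_, ?_⟩
    · rw [Term.subst_subst] at h₁; exact h₁
    · rw [hafter, hafter]
      have := Chain.reint (.single (.base h₂)) η
      rw [Term.subst_subst, Term.subst_subst] at this
      exact this

theorem sim_map (h : Bisim Ax A B) (k : ℕ) (δ : ℕ → L.Term ℕ) (ξ : ℕ → L.Term (ℕ ⊕ ℕ)) :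
    Sim Ax (A.map k δ ξ) (B.map k δ ξ) := by
  obtain ⟨b, A', B', h₁, h₂, hA, hB, h'⟩ := h.exists_instance k δ
  refine Sim.of_sub (c := b + 2 * k + 1) ?_
  rw [hA.map_sub h₁, hB.map_sub h₂, ← h.dom_eq]
  exact h'.sim_reint (hA.notMem_fv h₁) (hB.notMem_fv h₂) fun y =>
    mem_fvT_subst_sum fun s => notMem_fvT_recipeS h₁.dom δ s

end Bisim

end Instances

/-! ### The induction over links and the soundness theorem. -/

section Soundness

variable {L : FirstOrder.Language.{u, v}} {Ax : Set (L.Term ℕ × L.Term ℕ)} {A B C : Ext L}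

theorem Sim.trans (h₁ : Sim Ax A B) (h₂ : Sim Ax B C) : Sim Ax A C where
  tau h := by
    obtain ⟨_, _, h, hc⟩ := h₁.tau h
    obtain ⟨_, _, h, hd⟩ := h₂.tau h
    exact ⟨_, _, h, Relation.ReflTransGen.trans hc hd⟩
  out M _ _ _ h := by
    obtain ⟨_, _, _, h, hc⟩ := h₁.out M h
    obtain ⟨_, _, _, h, hd⟩ := h₂.out M h
    exact ⟨_, _, _, h, Relation.ReflTransGen.trans hc hd⟩
  inp M N _ _ h := by
    obtain ⟨_, _, h, hc⟩ := h₁.inp M N h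
    obtain ⟨_, _, h, hd⟩ := h₂.inp M N h
    exact ⟨_, _, h, Relation.ReflTransGen.trans hc hd⟩

theorem Sim.perm_perm (h : Sim Ax A B) {p q : Equiv.Perm ℕ} (hp : ∀ i, A.n ≤ i → p i = i)
    (hq : ∀ i, B.n ≤ i → q i = i) : Sim Ax (A.perm p) (B.perm q) := by
  have := Sim.perm (Ax := Ax) (A.perm p) (p := p.symm)
    fun i hi => (Equiv.symm_apply_eq _).2 (hp i hi).symm
  rw [Ext.perm_symm] at this
  exact (this.trans h).trans (Sim.perm B hq)

theorem Sim.expose (h : ∀ k δ ξ, Sim Ax (A.map k δ ξ) (B.map k δ ξ)) (k : ℕ) :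
    Sim Ax (A.expose k) (B.expose k) := by
  rw [Ext.expose_eq, Ext.expose_eq]
  exact (h _ _ _).perm_perm (fun i hi => blockSwap_of_le hi) fun i hi => blockSwap_of_le hi

theorem Ext.newN_map_act (n a k : ℕ) (φ δ : ℕ → L.Term ℕ) (ξ : ℕ → L.Term (ℕ ⊕ ℕ)) (P Q : Proc L) :
    ((Ext.mk (n + a) (fun y => shiftT a (φ y)) P).map k δ ξ).act =
      fun y => shiftT a (((Ext.mk n φ Q).map k δ ξ).act y) := by
  funext y
  simp only [Ext.map, shiftT_eq a ((ξ y).subst _), Term.subst_subst]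
  congr 1
  funext s
  cases s with
  | inl z => simp only [Sum.elim_inl, ← liftS_liftS, shiftT_subst_liftS, ← shiftT_eq]
  | inr i => simp only [Sum.elim_inr, ← Nat.add_assoc]; rfl

/-- Only the interfaces matter. Operators leave them unchanged up to an injective weakening or
permutation, and for guarded processes, sums and replications the two sides have the same interface.
-/
theorem Link.static_map (h : Link Ax A B) (k : ℕ) (δ : ℕ → L.Term ℕ) (ξ : ℕ → L.Term (ℕ ⊕ ℕ)) :
    StaticEquiv Ax (A.map k δ ξ) (B.map k δ ξ) := by
  induction h generalizing k δ ξ with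
  | base h => exact h.static_map k δ ξ
  | map k' δ' ξ' _ ih => rw [Ext.map_map, Ext.map_map]; exact ih _ _ _
  | perm A hp =>
    rw [Ext.perm_map _ hp]
    intro M N
    simp only [Ext.perm, ← Term.subst_subst]
    exact (eqTheory_ren_iff (Equiv.injective _)).symm
  | par b R _ ih => exact ih k δ ξ
  | @new n m a b φ ψ P Q _ ih =>
    intro M N
    have := ih k δ ξ M N
    rw [Ext.newN_map_act n a k φ δ ξ P (P.newN a), Ext.newN_map_act m b k ψ δ ξ Q (Q.newN b)] at this
    simpa only [subst_comp_shiftT, eqTheory_shiftT_iff] using this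
  | out | inp | mat | mis | plusL | plusR | rep => exact fun M N => .rfl

/-- The generality over maps is used by the parallel case, which needs exposed names and the old
interface, and by replication, whose copies are simulated under further private names. -/
theorem Link.sim_map (h : Link Ax A B) (k : ℕ) (δ : ℕ → L.Term ℕ) (ξ : ℕ → L.Term (ℕ ⊕ ℕ)) :
    Sim Ax (A.map k δ ξ) (B.map k δ ξ) := by
  have operand : ∀ {P Q : Proc L},
      (∀ k δ ξ, Sim Ax ((Ext.ofProc P).map k δ ξ) ((Ext.ofProc Q).map k δ ξ)) →
      ∀ n δ, Sim Ax ⟨n, var, P.subst δ⟩ ⟨n, var, Q.subst δ⟩ := by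
    intro P Q h n δ
    have := h n δ fun y => var (.inr y)
    simp only [Ext.map, Ext.ofProc, Nat.zero_add, liftS_zero] at this
    exact this
  induction h generalizing k δ ξ with
  | base h => exact h.sim_map k δ ξ
  | map k' δ' ξ' _ ih => rw [Ext.map_map, Ext.map_map]; exact ih _ _ _
  | perm A hp => rw [Ext.perm_map _ hp]; exact Sim.perm _ fun i hi => hp i (by
      have : A.n + k ≤ i := hi
      omega)
  | par b R h ih =>
    rw [Ext.parB_map, Ext.parB_map]
    refine Sim.reint (Sim.par (ih _ _ _) (Sim.expose fun _ _ _ => ?_)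
      (transferable_of_static fun _ _ _ => ?_) (.single (h.map _ _ _)) _ _) _
    · rw [Ext.map_map, Ext.map_map]; exact ih _ _ _
    · rw [Ext.map_map, Ext.map_map]; exact h.static_map _ _ _
  | @new n m a b φ ψ P Q _ ih =>
    -- The `k` new names lie outside the `a` restricted ones, so the map leaves the interface free
    -- of the latter and `Sim.newN` applies.
    have key : ∀ (n a : ℕ) (φ : ℕ → L.Term ℕ) (P : Proc L),
        (Ext.mk (n + a) (fun y => shiftT a (φ y)) P).map k δ ξ =
          ⟨n + k + a, fun y => shiftT a (((Ext.mk n φ (P.newN a)).map k δ ξ).act y),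
            P.subst (liftS (n + a) δ)⟩ := fun n a φ P =>
      Ext.ext' (by simp only [Ext.map]; omega)
        (fun y => congr_fun (Ext.newN_map_act n a k φ δ ξ P (P.newN a)) y) rfl
    have := ih k δ ξ
    rw [key, key] at this
    have := this.newN
    rw [← liftS_liftS, ← liftS_liftS, ← Proc.newN_subst, ← Proc.newN_subst] at this
    exact this
  | out M N h ih => exact (Sim.output h k δ _ _).ofProc_map ξ
  | inp M h ih => exact (Sim.input h k δ _).ofProc_map ξ
  | mat M N h ih => exact ((operand ih k δ).mat _ _).ofProc_map ξ
  | mis M N h ih => exact ((operand ih k δ).mis _ _).ofProc_map ξ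
  | plusL R h ih => exact ((operand ih k δ).plusL _).ofProc_map ξ
  | plusR R h ih => exact ((operand ih k δ).plusR _).ofProc_map ξ
  | rep h ih => exact (Sim.rep h (operand ih) k δ).ofProc_map ξ

theorem Link.sim (h : Link Ax A B) : Sim Ax A B := by
  have := h.sim_map 0 var fun y => var (.inl y)
  rwa [Ext.map_zero, Ext.map_zero] at this

/-- Links between processes. -/
def ProcLink (Ax : Set (L.Term ℕ × L.Term ℕ)) (P Q : Proc L) : Prop :=
  Link Ax (.ofProc P) (.ofProc Q)

namespace ProcLink

variable {P Q : Proc L}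

theorem symm (h : ProcLink Ax P Q) : ProcLink Ax Q P := Link.symm h

theorem fill (h : ProcLink Ax P Q) (C : Ctx L) : ProcLink Ax (C.fill P) (C.fill Q) := by
  have hpar : ∀ (P R : Proc L) b,
      (Ext.ofProc P).parB b R = Ext.ofProc (Proc.parB b P R) := fun P R b =>
    Ext.ext' rfl (fun _ => rfl) (congr_arg (Proc.parB b P) R.subst_var)
  induction C with
  | hole => exact h
  | out M N C ih => exact .out M N ih
  | inp M x C ih => exact .inp M (Link.ofProc_map ih 0 (bindS x) _)
  | mat M N C ih => exact .mat M N ih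
  | mis M N C ih => exact .mis M N ih
  | new x C ih =>
    exact Link.new (n := 0) (m := 0) (a := 1) (b := 1) (Link.ofProc_map ih 1 (bindS x) _)
  | parL C R ih =>
    have := Link.par true R ih
    rwa [hpar, hpar] at this
  | parR R C ih =>
    have := Link.par false R ih
    rwa [hpar, hpar] at this
  | plusL C R ih => exact .plusL R ih
  | plusR R C ih => exact .plusR R ih
  | rep C ih => exact .rep ih

/-- Replacing the interface by the plain free names makes it avoid all private names, which can then
be restricted inside the processes, even when their numbers differ. -/
theorem of_link (h : Link Ax A B) : ProcLink Ax (A.proc.newN A.n) (B.proc.newN B.n) := by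
  have := h.map 0 var fun y => var (.inr y)
  have key : ∀ A : Ext L, A.map 0 var (fun y => var (.inr y)) =
      ⟨0 + A.n, fun y => shiftT A.n (idAct 0 y), A.proc⟩ := fun A =>
    Ext.ext' (Nat.zero_add _).symm (fun _ => rfl) (by
      simp only [Ext.map, liftS_var, Proc.subst_var])
  rw [key, key] at this
  exact .new this

theorem tau {P' : Proc L} (h : ProcLink Ax P Q) (ht : TauStep Ax P P') :
    ∃ Q', TauStep Ax Q Q' ∧ Relation.ReflTransGen (ProcLink Ax) P' Q' := by
  obtain ⟨k, P₀, ht, rfl⟩ := ht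
  obtain ⟨l, k, P', hr, h₀⟩ := ht.exists_tr
  cases hr
  rw [← envN_zero ∅, envN_empty] at h₀
  obtain ⟨j, Q', h₁, h₂⟩ := (Link.sim h).tau (A := .ofProc P) h₀
  have h₁ : Tr Ax (Iio 0) Q .tau j Q' := h₁
  rw [← envN_empty, envN_zero] at h₁
  refine ⟨_, ⟨j, Q', h₁.toStep finite_empty (.tau j Q') trivial, rfl⟩, ?_⟩
  have := Relation.ReflTransGen.lift (fun A : Ext L => A.proc.newN A.n) (fun _ _ => of_link) _ _ h₂
  simpa only [Ext.after, Ext.ofProc, Nat.zero_add] using this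

theorem barb {M : L.Term ℕ} (h : ProcLink Ax P Q) (hb : Barb Ax P M) : Barb Ax Q M := by
  have hM : ∀ P : Proc L, M.subst (Ext.ofProc P).act = M := fun _ => Term.subst_var M
  obtain ⟨z, A, ht⟩ | ⟨N, A, ht⟩ := hb
  · obtain ⟨l, k, P', hr, h₀⟩ := ht.exists_tr
    cases hr
    rw [← envN_zero ∅, envN_empty, ← hM P] at h₀
    obtain ⟨N', j, Q', h₁, -⟩ := (Link.sim h).out (A := .ofProc P) M h₀
    rw [hM] at h₁
    have h₁ : Tr Ax (Iio 0) Q (.out M N') j Q' := h₁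
    rw [← envN_empty, envN_zero] at h₁
    obtain ⟨x, hx⟩ := ((fvT_finite M).union (Q.fv_finite.union finite_empty)).infinite_compl.nonempty
    simp only [mem_compl_iff, mem_union, not_or] at hx
    exact .inl ⟨x, _, h₁.toStep finite_empty (.out M x N' j Q')
      ⟨hx.1, fun h => h.elim hx.2.1 hx.2.2⟩⟩
  · obtain ⟨l, k, P', hr, h₀⟩ := ht.exists_tr
    cases hr
    rw [← envN_zero ∅, envN_empty, ← hM P] at h₀
    obtain ⟨j, Q', h₁, -⟩ := (Link.sim h).inp (A := .ofProc P) M N h₀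
    rw [hM] at h₁
    have h₁ : Tr Ax (Iio 0) Q (.inp M) j Q' := h₁
    rw [← envN_empty, envN_zero] at h₁
    exact .inr ⟨N, _, h₁.toStep finite_empty (.inp M N j Q') trivial⟩

/-- Each clause holds for a single link up to a chain, and the reflexive transitive closure absorbs
the chains. -/
theorem isOpenBarbedBisimulation :
    IsOpenBarbedBisimulation Ax (Relation.ReflTransGen (ProcLink Ax)) where
  symm P Q h := by
    induction h with
    | refl => exact .refl
    | tail _ h ih => exact .head h.symm ih
  context P Q h C := Relation.ReflTransGen.lift C.fill (fun _ _ h => ProcLink.fill h C) _ _ h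
  barb P Q h M hb := by
    induction h with
    | refl => exact hb
    | tail _ h ih => exact h.barb ih
  tau P Q h P' ht := by
    induction h with
    | refl => exact ⟨P', ht, .refl⟩
    | tail _ h ih =>
      obtain ⟨Q', h₁, h₂⟩ := ih
      obtain ⟨Q'', h₃, h₄⟩ := h.tau h₁
      exact ⟨Q'', h₃, h₂.trans h₄⟩

end ProcLink

end Soundness


end AppliedPi

theorem corollary3p9 {L : FirstOrder.Language.{u, v}} (Ax : Set (L.Term ℕ × L.Term ℕ))
    (P Q : AppliedPi.Proc L)
    (h : AppliedPi.QuasiOpenBisimilar Ax (AppliedPi.Ext.ofProc P) (AppliedPi.Ext.ofProc Q)) :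
    AppliedPi.OpenBarbedBisimilar Ax P Q :=
  ⟨_, AppliedPi.ProcLink.isOpenBarbedBisimulation, .single (.base ⟨h, rfl⟩)⟩
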